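/- Let $(\Omega,\mathcal F,P)$ be a probability space, $(\mathcal F_t)_{0\le t\le T}$ a filtration such that $\mathcal F_0$ contains all $P$-null sets of $\mathcal F$, and $(S_t)_{0\le t\le T}$ an adapted $\mathbb R^d$-valued process; put $\Delta S_t=S_t-S_{t-1}$. Let $\Xi_t$ be the set of $\mathcal F_t$-measurable $\mathbb R^d$-valued random variables. A strategy is a family $\phi=(\phi_t)_{1\le t\le T}$ with $\phi_t\in\Xi_{t-1}$, and for $c\in\mathbb R$ we write $V_T^{c,\phi}=c+\sum_{t=1}^T\langle\phi_t,\Delta S_t\rangle$. Expectations and conditional expectations of extended real variables are understood in the generalized sense (difference of those of the positive and the negative part, well defined if the two are not both infinite). Let $U:\mathbb R\to\mathbb R$ be concave, strictly increasing and continuously differentiable with $U(0)=0$, and suppose that at least one of the following holds: (a) there are $\tilde x>0$ and $0<\gamma<1$ with $U(\lambda x)\le\lambda^{\gamma}U(x)$ for all $x\ge\tilde x$ and $\lambda\ge1$; (b) there are $\tilde x\le0$ and $\alpha>0$ with $U(\lambda x)\le\lambda^{1+\alpha}U(x)$ for all $x\le\tilde x$ and $\lambda\ge1$. Suppose further that -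 $S$ is bounded, that is, there is a constant $M$ with $|S_t|\le M$ a.s. for all $t$; - (NA) holds: for every strategy $\phi$, if $V_T^{0,\phi}\ge0$ a.s. then $V_T^{0,\phi}=0$ a.s.; - the random functions defined backwards by $U_T(x)=U(x)$ and $$U_t(x)=\operatorname*{ess\,sup}_{\xi\in\Xi_t}E\bigl(U_{t+1}(x+\langle\xi,\Delta S_{t+1}\rangle)\,\big|\,\mathcal F_t\bigr),\qquad 0\le t<T,\ x\in\mathbb R,$$ are well defined (where $U_{t+1}$ is evaluated at a random argument through its version that is right-continuous in $x$, obtained from the rational points), with $U_t(x)<\infty$ a.s. for all $0\le t<T$ and $x\in\mathbb R$, and $EU_0(x)<\infty$ for all $x\in\mathbb R$. Let $c\in\mathbb R$. Call a strategy $\phi^*$ optimal for initial capital $c$ if $EU(V_T^{c,\phi^*})$ is well defined, is less than $\infty$, and equals the supremum of $EU(V_T^{c,\phi})$ over all strategies $\phi$ for which this expectation is well defined. Then an optimal strategy exists, and for every optimal strategy $\phi^*$ one has $0<EU'(V_T^{c,\phi^*})<\infty$, and $$\frac{dQ}{dP}=\frac{U'(V_T^{c,\phi^*})}{EU'(V_T^{c,\phi^*})}$$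 defines a probability measure $Q$ that is equivalent to $P$ and under which $(S_t)_{0\le t\le T}$ is an $(\mathcal F_t)$-martingale. -/

import Mathlib

open MeasureTheory ProbabilityTheory Filter Set

noncomputable section

namespace UtilityMax

/-! ### Extended expectations and conditional expectations -/

section Expectation

variable {Ω : Type*} {mΩ : MeasurableSpace Ω}

/-- The expectation of an extended real random variable is well defined: the positive part or the
negative part has finite expectation. -/
def ExpWellDefined (P : Measure Ω) (X : Ω → EReal) : Prop :=
  (∫⁻ ω, (X ω).toENNReal ∂P) < ⊤ ∨ (∫⁻ ω, (-X ω).toENNReal ∂P) < ⊤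

/-- The extended expectation `E X⁺ - E X⁻`, meaningful under `ExpWellDefined`. Here
`EReal.toENNReal` is the positive part. -/
def extExp (P : Measure Ω) (X : Ω → EReal) : EReal :=
  ((∫⁻ ω, (X ω).toENNReal ∂P : ENNReal) : EReal) -
    ((∫⁻ ω, (-X ω).toENNReal ∂P : ENNReal) : EReal)

/-- The generalized conditional expectation `E(X | m)` is well defined: almost surely
`E(X⁺ | m) < ∞` or `E(X⁻ | m) < ∞`. -/
def CondExpWellDefined (P : Measure Ω) (m : MeasurableSpace Ω) (X : Ω → EReal) : Prop :=
  ∀ᵐ ω ∂P, condLExp m P (fun ω' => (X ω').toENNReal) ω < ⊤ ∨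
    condLExp m P (fun ω' => (-X ω').toENNReal) ω < ⊤

/-- The generalized conditional expectation `E(X | m) = E(X⁺ | m) - E(X⁻ | m)`, meaningful under
`CondExpWellDefined`. -/
def genCondExp (P : Measure Ω) (m : MeasurableSpace Ω) (X : Ω → EReal) : Ω → EReal := fun ω =>
  ((condLExp m P (fun ω' => (X ω').toENNReal) ω : ENNReal) : EReal) -
    ((condLExp m P (fun ω' => (-X ω').toENNReal) ω : ENNReal) : EReal)

/-- `u` is a version (measurable with respect to `m`) of the essential supremum of the family `G`:
an almost sure upper bound of `G` which is almost surely below every other one. -/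
def IsEssSup (P : Measure Ω) (m : MeasurableSpace Ω) (G : Set (Ω → EReal)) (u : Ω → EReal) :
    Prop :=
  Measurable[m] u ∧ (∀ g ∈ G, g ≤ᵐ[P] u) ∧
    ∀ v : Ω → EReal, Measurable[mΩ] v → (∀ g ∈ G, g ≤ᵐ[P] v) → u ≤ᵐ[P] v

/-- The value `W(X(ω), ω)` of a random function at a random point. A random function that is
only given up to a null set for each `x` (as an essential supremum is) is evaluated through its
right-continuous version `x ↦ inf {W(q, ω) : q rational, q > x}`; for the finite-valued
nondecreasing concave random functions met below this is their continuous version. Changing each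
`W x` on a null set changes `randomEval W X` only on a null set. -/
def randomEval (W : ℝ → Ω → EReal) (X : Ω → ℝ) : Ω → EReal := fun ω =>
  ⨅ q : {q : ℚ // X ω < (q : ℝ)}, W ((q : ℚ) : ℝ) ω

end Expectation

/-! ### The utility function -/

/-- Concave nondecreasing utility, `U 0 = 0`, with the growth condition at `+∞`. -/
def ElasticityAtTop (U : ℝ → ℝ) : Prop :=
  ConcaveOn ℝ univ U ∧ Monotone U ∧ U 0 = 0 ∧
    ∃ x₀ γ : ℝ, 0 < x₀ ∧ 0 < γ ∧ γ < 1 ∧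
      ∀ x l : ℝ, x₀ ≤ x → 1 ≤ l → U (l * x) ≤ l ^ γ * U x

/-- Concave nondecreasing utility, `U 0 = 0`, with the growth condition at `-∞`. -/
def ElasticityAtBot (U : ℝ → ℝ) : Prop :=
  ConcaveOn ℝ univ U ∧ Monotone U ∧ U 0 = 0 ∧
    ∃ x₀ α : ℝ, x₀ ≤ 0 ∧ 0 < α ∧
      ∀ x l : ℝ, x ≤ x₀ → 1 ≤ l → U (l * x) ≤ l ^ (1 + α) * U x

/-! ### The market: times `0, …, T`, with `d` assets -/

section Market

variable {Ω : Type*} {mΩ : MeasurableSpace Ω} {T d : ℕ}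

/-- `ΔS`: for `i : Fin T` the increment of the price over the `i`-th trading period, from time
`i.castSucc` to time `i.succ`. -/
def increment (S : Fin (T + 1) → Ω → EuclideanSpace ℝ (Fin d)) (i : Fin T) (ω : Ω) :
    EuclideanSpace ℝ (Fin d) :=
  S i.succ ω - S i.castSucc ω

/-- A trading strategy: the portfolio `φ i` held over the `i`-th period is measurable with respect
to the information at the beginning of that period. -/
def IsStrategy (ℱ : Filtration (Fin (T + 1)) mΩ)
    (φ : Fin T → Ω → EuclideanSpace ℝ (Fin d)) : Prop :=
  ∀ i : Fin T, Measurable[ℱ i.castSucc] (φ i)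

/-- Terminal wealth `V_T^{c, φ} = c + ∑ ⟨φ_i, ΔS_i⟩`. -/
def terminalWealth (S : Fin (T + 1) → Ω → EuclideanSpace ℝ (Fin d)) (c : ℝ)
    (φ : Fin T → Ω → EuclideanSpace ℝ (Fin d)) (ω : Ω) : ℝ :=
  c + ∑ i : Fin T, inner ℝ (φ i ω) (increment S i ω)

/-- Absence of arbitrage. -/
def NoArbitrage (P : Measure Ω) (ℱ : Filtration (Fin (T + 1)) mΩ)
    (S : Fin (T + 1) → Ω → EuclideanSpace ℝ (Fin d)) : Prop :=
  ∀ φ : Fin T → Ω → EuclideanSpace ℝ (Fin d), IsStrategy ℱ φ →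
    (∀ᵐ ω ∂P, 0 ≤ terminalWealth S 0 φ ω) → ∀ᵐ ω ∂P, terminalWealth S 0 φ ω = 0

/-- The one-period objective `U_{t+1}(x + ⟨ξ, ΔS_{t+1}⟩)`, with `W` in the role of `U_{t+1}`. -/
def oneStepUtility (S : Fin (T + 1) → Ω → EuclideanSpace ℝ (Fin d)) (W : ℝ → Ω → EReal)
    (t : Fin T) (x : ℝ) (ξ : Ω → EuclideanSpace ℝ (Fin d)) : Ω → EReal :=
  randomEval W (fun ω => x + inner ℝ (ξ ω) (increment S t ω))

/-- `W t x` is a version of `U_t(x)`, where `U_T(x) = U(x)` and, for `t < T`,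
`U_t(x) = ess sup { E(U_{t+1}(x + ⟨ξ, ΔS_{t+1}⟩) | ℱ_t) : ξ is ℱ_t-measurable }`, all these
conditional expectations being well defined. -/
def IsValueFamily (P : Measure Ω) (ℱ : Filtration (Fin (T + 1)) mΩ)
    (S : Fin (T + 1) → Ω → EuclideanSpace ℝ (Fin d)) (U : ℝ → ℝ)
    (W : Fin (T + 1) → ℝ → Ω → EReal) : Prop :=
  (∀ x ω, W (Fin.last T) x ω = (U x : EReal)) ∧
  ∀ (t : Fin T) (x : ℝ),
    (∀ ξ : Ω → EuclideanSpace ℝ (Fin d), Measurable[ℱ t.castSucc] ξ →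
      CondExpWellDefined P (ℱ t.castSucc) (oneStepUtility S (W t.succ) t x ξ)) ∧
    IsEssSup P (ℱ t.castSucc)
      {Z | ∃ ξ : Ω → EuclideanSpace ℝ (Fin d), Measurable[ℱ t.castSucc] ξ ∧
        Z = genCondExp P (ℱ t.castSucc) (oneStepUtility S (W t.succ) t x ξ)}
      (W t.castSucc x)

/-- The functions `U_t` are well defined, `U_t(x) < ∞` almost surely for `t < T`, and
`E U_0(x) < ∞`, for all `x`. -/
def FiniteValue (P : Measure Ω) (ℱ : Filtration (Fin (T + 1)) mΩ)
    (S : Fin (T + 1) → Ω → EuclideanSpace ℝ (Fin d)) (U : ℝ → ℝ) : Prop :=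
  ∃ W : Fin (T + 1) → ℝ → Ω → EReal, IsValueFamily P ℱ S U W ∧
    (∀ (t : Fin T) (x : ℝ), ∀ᵐ ω ∂P, W t.castSucc x ω < ⊤) ∧
    ∀ x : ℝ, ExpWellDefined P (W 0 x) ∧ extExp P (W 0 x) < ⊤

/-- The utility of terminal wealth, as an extended real random variable. -/
def terminalUtility (S : Fin (T + 1) → Ω → EuclideanSpace ℝ (Fin d)) (U : ℝ → ℝ) (c : ℝ)
    (φ : Fin T → Ω → EuclideanSpace ℝ (Fin d)) (ω : Ω) : EReal :=
  (U (terminalWealth S c φ ω) : EReal)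

/-- `φ` is an optimal strategy for initial capital `c`: among all strategies whose expected utility
`E U(V_T^{c, ·})` is well defined it attains the supremum of the expected utilities, and that
supremum is finite from above. -/
def IsOptimal (P : Measure Ω) (ℱ : Filtration (Fin (T + 1)) mΩ)
    (S : Fin (T + 1) → Ω → EuclideanSpace ℝ (Fin d)) (U : ℝ → ℝ) (c : ℝ)
    (φ : Fin T → Ω → EuclideanSpace ℝ (Fin d)) : Prop :=
  IsStrategy ℱ φ ∧ ExpWellDefined P (terminalUtility S U c φ) ∧
    extExp P (terminalUtility S U c φ) < ⊤ ∧
    ∀ ψ : Fin T → Ω → EuclideanSpace ℝ (Fin d), IsStrategy ℱ ψ →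
      ExpWellDefined P (terminalUtility S U c ψ) →
      extExp P (terminalUtility S U c ψ) ≤ extExp P (terminalUtility S U c φ)

/-- A probability measure `Q`, equivalent to `P`, under which `S` is a martingale. -/
def IsEquivMartingaleMeasure (P Q : Measure Ω) (ℱ : Filtration (Fin (T + 1)) mΩ)
    (S : Fin (T + 1) → Ω → EuclideanSpace ℝ (Fin d)) : Prop :=
  IsProbabilityMeasure Q ∧ Q ≪ P ∧ P ≪ Q ∧ Martingale S ℱ Q

/-- The measure `Q` with `dQ/dP = U'(V_T^{c, φ}) / E U'(V_T^{c, φ})`. -/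
def marginalUtilityMeasure (P : Measure Ω) (S : Fin (T + 1) → Ω → EuclideanSpace ℝ (Fin d))
    (U : ℝ → ℝ) (c : ℝ) (φ : Fin T → Ω → EuclideanSpace ℝ (Fin d)) : Measure Ω :=
  P.withDensity fun ω => ENNReal.ofReal
    (deriv U (terminalWealth S c φ ω) / ∫ ω', deriv U (terminalWealth S c φ ω') ∂P)

end Market

end UtilityMax

end

open MeasureTheory ProbabilityTheory Filter Set

noncomputable section

namespace UtilityMax

/-! ### Generalized conditional expectations -/

section Generalized

variable {Ω : Type*} {m mΩ : MeasurableSpace Ω} {P : Measure Ω}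

/-! The value functions are used only as upper bounds. Along any strategy the process `U_t(V_t)` has
the supermartingale inequality, so if `U(V_T)` has an integrable negative part, its positive part is
integrable too. On an event known at time `t` where `V_t ≤ q`, it is even controlled by one
integrable function that does not depend on the strategy (`FiniteValue.exists_dominating`). Hence
the problem reduces to strategies with integrable utility, over which the supremum is finite.

Existence. Take a maximising sequence. Either elasticity condition bounds `U(x)⁺` by `p U(x/2) + κ
U(x)⁻ + C` with `κ < 1`. Since `E U(V/2)` is bounded above (half the strategy, half the capital),
this bounds `E U(V)⁻`, and by concavity `E V⁻`
(`FiniteValue.exists_lintegral_neg_terminalWealth_le`). Absence of arbitrage gives an equivalent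
measure `Q` with `Q ≤ 2^T P` that centers all bounded portfolios (`exists_centering_measure`); it is
built backwards in time, each factor being minus the derivative of a smooth loss at its minimiser.
Under `Q` the gains of each period are bounded in mean, so a Komlós-type argument
(`exists_convexHull_tendsto`) makes convex combinations of the tails have almost surely convergent
gains. Convergence passes from gains to portfolios after each portfolio is projected onto the
orthogonal complement of the kernel of the conditional second moment operator of the price increment
(`exists_subseq_canonicalRep_tendsto`). The set of strategies with utility at least a given level is
convex, so the combinations still maximise, and the uniform domination makes expected utility upper
semicontinuous along the limit (`FiniteValue.le_integral_of_tendsto`).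

Martingale measure. Difference quotients of a concave `U` are bounded below by the unit-step
quotient, so Fatou turns optimality into `E U'(V)(V' - V) ≤ 0` for every competitor `V'` with the
same capital. Comparing initial capitals `c` and `c + 1` shows that `U'(V)` is integrable
(`IsIntegrableOptimal.integrable_deriv`). Bounded gains may be scaled by any real factor, so `U'(V)`
is orthogonal to all of them (`IsIntegrableOptimal.integral_deriv_mul_gain`), and testing with
buy-and-hold positions on events is the martingale property. -/

theorem randomEval_mono (W : ℝ → Ω → EReal) {X Y : Ω → ℝ} {ω : Ω} (h : X ω ≤ Y ω) :
    randomEval W X ω ≤ randomEval W Y ω :=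
  le_iInf fun q => iInf_le_of_le ⟨q.1, h.trans_lt q.2⟩ le_rfl

theorem randomEval_le (W : ℝ → Ω → EReal) {X : Ω → ℝ} {ω : Ω} {q : ℚ} (h : X ω < q) :
    randomEval W X ω ≤ W q ω :=
  iInf_le_of_le (⟨q, h⟩ : {q : ℚ // X ω < (q : ℝ)}) le_rfl

/-- Locality of conditional expectation: it suffices to compare integrals over `B ∩ s` with `s` in
`m`, where the pointwise inequality is available. -/
theorem condLExp_le_of_le_on (hm : m ≤ mΩ) [SigmaFinite (P.trim hm)] {f g : Ω → ENNReal}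
    {B : Set Ω} (hB : MeasurableSet[m] B) (h : ∀ ω ∈ B, f ω ≤ g ω) :
    ∀ᵐ ω ∂P, ω ∈ B → condLExp m P f ω ≤ condLExp m P g ω := by
  have key : B.indicator (condLExp m P f) ≤ᵐ[P] condLExp m P g := by
    apply ae_le_of_ae_le_trim (hm := hm)
    apply ae_le_of_forall_setLIntegral_le_of_sigmaFinite (μ := P.trim hm)
      ((measurable_condLExp m P f).indicator hB)
    intro s hs _
    rw [setLIntegral_trim hm ((measurable_condLExp m P f).indicator hB) hs,
      setLIntegral_condLExp_trim hm _ _ hs, setLIntegral_indicator (hm B hB),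
      setLIntegral_condLExp hm P f (hB.inter hs)]
    calc ∫⁻ ω in B ∩ s, f ω ∂P ≤ ∫⁻ ω in B ∩ s, g ω ∂P :=
          setLIntegral_mono' (hm _ (hB.inter hs)) fun ω hω => h ω hω.1
      _ ≤ _ := lintegral_mono_set inter_subset_right
  filter_upwards [key] with ω hω hωB
  simpa [hωB] using hω

/-- The one-step inequality for constants extends to random initial positions. -/
theorem genCondExp_randomEval_le (hm : m ≤ mΩ) [SigmaFinite (P.trim hm)] {W W' : ℝ → Ω → EReal}
    {X G : Ω → ℝ} (hX : Measurable[m] X)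
    (h : ∀ x : ℝ, genCondExp P m (randomEval W' fun ω => x + G ω) ≤ᵐ[P] W x) :
    genCondExp P m (randomEval W' fun ω => X ω + G ω) ≤ᵐ[P] randomEval W X := by
  have hset : ∀ q : ℚ, MeasurableSet[m] {ω | X ω < q} := fun q =>
    measurableSet_lt hX measurable_const
  -- On the event `{X < q}` the random start is dominated by the constant start `q`. Only countably
  -- many `q` occur, so the null sets can be collected, and the infimum over `q` is `randomEval W
  -- X`.
  have hmono : ∀ q : ℚ, ∀ ω ∈ {ω | X ω < q}, randomEval W' (fun ω => X ω + G ω) ω ≤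
      randomEval W' (fun ω => (q : ℝ) + G ω) ω := fun q ω hω =>
    randomEval_mono W' (by have : X ω < q := hω; linarith)
  have h1 : ∀ᵐ ω ∂P, ∀ q : ℚ, X ω < q →
      condLExp m P (fun ω => (randomEval W' (fun ω => X ω + G ω) ω).toENNReal) ω ≤
      condLExp m P (fun ω => (randomEval W' (fun ω => (q : ℝ) + G ω) ω).toENNReal) ω :=
    ae_all_iff.2 fun q => condLExp_le_of_le_on hm (hset q) fun ω hω =>
      EReal.toENNReal_le_toENNReal (hmono q ω hω)
  have h2 : ∀ᵐ ω ∂P, ∀ q : ℚ, X ω < q →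
      condLExp m P (fun ω => (-randomEval W' (fun ω => (q : ℝ) + G ω) ω).toENNReal) ω ≤
      condLExp m P (fun ω => (-randomEval W' (fun ω => X ω + G ω) ω).toENNReal) ω :=
    ae_all_iff.2 fun q => condLExp_le_of_le_on hm (hset q) fun ω hω =>
      EReal.toENNReal_le_toENNReal (EReal.neg_le_neg_iff.2 (hmono q ω hω))
  have h3 := ae_all_iff.2 fun q : ℚ => h q
  filter_upwards [h1, h2, h3] with ω hω1 hω2 hω3
  refine le_iInf fun q => le_trans ?_ (hω3 q.1)
  exact EReal.sub_le_sub (EReal.coe_ennreal_le_coe_ennreal_iff.2 (hω1 _ q.2))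
    (EReal.coe_ennreal_le_coe_ennreal_iff.2 (hω2 _ q.2))

/-- The inequality is rearranged without subtraction, so that it can be integrated in `ENNReal` with
no `∞ - ∞`. -/
theorem EReal_parts_of_sub_le {a b : ENNReal} {y : EReal} (hb : b < ⊤)
    (h : (a : EReal) - (b : EReal) ≤ y) :
    a + (-y).toENNReal ≤ y.toENNReal + b ∧ (-y).toENNReal ≤ b := by
  lift b to NNReal using hb.ne
  have eb : (b : ENNReal) = ENNReal.ofReal b := by simp
  have ha0 : a = ⊤ → y = ⊤ := by
    rintro rfl
    exact top_le_iff.1 (by simpa using h)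
  induction y with
  | bot =>
    have ha : a ≠ ⊤ := fun h => by simpa using ha0 h
    lift a to NNReal using ha
    rw [le_bot_iff] at h
    exact absurd h (EReal.coe_ne_bot ((a : ℝ) - (b : ℝ)))
  | top => simp
  | coe y =>
    have ha : a ≠ ⊤ := fun h => by simpa using ha0 h
    lift a to NNReal using ha
    have h' : (a : ℝ) - b ≤ y := EReal.coe_le_coe_iff.1 h
    have e1 : (-(y : EReal)).toENNReal = ENNReal.ofReal (-y) := by
      rw [← EReal.coe_neg]; simp
    have ea : (a : ENNReal) = ENNReal.ofReal a := by simp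
    rw [e1, EReal.toENNReal_of_ne_top (EReal.coe_ne_top y), EReal.toReal_coe, ea, eb]
    refine ⟨?_, ENNReal.ofReal_le_ofReal (by linarith [a.coe_nonneg])⟩
    rcases le_total 0 y with hy | hy
    · rw [ENNReal.ofReal_of_nonpos (by linarith : -y ≤ 0), add_zero,
        ← ENNReal.ofReal_add hy b.coe_nonneg]
      exact ENNReal.ofReal_le_ofReal (by linarith)
    · rw [ENNReal.ofReal_of_nonpos hy, zero_add,
        ← ENNReal.ofReal_add a.coe_nonneg (by linarith)]
      exact ENNReal.ofReal_le_ofReal (by linarith)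

theorem lintegral_parts_of_genCondExp_le (hm : m ≤ mΩ) [SigmaFinite (P.trim hm)]
    {Z Y : Ω → EReal} (h : genCondExp P m Z ≤ᵐ[P] Y)
    (hZ : ∫⁻ ω, (-Z ω).toENNReal ∂P < ⊤) :
    (∫⁻ ω, (-Y ω).toENNReal ∂P ≤ ∫⁻ ω, (-Z ω).toENNReal ∂P) ∧
    ∀ A, MeasurableSet[m] A →
      ∫⁻ ω in A, (Z ω).toENNReal ∂P + ∫⁻ ω in A, (-Y ω).toENNReal ∂P ≤
        ∫⁻ ω in A, (Y ω).toENNReal ∂P + ∫⁻ ω in A, (-Z ω).toENNReal ∂P := by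
  have hfin := condLExp_lt_top (mΩ := m) hZ.ne
  have hae : ∀ᵐ ω ∂P, condLExp m P (fun ω => (Z ω).toENNReal) ω + (-Y ω).toENNReal ≤
      (Y ω).toENNReal + condLExp m P (fun ω => (-Z ω).toENNReal) ω ∧
      (-Y ω).toENNReal ≤ condLExp m P (fun ω => (-Z ω).toENNReal) ω := by
    filter_upwards [hfin, h] with ω h1 h2
    exact EReal_parts_of_sub_le h1 h2
  constructor
  · calc ∫⁻ ω, (-Y ω).toENNReal ∂P ≤ ∫⁻ ω, condLExp m P (fun ω => (-Z ω).toENNReal) ω ∂P :=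
          lintegral_mono_ae (hae.mono fun ω hω => hω.2)
      _ = _ := lintegral_condLExp hm P _
  · intro A hA
    rw [← setLIntegral_condLExp hm P (fun ω => (Z ω).toENNReal) hA,
      ← setLIntegral_condLExp hm P (fun ω => (-Z ω).toENNReal) hA,
      ← lintegral_add_left (measurable_condLExp' m P _),
      ← lintegral_add_right _ (measurable_condLExp' m P _)]
    exact lintegral_mono_ae (ae_restrict_of_ae (hae.mono fun ω hω => hω.1))

end Generalized

/-! ### Wealth processes -/

section Wealth

variable {Ω : Type*} {mΩ : MeasurableSpace Ω} {T d : ℕ}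

/-- The wealth at time `t` of the strategy `φ` started from `c`. -/
def wealthAt (S : Fin (T + 1) → Ω → EuclideanSpace ℝ (Fin d)) (c : ℝ)
    (φ : Fin T → Ω → EuclideanSpace ℝ (Fin d)) (t : Fin (T + 1)) (ω : Ω) : ℝ :=
  c + ∑ i : Fin T with i.castSucc < t, inner ℝ (φ i ω) (increment S i ω)

variable {S : Fin (T + 1) → Ω → EuclideanSpace ℝ (Fin d)} {c : ℝ}
  {φ : Fin T → Ω → EuclideanSpace ℝ (Fin d)} {ℱ : Filtration (Fin (T + 1)) mΩ}

theorem wealthAt_zero : wealthAt S c φ 0 = fun _ => c := by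
  funext ω; simp [wealthAt]

theorem wealthAt_last : wealthAt S c φ (Fin.last T) = terminalWealth S c φ := by
  funext ω
  simp [wealthAt, terminalWealth, Fin.castSucc_lt_last]

theorem wealthAt_succ (i : Fin T) (ω : Ω) : wealthAt S c φ i.succ ω =
    wealthAt S c φ i.castSucc ω + inner ℝ (φ i ω) (increment S i ω) := by
  have : (Finset.univ.filter fun j : Fin T => j.castSucc < i.succ) =
      insert i (Finset.univ.filter fun j : Fin T => j.castSucc < i.castSucc) := by
    ext j
    simp only [Finset.mem_filter, Finset.mem_univ, true_and, Finset.mem_insert, Fin.ext_iff,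
      Fin.lt_def, Fin.val_castSucc, Fin.val_succ]
    omega
  unfold wealthAt
  rw [this, Finset.sum_insert (by simp)]
  ring

theorem measurable_increment (hS : ∀ t, Measurable[ℱ t] (S t)) (i : Fin T) :
    Measurable[ℱ i.succ] (increment S i) :=
  (hS i.succ).sub ((hS i.castSucc).mono (ℱ.mono (Fin.castSucc_le_succ i)) le_rfl)

theorem measurable_gain (hS : ∀ t, Measurable[ℱ t] (S t)) (i : Fin T)
    {ξ : Ω → EuclideanSpace ℝ (Fin d)} (hξ : Measurable[ℱ i.castSucc] ξ) :
    Measurable[ℱ i.succ] fun ω => (inner ℝ (ξ ω) (increment S i ω) : ℝ) :=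
  Measurable.inner (𝕜 := ℝ) (hξ.mono (ℱ.mono (Fin.castSucc_le_succ i)) le_rfl)
    (measurable_increment hS i)

theorem measurable_wealthAt (hS : ∀ t, Measurable[ℱ t] (S t)) (hφ : IsStrategy ℱ φ)
    (t : Fin (T + 1)) : Measurable[ℱ t] (wealthAt S c φ t) := by
  refine measurable_const.add (Finset.measurable_fun_sum _ fun i hi => ?_)
  refine (measurable_gain hS i (hφ i)).mono (ℱ.mono ?_) le_rfl
  have := (Finset.mem_filter.1 hi).2
  simp only [Fin.lt_def, Fin.le_def, Fin.val_castSucc, Fin.val_succ] at this ⊢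
  omega

end Wealth

/-! ### Bounds on expected utility from the value functions -/

section ValueBound

variable {Ω : Type*} {mΩ : MeasurableSpace Ω} {P : Measure Ω} {T d : ℕ}
  {ℱ : Filtration (Fin (T + 1)) mΩ} {S : Fin (T + 1) → Ω → EuclideanSpace ℝ (Fin d)} {U : ℝ → ℝ}
  {W : Fin (T + 1) → ℝ → Ω → EReal}

/-- The value process along a strategy. -/
def valueAlong (W : Fin (T + 1) → ℝ → Ω → EReal)
    (S : Fin (T + 1) → Ω → EuclideanSpace ℝ (Fin d)) (c : ℝ)
    (φ : Fin T → Ω → EuclideanSpace ℝ (Fin d)) (t : Fin (T + 1)) : Ω → EReal :=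
  randomEval (W t) (wealthAt S c φ t)

/-- By continuity of `U`, passing to the infimum over larger rationals changes nothing at the
terminal time. -/
theorem valueAlong_last (hW : IsValueFamily P ℱ S U W) (hU : Monotone U) (hc : Continuous U)
    {φ : Fin T → Ω → EuclideanSpace ℝ (Fin d)} (c : ℝ) (ω : Ω) :
    valueAlong W S c φ (Fin.last T) ω = (U (terminalWealth S c φ ω) : EReal) := by
  unfold valueAlong randomEval
  rw [wealthAt_last]
  simp only [hW.1]
  set x := terminalWealth S c φ ω
  refine le_antisymm ?_ (le_iInf fun q => EReal.coe_le_coe_iff.2 (hU q.2.le))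
  refine EReal.le_of_forall_lt_iff_le.1 fun z hz => ?_
  have hz' : U x < z := EReal.coe_lt_coe_iff.1 hz
  have hev : ∀ᶠ y in nhdsWithin x (Ioi x), U y < z :=
    (hc.tendsto x).mono_left nhdsWithin_le_nhds |>.eventually (gt_mem_nhds hz')
  obtain ⟨y, hy, hy'⟩ := (mem_nhdsGT_iff_exists_Ioo_subset.1 hev)
  obtain ⟨q, hq1, hq2⟩ := exists_rat_btwn (show x < y from hy)
  exact iInf_le_of_le ⟨q, hq1⟩ (EReal.coe_le_coe_iff.2 (le_of_lt (hy' ⟨hq1, hq2⟩)))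

variable [IsProbabilityMeasure P]

theorem genCondExp_valueAlong_le (hW : IsValueFamily P ℱ S U W)
    (hS : ∀ t, Measurable[ℱ t] (S t)) {φ : Fin T → Ω → EuclideanSpace ℝ (Fin d)}
    (hφ : IsStrategy ℱ φ) (c : ℝ) (i : Fin T) :
    genCondExp P (ℱ i.castSucc) (valueAlong W S c φ i.succ) ≤ᵐ[P]
      valueAlong W S c φ i.castSucc := by
  have e : valueAlong W S c φ i.succ = randomEval (W i.succ) fun ω =>
      wealthAt S c φ i.castSucc ω + inner ℝ (φ i ω) (increment S i ω) := by
    unfold valueAlong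
    congr 1
    funext ω
    exact wealthAt_succ i ω
  rw [e]
  refine genCondExp_randomEval_le (ℱ.le _) (measurable_wealthAt hS hφ _) fun x => ?_
  exact (hW.2 i x).2.2.1 _ ⟨φ i, hφ i, rfl⟩

theorem lintegral_parts_valueAlong_succ (hW : IsValueFamily P ℱ S U W)
    (hS : ∀ t, Measurable[ℱ t] (S t)) {φ : Fin T → Ω → EuclideanSpace ℝ (Fin d)}
    (hφ : IsStrategy ℱ φ) (c : ℝ) (i : Fin T)
    (hneg : ∫⁻ ω, (-valueAlong W S c φ i.succ ω).toENNReal ∂P < ⊤) :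
    (∫⁻ ω, (-valueAlong W S c φ i.castSucc ω).toENNReal ∂P ≤
      ∫⁻ ω, (-valueAlong W S c φ i.succ ω).toENNReal ∂P) ∧
    ∀ A, MeasurableSet[ℱ i.castSucc] A →
      ∫⁻ ω in A, (valueAlong W S c φ i.succ ω).toENNReal ∂P +
          ∫⁻ ω in A, (-valueAlong W S c φ i.castSucc ω).toENNReal ∂P ≤
        ∫⁻ ω in A, (valueAlong W S c φ i.castSucc ω).toENNReal ∂P +
          ∫⁻ ω in A, (-valueAlong W S c φ i.succ ω).toENNReal ∂P :=
  lintegral_parts_of_genCondExp_le (ℱ.le i.castSucc) (genCondExp_valueAlong_le hW hS hφ c i) hneg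

/-- Backward iteration of the one-step inequality. The negative parts stay below the terminal one,
hence finite, which is what permits cancelling the intermediate terms. -/
theorem lintegral_parts_valueAlong (hW : IsValueFamily P ℱ S U W)
    (hS : ∀ t, Measurable[ℱ t] (S t)) {φ : Fin T → Ω → EuclideanSpace ℝ (Fin d)}
    (hφ : IsStrategy ℱ φ) (c : ℝ)
    (hneg : ∫⁻ ω, (-valueAlong W S c φ (Fin.last T) ω).toENNReal ∂P < ⊤) (t : Fin (T + 1)) :
    (∫⁻ ω, (-valueAlong W S c φ t ω).toENNReal ∂P ≤
      ∫⁻ ω, (-valueAlong W S c φ (Fin.last T) ω).toENNReal ∂P) ∧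
    ∀ A, MeasurableSet[ℱ t] A →
      ∫⁻ ω in A, (valueAlong W S c φ (Fin.last T) ω).toENNReal ∂P +
          ∫⁻ ω in A, (-valueAlong W S c φ t ω).toENNReal ∂P ≤
        ∫⁻ ω in A, (valueAlong W S c φ t ω).toENNReal ∂P +
          ∫⁻ ω in A, (-valueAlong W S c φ (Fin.last T) ω).toENNReal ∂P := by
  induction t using Fin.reverseInduction with
  | last => exact ⟨le_rfl, fun A _ => le_rfl⟩
  | cast i ih =>
    obtain ⟨h1, h2⟩ := ih
    obtain ⟨h3, h4⟩ := lintegral_parts_valueAlong_succ hW hS hφ c i (h1.trans_lt hneg)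
    refine ⟨h3.trans h1, fun A hA => ?_⟩
    have k1 := h2 A (ℱ.mono (Fin.castSucc_le_succ i) A hA)
    have k2 := h4 A hA
    have n1 : ∫⁻ ω in A, (-valueAlong W S c φ i.succ ω).toENNReal ∂P ≠ ⊤ :=
      ((setLIntegral_le_lintegral A _).trans_lt (h1.trans_lt hneg)).ne
    -- If the right-hand side is infinite there is nothing to show; otherwise the intermediate
    -- positive part is finite and can be cancelled.
    by_cases htop : ∫⁻ ω in A, (valueAlong W S c φ i.castSucc ω).toENNReal ∂P = ⊤
    · rw [htop]; simp
    have n2 : ∫⁻ ω in A, (valueAlong W S c φ i.succ ω).toENNReal ∂P ≠ ⊤ := by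
      refine ((le_self_add.trans k2).trans_lt ?_).ne
      exact ENNReal.add_lt_top.2 ⟨lt_top_iff_ne_top.2 htop, lt_top_iff_ne_top.2 n1⟩
    have k3 := add_le_add k1 k2
    refine (ENNReal.add_le_add_iff_right (ENNReal.add_ne_top.2 ⟨n1, n2⟩)).1 ?_
    calc _ = _ := ?_
      _ ≤ _ := k3
      _ = _ := ?_
    · ring
    · ring

end ValueBound

/-! ### Integrability and uniform upper bounds for the utility of terminal wealth. -/

section UtilityBound

variable {Ω : Type*} {mΩ : MeasurableSpace Ω} {P : Measure Ω} [IsProbabilityMeasure P] {T d : ℕ}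
  {ℱ : Filtration (Fin (T + 1)) mΩ} {S : Fin (T + 1) → Ω → EuclideanSpace ℝ (Fin d)} {U : ℝ → ℝ}

theorem toENNReal_neg_coe (x : ℝ) : (-(x : EReal)).toENNReal = ENNReal.ofReal (-x) := by
  rw [← EReal.coe_neg, EReal.toENNReal_of_ne_top (EReal.coe_ne_top _), EReal.toReal_coe]

theorem toENNReal_coe (x : ℝ) : (x : EReal).toENNReal = ENNReal.ofReal x := by
  rw [EReal.toENNReal_of_ne_top (EReal.coe_ne_top _), EReal.toReal_coe]

theorem isStrategy_zero : IsStrategy ℱ (fun _ _ => 0 : Fin T → Ω → EuclideanSpace ℝ (Fin d)) :=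
  fun _ => measurable_const

theorem terminalWealth_zero (c : ℝ) (ω : Ω) : terminalWealth S c (fun _ _ => 0) ω = c := by
  simp [terminalWealth]

theorem measurable_terminalWealth (hS : ∀ t, Measurable[ℱ t] (S t)) (c : ℝ)
    {φ : Fin T → Ω → EuclideanSpace ℝ (Fin d)} (hφ : IsStrategy ℱ φ) :
    Measurable (terminalWealth S c φ) := by
  rw [← wealthAt_last]
  exact (measurable_wealthAt hS hφ _).mono (ℱ.le _) le_rfl

/-- On an event known at time `t` on which the wealth at time `t` is at most `q`, the positive part
of the utility of terminal wealth is controlled by an integrable function depending only on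
`t` and `q`. -/
theorem FiniteValue.exists_dominating (hfin : FiniteValue P ℱ S U) (hmono : Monotone U)
    (hcont : Continuous U) (hS : ∀ t, Measurable[ℱ t] (S t)) (t : Fin (T + 1)) (q : ℝ) :
    ∃ h : Ω → ENNReal, ∫⁻ ω, h ω ∂P < ⊤ ∧
      ∀ (c : ℝ) (φ : Fin T → Ω → EuclideanSpace ℝ (Fin d)), IsStrategy ℱ φ →
        ∫⁻ ω, ENNReal.ofReal (-U (terminalWealth S c φ ω)) ∂P < ⊤ →
        ∀ A, MeasurableSet[ℱ t] A → (∀ ω ∈ A, wealthAt S c φ t ω ≤ q) →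
          ∫⁻ ω in A, ENNReal.ofReal (U (terminalWealth S c φ ω)) ∂P ≤
            ∫⁻ ω in A, h ω ∂P + ∫⁻ ω in A, ENNReal.ofReal (-U (terminalWealth S c φ ω)) ∂P := by
  obtain ⟨W, hW, -, hW0⟩ := hfin
  have hneg : ∀ (c : ℝ) (φ : Fin T → Ω → EuclideanSpace ℝ (Fin d)) (ω : Ω),
      (-valueAlong W S c φ (Fin.last T) ω).toENNReal =
        ENNReal.ofReal (-U (terminalWealth S c φ ω)) := fun c φ ω => by
    rw [valueAlong_last hW hmono hcont, toENNReal_neg_coe]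
  have hpos : ∀ (c : ℝ) (φ : Fin T → Ω → EuclideanSpace ℝ (Fin d)) (ω : Ω),
      (valueAlong W S c φ (Fin.last T) ω).toENNReal =
        ENNReal.ofReal (U (terminalWealth S c φ ω)) := fun c φ ω => by
    rw [valueAlong_last hW hmono hcont, toENNReal_coe]
  let φ₀ : Fin T → Ω → EuclideanSpace ℝ (Fin d) := fun _ _ => 0
  have hφ₀ : IsStrategy ℱ φ₀ := isStrategy_zero
  have hneg₀ : ∫⁻ ω, (-valueAlong W S q φ₀ (Fin.last T) ω).toENNReal ∂P < ⊤ := by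
    simp only [hneg]
    simp only [φ₀, terminalWealth_zero]
    simp
  -- The dominating function is `U_t(q)⁺`, the value of doing nothing from capital `q`. It is
  -- integrable by forward induction from `E U_0 < ∞`, because the zero strategy has bounded
  -- terminal utility. It dominates because the value functions are evaluated monotonically.
  refine ⟨fun ω => (valueAlong W S q φ₀ t ω).toENNReal, ?_, ?_⟩
  · induction t using Fin.induction with
    | zero =>
      -- The right-continuous version at `q` lies below the value at any rational `r > q`.
      obtain ⟨r, hr, -⟩ := exists_rat_btwn (lt_add_one q)
      obtain ⟨hwd, hlt⟩ := hW0 r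
      have hlt' : ∫⁻ ω, (W 0 r ω).toENNReal ∂P < ⊤ := by
        rcases hwd with h | h
        · exact h
        · by_contra hcon
          rw [not_lt, top_le_iff] at hcon
          lift ∫⁻ ω, (-W 0 r ω).toENNReal ∂P to NNReal using h.ne with b hb
          unfold extExp at hlt
          rw [hcon, ← hb] at hlt
          have : ((b : ENNReal) : EReal) = ((b : ℝ) : EReal) := rfl
          rw [this] at hlt
          simp at hlt
      refine lt_of_le_of_lt (lintegral_mono fun ω => EReal.toENNReal_le_toENNReal ?_) hlt'
      exact randomEval_le _ (by rw [wealthAt_zero]; exact hr)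
    | succ i ih =>
      have h1 := (lintegral_parts_valueAlong hW hS hφ₀ q hneg₀ i.succ).1.trans_lt hneg₀
      have h2 := (lintegral_parts_valueAlong_succ hW hS hφ₀ q i h1).2 univ MeasurableSet.univ
      simp only [Measure.restrict_univ] at h2
      exact (le_self_add.trans h2).trans_lt (ENNReal.add_lt_top.2 ⟨ih, h1⟩)
  · intro c φ hφ hn A hA hq
    have h1 := (lintegral_parts_valueAlong hW hS hφ c (by simpa only [hneg] using hn) t).2 A hA
    simp only [hneg, hpos] at h1
    refine (le_self_add.trans h1).trans (add_le_add ?_ le_rfl)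
    refine setLIntegral_mono' (ℱ.le t A hA) fun ω hω => EReal.toENNReal_le_toENNReal ?_
    refine randomEval_mono _ ((hq ω hω).trans_eq ?_)
    simp [wealthAt, φ₀]

/-- At time `0` the wealth is the constant `c`, so the domination applies on the whole space. -/
theorem FiniteValue.integrable_utility (hfin : FiniteValue P ℱ S U) (hmono : Monotone U)
    (hcont : Continuous U) (hS : ∀ t, Measurable[ℱ t] (S t)) {c : ℝ}
    {φ : Fin T → Ω → EuclideanSpace ℝ (Fin d)} (hφ : IsStrategy ℱ φ)
    (hn : ∫⁻ ω, ENNReal.ofReal (-U (terminalWealth S c φ ω)) ∂P < ⊤) :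
    Integrable (fun ω => U (terminalWealth S c φ ω)) P := by
  obtain ⟨h, hh, H⟩ := hfin.exists_dominating hmono hcont hS 0 c
  have h1 := H c φ hφ hn univ MeasurableSet.univ fun ω _ => by rw [wealthAt_zero]
  simp only [Measure.restrict_univ] at h1
  have h2 : ∫⁻ ω, ENNReal.ofReal (U (terminalWealth S c φ ω)) ∂P < ⊤ :=
    h1.trans_lt (ENNReal.add_lt_top.2 ⟨hh, hn⟩)
  refine ⟨(hcont.measurable.comp (measurable_terminalWealth hS c hφ)).aestronglyMeasurable, ?_⟩
  rw [hasFiniteIntegral_iff_norm]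
  refine lt_of_le_of_lt (lintegral_mono fun ω => ?_) (lt_of_le_of_lt
    (lintegral_add_left (hcont.measurable.comp
      (measurable_terminalWealth hS c hφ)).ennreal_ofReal _).le (ENNReal.add_lt_top.2 ⟨h2, hn⟩))
  change ENNReal.ofReal ‖U (terminalWealth S c φ ω)‖ ≤
    ENNReal.ofReal (U (terminalWealth S c φ ω)) + ENNReal.ofReal (-U (terminalWealth S c φ ω))
  rw [Real.norm_eq_abs]
  rcases abs_cases (U (terminalWealth S c φ ω)) with ⟨h, -⟩ | ⟨h, -⟩ <;> rw [h]
  exacts [le_self_add, le_add_self]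

theorem FiniteValue.exists_setIntegral_le (hfin : FiniteValue P ℱ S U) (hmono : Monotone U)
    (hcont : Continuous U) (hS : ∀ t, Measurable[ℱ t] (S t)) (t : Fin (T + 1)) (q : ℝ) :
    ∃ h : Ω → ENNReal, ∫⁻ ω, h ω ∂P < ⊤ ∧
      ∀ (c : ℝ) (φ : Fin T → Ω → EuclideanSpace ℝ (Fin d)), IsStrategy ℱ φ →
        Integrable (fun ω => U (terminalWealth S c φ ω)) P →
        ∀ A, MeasurableSet[ℱ t] A → (∀ ω ∈ A, wealthAt S c φ t ω ≤ q) →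
          ∫ ω in A, U (terminalWealth S c φ ω) ∂P ≤ (∫⁻ ω in A, h ω ∂P).toReal := by
  obtain ⟨h, hh, H⟩ := hfin.exists_dominating hmono hcont hS t q
  refine ⟨h, hh, fun c φ hφ hint A hA hq => ?_⟩
  have hn : ∫⁻ ω, ENNReal.ofReal (-U (terminalWealth S c φ ω)) ∂P < ⊤ := hint.neg.lintegral_lt_top
  have h1 := H c φ hφ hn A hA hq
  have hnA := (setLIntegral_le_lintegral A _).trans_lt hn
  have hhA := (setLIntegral_le_lintegral A _).trans_lt hh
  rw [integral_eq_lintegral_pos_part_sub_lintegral_neg_part hint.integrableOn]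
  have h2 := ENNReal.toReal_mono (ENNReal.add_ne_top.2 ⟨hhA.ne, hnA.ne⟩) h1
  rw [ENNReal.toReal_add hhA.ne hnA.ne] at h2
  linarith

theorem FiniteValue.exists_integral_le (hfin : FiniteValue P ℱ S U) (hmono : Monotone U)
    (hcont : Continuous U) (hS : ∀ t, Measurable[ℱ t] (S t)) (c : ℝ) :
    ∃ C : ℝ, ∀ φ : Fin T → Ω → EuclideanSpace ℝ (Fin d), IsStrategy ℱ φ →
      Integrable (fun ω => U (terminalWealth S c φ ω)) P →
      ∫ ω, U (terminalWealth S c φ ω) ∂P ≤ C := by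
  obtain ⟨h, hh, H⟩ := hfin.exists_setIntegral_le hmono hcont hS 0 c
  refine ⟨(∫⁻ ω, h ω ∂P).toReal, fun φ hφ hint => ?_⟩
  have := H c φ hφ hint univ MeasurableSet.univ fun ω _ => by rw [wealthAt_zero]
  simpa using this

/-- Optimality in terms of integrable utilities. -/
theorem FiniteValue.isOptimal_iff (hfin : FiniteValue P ℱ S U) (hmono : Monotone U)
    (hcont : Continuous U) (hS : ∀ t, Measurable[ℱ t] (S t)) {c : ℝ}
    {φ : Fin T → Ω → EuclideanSpace ℝ (Fin d)} :
    IsOptimal P ℱ S U c φ ↔ IsStrategy ℱ φ ∧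
      Integrable (fun ω => U (terminalWealth S c φ ω)) P ∧
      ∀ ψ : Fin T → Ω → EuclideanSpace ℝ (Fin d), IsStrategy ℱ ψ →
        Integrable (fun ω => U (terminalWealth S c ψ ω)) P →
        ∫ ω, U (terminalWealth S c ψ ω) ∂P ≤ ∫ ω, U (terminalWealth S c φ ω) ∂P := by
  have hpos : ∀ ψ : Fin T → Ω → EuclideanSpace ℝ (Fin d), ∫⁻ ω,
      (terminalUtility S U c ψ ω).toENNReal ∂P =
        ∫⁻ ω, ENNReal.ofReal (U (terminalWealth S c ψ ω)) ∂P := fun ψ =>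
    lintegral_congr fun ω => toENNReal_coe _
  have hneg : ∀ ψ : Fin T → Ω → EuclideanSpace ℝ (Fin d), ∫⁻ ω,
      (-terminalUtility S U c ψ ω).toENNReal ∂P =
        ∫⁻ ω, ENNReal.ofReal (-U (terminalWealth S c ψ ω)) ∂P := fun ψ =>
    lintegral_congr fun ω => toENNReal_neg_coe _
  have hext : ∀ ψ : Fin T → Ω → EuclideanSpace ℝ (Fin d),
      Integrable (fun ω => U (terminalWealth S c ψ ω)) P →
      extExp P (terminalUtility S U c ψ) = ((∫ ω, U (terminalWealth S c ψ ω) ∂P : ℝ) : EReal) := by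
    intro ψ hint
    have hn : ∫⁻ ω, ENNReal.ofReal (-U (terminalWealth S c ψ ω)) ∂P ≠ ⊤ :=
      hint.neg.lintegral_lt_top.ne
    unfold extExp
    rw [hpos, hneg, integral_eq_lintegral_pos_part_sub_lintegral_neg_part hint, EReal.coe_sub,
      EReal.coe_ennreal_toReal hint.lintegral_lt_top.ne, EReal.coe_ennreal_toReal hn]
  have hwd : ∀ ψ : Fin T → Ω → EuclideanSpace ℝ (Fin d),
      Integrable (fun ω => U (terminalWealth S c ψ ω)) P →
      ExpWellDefined P (terminalUtility S U c ψ) := fun ψ hint =>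
    Or.inl (by rw [hpos]; exact hint.lintegral_lt_top)
  -- A competitor without integrable utility has expected utility `⊥`, so it neither beats an
  -- integrable strategy nor is optimal, since the zero strategy already reaches `U c`.
  have hdich : ∀ ψ : Fin T → Ω → EuclideanSpace ℝ (Fin d), IsStrategy ℱ ψ →
      ExpWellDefined P (terminalUtility S U c ψ) →
      Integrable (fun ω => U (terminalWealth S c ψ ω)) P ∨
        extExp P (terminalUtility S U c ψ) = ⊥ := by
    intro ψ hψ hw
    by_cases hn : ∫⁻ ω, ENNReal.ofReal (-U (terminalWealth S c ψ ω)) ∂P < ⊤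
    · exact Or.inl (hfin.integrable_utility hmono hcont hS hψ hn)
    · right
      unfold extExp
      rw [hneg, top_le_iff.1 (not_lt.1 hn)]
      simp
  constructor
  · rintro ⟨h1, h2, h3, h4⟩
    have hint : Integrable (fun ω => U (terminalWealth S c φ ω)) P := by
      refine (hdich φ h1 h2).resolve_right fun hbot => ?_
      have hz : Integrable (fun ω => U (terminalWealth S c
          (fun _ _ => 0 : Fin T → Ω → EuclideanSpace ℝ (Fin d)) ω)) P := by
        simp only [terminalWealth_zero]
        exact integrable_const _
      have := h4 _ isStrategy_zero (hwd _ hz)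
      rw [hbot, hext _ hz, le_bot_iff] at this
      exact EReal.coe_ne_bot _ this
    refine ⟨h1, hint, fun ψ hψ hψi => ?_⟩
    have := h4 ψ hψ (hwd ψ hψi)
    rwa [hext _ hint, hext _ hψi, EReal.coe_le_coe_iff] at this
  · rintro ⟨h1, hint, h4⟩
    refine ⟨h1, hwd φ hint, by rw [hext _ hint]; exact EReal.coe_lt_top _, fun ψ hψ hw => ?_⟩
    rcases hdich ψ hψ hw with h | h
    · rw [hext _ hint, hext _ h, EReal.coe_le_coe_iff]
      exact h4 ψ hψ h
    · rw [h]; exact bot_le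

end UtilityBound

/-! ### First-order conditions for optimal strategies -/

section FirstOrder

variable {Ω : Type*} {mΩ : MeasurableSpace Ω} {P : Measure Ω} {U : ℝ → ℝ}

theorem tendsto_difference_quotient (hd : Differentiable ℝ U) (x h : ℝ) :
    Tendsto (fun n : ℕ => ((n : ℝ) + 1) * (U (x + ((n : ℝ) + 1)⁻¹ * h) - U x)) atTop
      (nhds (deriv U x * h)) := by
  have h1 : HasDerivAt (fun t : ℝ => U (x + t * h)) (deriv U x * h) 0 := by
    have h2 : HasDerivAt (fun t : ℝ => x + t * h) h 0 := by
      simpa using ((hasDerivAt_id (0 : ℝ)).mul_const h).const_add x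
    have h3 : HasDerivAt U (deriv U x) (x + 0 * h) := by
      rw [zero_mul, add_zero]; exact (hd x).hasDerivAt
    exact h3.comp (0 : ℝ) h2
  have h4 := h1.tendsto_slope_zero
  have h5 : Tendsto (fun n : ℕ => ((n : ℝ) + 1)⁻¹) atTop (nhdsWithin 0 {0}ᶜ) := by
    refine tendsto_nhdsWithin_iff.2 ⟨?_, Eventually.of_forall fun n => ?_⟩
    · simpa using tendsto_one_div_add_atTop_nhds_zero_nat (𝕜 := ℝ)
    · simp only [mem_compl_iff, mem_singleton_iff]
      positivity
  refine (h4.comp h5).congr fun n => ?_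
  simp

/-- Slopes of a concave function grow as the step shrinks. The left side does not depend on `n`,
which gives Fatou its integrable lower bound. -/
theorem ConcaveOn.le_difference_quotient (hU : ConcaveOn ℝ univ U) (x h : ℝ) (n : ℕ) :
    U (x + h) - U x ≤ ((n : ℝ) + 1) * (U (x + ((n : ℝ) + 1)⁻¹ * h) - U x) := by
  have hn : (0 : ℝ) < (n : ℝ) + 1 := by positivity
  have h1 : ((n : ℝ) + 1)⁻¹ ≤ 1 := inv_le_one_of_one_le₀ (by linarith [n.cast_nonneg (α := ℝ)])
  have h2 := hU.2 (mem_univ x) (mem_univ (x + h)) (sub_nonneg.2 h1) (inv_pos.2 hn).le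
    (sub_add_cancel _ _)
  simp only [smul_eq_mul] at h2
  have e : (1 - ((n : ℝ) + 1)⁻¹) * x + ((n : ℝ) + 1)⁻¹ * (x + h) = x + ((n : ℝ) + 1)⁻¹ * h := by
    ring
  rw [e] at h2
  have h3 := mul_le_mul_of_nonneg_left h2 hn.le
  have e2 : ((n : ℝ) + 1) * ((1 - ((n : ℝ) + 1)⁻¹) * U x + ((n : ℝ) + 1)⁻¹ * U (x + h)) =
      n * U x + U (x + h) := by
    field_simp
    ring
  rw [e2] at h3
  linarith

/-- Fatou applied to `f n - g`. Integrability of the limit is part of the conclusion; no domination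
from above is available where it is used. -/
theorem integrable_of_fatou {f : ℕ → Ω → ℝ} {F g : Ω → ℝ} {K : ℝ}
    (hf : ∀ n, Integrable (f n) P) (hg : Integrable g P) (hgf : ∀ n ω, g ω ≤ f n ω)
    (hlim : ∀ ω, Tendsto (fun n => f n ω) atTop (nhds (F ω))) (hK : ∀ n, ∫ ω, f n ω ∂P ≤ K) :
    Integrable F P ∧ ∫ ω, F ω ∂P ≤ K := by
  have hgF : ∀ ω, g ω ≤ F ω := fun ω => ge_of_tendsto' (hlim ω) fun n => hgf n ω
  have hFm : AEStronglyMeasurable F P :=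
    aestronglyMeasurable_of_tendsto_ae atTop (fun n => (hf n).1) (Eventually.of_forall hlim)
  have h1 : ∫⁻ ω, ENNReal.ofReal (F ω - g ω) ∂P ≤ ENNReal.ofReal (K - ∫ ω, g ω ∂P) := by
    have e : ∀ ω, ENNReal.ofReal (F ω - g ω) =
        liminf (fun n => ENNReal.ofReal (f n ω - g ω)) atTop := fun ω =>
      (((ENNReal.continuous_ofReal.tendsto _).comp ((hlim ω).sub_const (g ω))).liminf_eq).symm
    simp only [e]
    refine (lintegral_liminf_le' fun n =>
      ((hf n).1.aemeasurable.sub hg.1.aemeasurable).ennreal_ofReal).trans ?_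
    refine liminf_le_of_le (by isBoundedDefault) fun b hb => ?_
    obtain ⟨n, hn⟩ := hb.exists
    refine hn.trans ?_
    rw [← ofReal_integral_eq_lintegral_ofReal ((hf n).sub hg)
      (Eventually.of_forall fun ω => sub_nonneg.2 (hgf n ω)), integral_sub' (hf n) hg]
    exact ENNReal.ofReal_le_ofReal (by linarith [hK n])
  have hint : Integrable (fun ω => F ω - g ω) P := by
    refine ⟨hFm.sub hg.1, ?_⟩
    rw [hasFiniteIntegral_iff_ofReal (Eventually.of_forall fun ω => sub_nonneg.2 (hgF ω))]
    exact h1.trans_lt ENNReal.ofReal_lt_top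
  have hF : Integrable F P :=
    (hint.add hg).congr (Eventually.of_forall fun ω => sub_add_cancel (F ω) (g ω))
  refine ⟨hF, ?_⟩
  have hKg : 0 ≤ K - ∫ ω, g ω ∂P := by
    have := integral_mono hg (hf 0) (hgf 0)
    linarith [hK 0]
  rw [← ofReal_integral_eq_lintegral_ofReal hint
    (Eventually.of_forall fun ω => sub_nonneg.2 (hgF ω)), ENNReal.ofReal_le_ofReal_iff hKg,
    integral_sub hF hg] at h1
  linarith

/-- The derivative is at least the unit-step slope `U (x + 1) - U x`. -/
theorem deriv_pos_of_concave_strictMono (hU : ConcaveOn ℝ univ U) (hmono : StrictMono U)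
    (hd : Differentiable ℝ U) (x : ℝ) : 0 < deriv U x := by
  have h1 : U (x + 1) - U x ≤ deriv U x * 1 :=
    ge_of_tendsto' (tendsto_difference_quotient hd x 1)
      (ConcaveOn.le_difference_quotient hU x 1)
  have h2 := hmono (lt_add_one x)
  linarith

end FirstOrder

/-! ### Perturbing an optimal strategy. -/

section Optimal

variable {Ω : Type*} {mΩ : MeasurableSpace Ω} {P : Measure Ω} [IsProbabilityMeasure P] {T d : ℕ}
  {ℱ : Filtration (Fin (T + 1)) mΩ} {S : Fin (T + 1) → Ω → EuclideanSpace ℝ (Fin d)} {U : ℝ → ℝ}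

/-- Wealth is linear in capital and strategy jointly; mixing different capitals is essential for the
integrability of the marginal utility. -/
theorem terminalWealth_combo (a b c c' : ℝ) (φ ψ : Fin T → Ω → EuclideanSpace ℝ (Fin d)) (ω : Ω) :
    terminalWealth S (a * c + b * c') (a • φ + b • ψ) ω =
      a * terminalWealth S c φ ω + b * terminalWealth S c' ψ ω := by
  simp only [terminalWealth, Pi.add_apply, Pi.smul_apply, inner_add_left, real_inner_smul_left,
    Finset.sum_add_distrib, ← Finset.mul_sum]
  ring

theorem IsStrategy.combo {φ ψ : Fin T → Ω → EuclideanSpace ℝ (Fin d)} (hφ : IsStrategy ℱ φ)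
    (hψ : IsStrategy ℱ ψ) (a b : ℝ) : IsStrategy ℱ (a • φ + b • ψ) :=
  fun i => ((hφ i).const_smul a).add ((hψ i).const_smul b)

/-- Concavity bounds the negative part of the mixed utility, and the value functions then take care
of the positive part. -/
theorem FiniteValue.integrable_combo (hfin : FiniteValue P ℱ S U) (hmono : Monotone U)
    (hcont : Continuous U) (hconc : ConcaveOn ℝ univ U) (hS : ∀ t, Measurable[ℱ t] (S t))
    {a b c c' : ℝ} (ha : 0 ≤ a) (hb : 0 ≤ b) (hab : a + b = 1)
    {φ ψ : Fin T → Ω → EuclideanSpace ℝ (Fin d)} (hφ : IsStrategy ℱ φ) (hψ : IsStrategy ℱ ψ)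
    (hiφ : Integrable (fun ω => U (terminalWealth S c φ ω)) P)
    (hiψ : Integrable (fun ω => U (terminalWealth S c' ψ ω)) P) :
    Integrable (fun ω => U (a * terminalWealth S c φ ω + b * terminalWealth S c' ψ ω)) P ∧
    a * ∫ ω, U (terminalWealth S c φ ω) ∂P + b * ∫ ω, U (terminalWealth S c' ψ ω) ∂P ≤
      ∫ ω, U (a * terminalWealth S c φ ω + b * terminalWealth S c' ψ ω) ∂P := by
  have hle : ∀ ω, a * U (terminalWealth S c φ ω) + b * U (terminalWealth S c' ψ ω) ≤
      U (a * terminalWealth S c φ ω + b * terminalWealth S c' ψ ω) := fun ω =>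
    hconc.2 (mem_univ _) (mem_univ _) ha hb hab
  have hi2 := (hiφ.const_mul a).add (hiψ.const_mul b)
  have hi : Integrable (fun ω => U (a * terminalWealth S c φ ω + b * terminalWealth S c' ψ ω)) P := by
    simp only [← terminalWealth_combo]
    refine hfin.integrable_utility hmono hcont hS (hφ.combo hψ a b) ?_
    simp only [terminalWealth_combo]
    refine lt_of_le_of_lt (lintegral_mono fun ω => ENNReal.ofReal_le_ofReal
      (neg_le_neg (hle ω))) hi2.neg.lintegral_lt_top
  refine ⟨hi, ?_⟩
  rw [← integral_const_mul, ← integral_const_mul, ← integral_add (hiφ.const_mul a)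
    (hiψ.const_mul b)]
  exact integral_mono hi2 hi hle

/-- An optimal strategy, in terms of integrable utilities. -/
structure IsIntegrableOptimal (P : Measure Ω) (ℱ : Filtration (Fin (T + 1)) mΩ)
    (S : Fin (T + 1) → Ω → EuclideanSpace ℝ (Fin d)) (U : ℝ → ℝ) (c : ℝ)
    (φ : Fin T → Ω → EuclideanSpace ℝ (Fin d)) : Prop where
  isStrategy : IsStrategy ℱ φ
  integrable : Integrable (fun ω => U (terminalWealth S c φ ω)) P
  le : ∀ ψ : Fin T → Ω → EuclideanSpace ℝ (Fin d), IsStrategy ℱ ψ →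
    Integrable (fun ω => U (terminalWealth S c ψ ω)) P →
    ∫ ω, U (terminalWealth S c ψ ω) ∂P ≤ ∫ ω, U (terminalWealth S c φ ω) ∂P

variable {c : ℝ} {φ : Fin T → Ω → EuclideanSpace ℝ (Fin d)}

/-- Fatou for the difference quotients from `φ` towards `ψ`. The capital `c'` may differ from `c`;
the bound `K` on the quotients is left to the caller, since optimality gives it directly only for
`c' = c`. -/
theorem IsIntegrableOptimal.perturb (hφ : IsIntegrableOptimal P ℱ S U c φ)
    (hfin : FiniteValue P ℱ S U) (hmono : Monotone U) (hd : Differentiable ℝ U)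
    (hconc : ConcaveOn ℝ univ U) (hS : ∀ t, Measurable[ℱ t] (S t))
    {c' K : ℝ} {ψ : Fin T → Ω → EuclideanSpace ℝ (Fin d)} (hψ : IsStrategy ℱ ψ)
    (hiψ : Integrable (fun ω => U (terminalWealth S c' ψ ω)) P)
    (hK : ∀ n : ℕ, ((n : ℝ) + 1) * (∫ ω, U ((1 - ((n : ℝ) + 1)⁻¹) * terminalWealth S c φ ω +
      ((n : ℝ) + 1)⁻¹ * terminalWealth S c' ψ ω) ∂P - ∫ ω, U (terminalWealth S c φ ω) ∂P) ≤ K) :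
    Integrable (fun ω => deriv U (terminalWealth S c φ ω) *
      (terminalWealth S c' ψ ω - terminalWealth S c φ ω)) P ∧
    ∫ ω, deriv U (terminalWealth S c φ ω) *
      (terminalWealth S c' ψ ω - terminalWealth S c φ ω) ∂P ≤ K := by
  have e : ∀ (n : ℕ) (x y : ℝ), (1 - ((n : ℝ) + 1)⁻¹) * x + ((n : ℝ) + 1)⁻¹ * y =
      x + ((n : ℝ) + 1)⁻¹ * (y - x) := fun n x y => by ring
  have hi : ∀ n : ℕ, Integrable (fun ω => U (terminalWealth S c φ ω +
      ((n : ℝ) + 1)⁻¹ * (terminalWealth S c' ψ ω - terminalWealth S c φ ω))) P := fun n => by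
    have h1 : ((n : ℝ) + 1)⁻¹ ≤ 1 :=
      inv_le_one_of_one_le₀ (by linarith [n.cast_nonneg (α := ℝ)])
    have := (hfin.integrable_combo hmono hd.continuous hconc hS (sub_nonneg.2 h1)
      (by positivity : (0 : ℝ) ≤ ((n : ℝ) + 1)⁻¹) (sub_add_cancel _ _) hφ.isStrategy hψ
      hφ.integrable hiψ).1
    simpa only [e] using this
  refine integrable_of_fatou (f := fun n ω => ((n : ℝ) + 1) * (U (terminalWealth S c φ ω +
      ((n : ℝ) + 1)⁻¹ * (terminalWealth S c' ψ ω - terminalWealth S c φ ω)) -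
      U (terminalWealth S c φ ω)))
    (g := fun ω => U (terminalWealth S c' ψ ω) - U (terminalWealth S c φ ω))
    (fun n => ((hi n).sub hφ.integrable).const_mul _) (hiψ.sub hφ.integrable)
    (fun n ω => ?_) (fun ω => tendsto_difference_quotient hd _ _) (fun n => ?_)
  · have := ConcaveOn.le_difference_quotient hconc (terminalWealth S c φ ω)
      (terminalWealth S c' ψ ω - terminalWealth S c φ ω) n
    rwa [add_sub_cancel] at this
  · rw [integral_const_mul, integral_sub (hi n) hφ.integrable]
    simpa only [e] using hK n

theorem IsIntegrableOptimal.integral_deriv_mul_le (hφ : IsIntegrableOptimal P ℱ S U c φ)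
    (hfin : FiniteValue P ℱ S U) (hmono : Monotone U) (hd : Differentiable ℝ U)
    (hconc : ConcaveOn ℝ univ U) (hS : ∀ t, Measurable[ℱ t] (S t))
    {ψ : Fin T → Ω → EuclideanSpace ℝ (Fin d)} (hψ : IsStrategy ℱ ψ)
    (hiψ : Integrable (fun ω => U (terminalWealth S c ψ ω)) P) :
    Integrable (fun ω => deriv U (terminalWealth S c φ ω) *
      (terminalWealth S c ψ ω - terminalWealth S c φ ω)) P ∧
    ∫ ω, deriv U (terminalWealth S c φ ω) *
      (terminalWealth S c ψ ω - terminalWealth S c φ ω) ∂P ≤ 0 := by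
  refine hφ.perturb hfin hmono hd hconc hS hψ hiψ fun n => ?_
  have hn : (0 : ℝ) < (n : ℝ) + 1 := by positivity
  have h1 : ((n : ℝ) + 1)⁻¹ ≤ 1 := inv_le_one_of_one_le₀ (by linarith [n.cast_nonneg (α := ℝ)])
  refine mul_nonpos_of_nonneg_of_nonpos hn.le (sub_nonpos.2 ?_)
  have hi := (hfin.integrable_combo hmono hd.continuous hconc hS (sub_nonneg.2 h1)
      (by positivity : (0 : ℝ) ≤ ((n : ℝ) + 1)⁻¹) (sub_add_cancel _ _) hφ.isStrategy hψ
      hφ.integrable hiψ).1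
  have := hφ.le _ (hφ.isStrategy.combo hψ (1 - ((n : ℝ) + 1)⁻¹) (((n : ℝ) + 1)⁻¹))
  have ec : (1 - ((n : ℝ) + 1)⁻¹) * c + ((n : ℝ) + 1)⁻¹ * c = c := by ring
  have e2 := terminalWealth_combo (S := S) (1 - ((n : ℝ) + 1)⁻¹) (((n : ℝ) + 1)⁻¹) c c φ ψ
  rw [ec] at e2
  simp only [e2] at this
  exact this hi

/-- Perturbing towards the constants `c` and `c + 1` makes `U'(V)(c - V)` and `U'(V)(c + 1 - V)`
integrable; their difference is `U'(V)`. -/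
theorem IsIntegrableOptimal.integrable_deriv (hφ : IsIntegrableOptimal P ℱ S U c φ)
    (hfin : FiniteValue P ℱ S U) (hmono : Monotone U) (hd : Differentiable ℝ U)
    (hconc : ConcaveOn ℝ univ U) (hS : ∀ t, Measurable[ℱ t] (S t)) :
    Integrable (fun ω => deriv U (terminalWealth S c φ ω)) P := by
  have hconst : ∀ x : ℝ, Integrable (fun ω => U (terminalWealth S x
      (fun _ _ => 0 : Fin T → Ω → EuclideanSpace ℝ (Fin d)) ω)) P := fun x => by
    simp only [terminalWealth_zero]
    exact integrable_const _
  have h1 := (hφ.integral_deriv_mul_le hfin hmono hd hconc hS isStrategy_zero (hconst c)).1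
  -- The maximal expected utility is concave in the capital, so its slope to the right of `c` is at
  -- most a slope to the left, which `u - U (c - 1)` bounds because the zero strategy is available
  -- from `c - 1`.
  have h2 := (hφ.perturb (c' := c + 1) (K := ∫ ω, U (terminalWealth S c φ ω) ∂P - U (c - 1))
    hfin hmono hd hconc hS isStrategy_zero (hconst (c + 1)) fun n => ?_).1
  · refine (h2.sub h1).congr (Eventually.of_forall fun ω => ?_)
    simp only [Pi.sub_apply, terminalWealth_zero]
    ring
  · have hn : (0 : ℝ) < (n : ℝ) + 1 := by positivity
    have hn0 : (0 : ℝ) ≤ n := n.cast_nonneg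
    have hinv : ((n : ℝ) + 1)⁻¹ ≤ 1 := inv_le_one_of_one_le₀ (by linarith)
    set u := ∫ ω, U (terminalWealth S c φ ω) ∂P
    set r := ((n : ℝ) + 1)⁻¹
    have hr0 : 0 ≤ r := (inv_pos.2 hn).le
    set φ₀ : Fin T → Ω → EuclideanSpace ℝ (Fin d) := fun _ _ => 0
    have hφ₀ : IsStrategy ℱ φ₀ := isStrategy_zero
    set χ := (1 - r) • φ + r • φ₀
    have hχ : IsStrategy ℱ χ := hφ.isStrategy.combo hφ₀ _ _
    set c₁ := (1 - r) * c + r * (c + 1)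
    have e1 : ∀ ω, terminalWealth S c₁ χ ω =
      (1 - r) * terminalWealth S c φ ω + r * terminalWealth S (c + 1) φ₀ ω :=
      terminalWealth_combo _ _ _ _ _ _
    have hiχ : Integrable (fun ω => U (terminalWealth S c₁ χ ω)) P := by
      simp only [e1]
      exact (hfin.integrable_combo hmono hd.continuous hconc hS (sub_nonneg.2 hinv) hr0
        (sub_add_cancel _ _) hφ.isStrategy hφ₀ hφ.integrable (hconst (c + 1))).1
    -- These weights mix capital `c + 1/(n + 1)` with capital `c - 1` to exactly `c`, where
    -- optimality of `φ` applies.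
    set a := ((n : ℝ) + 1) / ((n : ℝ) + 2)
    set b := 1 / ((n : ℝ) + 2)
    have hab : a + b = 1 := by simp only [a, b]; field_simp; ring
    have h3 := hfin.integrable_combo hmono hd.continuous hconc hS (a := a) (b := b)
      (by positivity) (by positivity) hab hχ hφ₀ hiχ (hconst (c - 1))
    have hcc : a * c₁ + b * (c - 1) = c := by
      simp only [a, b, c₁, r]
      field_simp
      ring
    have e2 := terminalWealth_combo (S := S) a b c₁ (c - 1) χ φ₀
    rw [hcc] at e2
    have h4 := hφ.le _ (hχ.combo hφ₀ a b)
    simp only [e2] at h4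
    have h5 := h3.2.trans (h4 h3.1)
    simp only [φ₀, terminalWealth_zero, integral_const, probReal_univ, smul_eq_mul, one_mul] at h5
    simp only [← e1]
    change ((n : ℝ) + 1) * (∫ ω, U (terminalWealth S c₁ χ ω) ∂P - u) ≤ u - U (c - 1)
    set v := ∫ ω, U (terminalWealth S c₁ χ ω) ∂P
    have h6 : a * v + b * U (c - 1) ≤ u := h5
    simp only [a, b] at h6
    have h7 : ((n : ℝ) + 1) * v + U (c - 1) ≤ u * ((n : ℝ) + 2) := by
      have h8 := mul_le_mul_of_nonneg_right h6 (by positivity : (0 : ℝ) ≤ (n : ℝ) + 2)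
      have e3 : ((((n : ℝ) + 1) / ((n : ℝ) + 2)) * v + (1 / ((n : ℝ) + 2)) * U (c - 1)) *
          ((n : ℝ) + 2) = ((n : ℝ) + 1) * v + U (c - 1) := by field_simp
      rwa [e3] at h8
    linarith

/-- Holding `k ψ` from capital `c` gives bounded wealth for every real `k`, so it is an admissible
competitor. The first-order inequality then bounds `k I` above for all `k` of both signs, which
forces `I = 0`. -/
theorem IsIntegrableOptimal.integral_deriv_mul_gain (hφ : IsIntegrableOptimal P ℱ S U c φ)
    (hfin : FiniteValue P ℱ S U) (hmono : Monotone U) (hd : Differentiable ℝ U)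
    (hconc : ConcaveOn ℝ univ U) (hS : ∀ t, Measurable[ℱ t] (S t))
    {ψ : Fin T → Ω → EuclideanSpace ℝ (Fin d)} (hψ : IsStrategy ℱ ψ) {B : ℝ}
    (hB : ∀ᵐ ω ∂P, |terminalWealth S 0 ψ ω| ≤ B) :
    ∫ ω, deriv U (terminalWealth S c φ ω) * terminalWealth S 0 ψ ω ∂P = 0 := by
  have hY := hφ.integrable_deriv hfin hmono hd hconc hS
  have hWm := measurable_terminalWealth hS 0 hψ
  have hYW : Integrable (fun ω => deriv U (terminalWealth S c φ ω) * terminalWealth S 0 ψ ω) P :=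
    hY.mul_bdd (c := B) hWm.aestronglyMeasurable (by simpa [Real.norm_eq_abs] using hB)
  have hconst : Integrable (fun ω => U (terminalWealth S c
      (fun _ _ => 0 : Fin T → Ω → EuclideanSpace ℝ (Fin d)) ω)) P := by
    simp only [terminalWealth_zero]
    exact integrable_const _
  have h1 := (hφ.integral_deriv_mul_le hfin hmono hd hconc hS isStrategy_zero hconst).1
  simp only [terminalWealth_zero] at h1
  have key : ∀ k : ℝ, k * ∫ ω, deriv U (terminalWealth S c φ ω) * terminalWealth S 0 ψ ω ∂P ≤
      -∫ ω, deriv U (terminalWealth S c φ ω) * (c - terminalWealth S c φ ω) ∂P := by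
    intro k
    set χ : Fin T → Ω → EuclideanSpace ℝ (Fin d) := k • ψ + (1 : ℝ) • (fun _ _ => 0)
    have hχ : IsStrategy ℱ χ := hψ.combo isStrategy_zero k 1
    have e : ∀ ω, terminalWealth S c χ ω = k * terminalWealth S 0 ψ ω + c := by
      intro ω
      have := terminalWealth_combo (S := S) k 1 0 c ψ (fun _ _ => 0) ω
      rw [terminalWealth_zero, one_mul, mul_zero, zero_add] at this
      exact this
    have hiχ : Integrable (fun ω => U (terminalWealth S c χ ω)) P := by
      refine hfin.integrable_utility hmono hd.continuous hS hχ ?_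
      refine lt_of_le_of_lt (b := ∫⁻ _, ENNReal.ofReal (-U (-(|k| * B) + c)) ∂P)
        (lintegral_mono_ae ?_) (by simp)
      filter_upwards [hB] with ω hω
      refine ENNReal.ofReal_le_ofReal (neg_le_neg (hmono ?_))
      rw [e]
      have : |k * terminalWealth S 0 ψ ω| ≤ |k| * B := by
        rw [abs_mul]; exact mul_le_mul_of_nonneg_left hω (abs_nonneg k)
      linarith [neg_abs_le (k * terminalWealth S 0 ψ ω)]
    have h2 := (hφ.integral_deriv_mul_le hfin hmono hd hconc hS hχ hiχ).2
    have e3 : ∀ ω, deriv U (terminalWealth S c φ ω) *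
        (terminalWealth S c χ ω - terminalWealth S c φ ω) =
        k * (deriv U (terminalWealth S c φ ω) * terminalWealth S 0 ψ ω) +
        deriv U (terminalWealth S c φ ω) * (c - terminalWealth S c φ ω) := fun ω => by
      rw [e]; ring
    simp only [e3] at h2
    rw [integral_add (hYW.const_mul k) h1, integral_const_mul] at h2
    linarith
  set I := ∫ ω, deriv U (terminalWealth S c φ ω) * terminalWealth S 0 ψ ω ∂P
  set a := -∫ ω, deriv U (terminalWealth S c φ ω) * (c - terminalWealth S c φ ω) ∂P
  by_contra hI
  have := key ((a + 1) / I)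
  rw [div_mul_cancel₀ _ hI] at this
  linarith

end Optimal

/-! ### The marginal utility measure -/

section MartingaleMeasure

variable {Ω : Type*} {mΩ : MeasurableSpace Ω} {P : Measure Ω} [IsProbabilityMeasure P] {T d : ℕ}
  {ℱ : Filtration (Fin (T + 1)) mΩ} {S : Fin (T + 1) → Ω → EuclideanSpace ℝ (Fin d)}

theorem sum_increment (i j : Fin (T + 1)) (hij : i ≤ j) (ω : Ω) :
    ∑ k : Fin T with i ≤ k.castSucc ∧ k.castSucc < j, increment S k ω = S j ω - S i ω := by
  induction j using Fin.induction with
  | zero =>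
    obtain rfl : i = 0 := nonpos_iff_eq_zero.1 hij
    simp
  | succ k ih =>
    rcases hij.eq_or_lt with rfl | hlt
    · rw [Finset.filter_eq_empty_iff.2, Finset.sum_empty, sub_self]
      intro l _ hl
      exact absurd hl.1 (not_le.2 hl.2)
    · have hik : i ≤ k.castSucc := Fin.le_castSucc_iff.2 hlt
      have : (Finset.univ.filter fun l : Fin T => i ≤ l.castSucc ∧ l.castSucc < k.succ) =
          insert k (Finset.univ.filter fun l : Fin T =>
            i ≤ l.castSucc ∧ l.castSucc < k.castSucc) := by
        ext l
        simp only [Finset.mem_filter, Finset.mem_univ, true_and, Finset.mem_insert, Fin.ext_iff,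
          Fin.lt_def, Fin.le_def, Fin.val_castSucc, Fin.val_succ] at hik ⊢
        omega
      rw [this, Finset.sum_insert (by simp), ih hik]
      simp only [increment]
      abel

/-- A positive integrable random variable orthogonal to all bounded gains is, after normalization,
the density of an equivalent martingale measure. -/
theorem isEquivMartingaleMeasure_withDensity (hS : ∀ t, Measurable[ℱ t] (S t)) {M : ℝ}
    (hM : ∀ t, ∀ᵐ ω ∂P, ‖S t ω‖ ≤ M) {Y : Ω → ℝ} (hYi : Integrable Y P) (hYpos : ∀ ω, 0 < Y ω)
    (hY : ∀ ψ : Fin T → Ω → EuclideanSpace ℝ (Fin d), IsStrategy ℱ ψ →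
      (∃ B : ℝ, ∀ᵐ ω ∂P, |terminalWealth S 0 ψ ω| ≤ B) →
      ∫ ω, Y ω * terminalWealth S 0 ψ ω ∂P = 0) :
    0 < ∫ ω, Y ω ∂P ∧
    IsEquivMartingaleMeasure P (P.withDensity fun ω => ENNReal.ofReal (Y ω / ∫ ω', Y ω' ∂P))
      ℱ S := by
  have hEY : 0 < ∫ ω, Y ω ∂P := by
    rw [integral_pos_iff_support_of_nonneg (fun ω => (hYpos ω).le) hYi]
    have : Function.support Y = univ := by
      ext ω; simp [(hYpos ω).ne']
    rw [this]; simp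
  refine ⟨hEY, ?_⟩
  set a := ∫ ω, Y ω ∂P
  set D : Ω → ENNReal := fun ω => ENNReal.ofReal (Y ω / a) with hD
  have hDm : AEMeasurable D P := (hYi.1.aemeasurable.div_const a).ennreal_ofReal
  have hDint : ∫⁻ ω, D ω ∂P = 1 := by
    rw [hD, ← ofReal_integral_eq_lintegral_ofReal (hYi.div_const a)
      (Eventually.of_forall fun ω => (div_pos (hYpos ω) hEY).le), integral_div, div_self hEY.ne']
    simp
  have hQprob : IsProbabilityMeasure (P.withDensity D) :=
    ⟨by rw [withDensity_apply _ MeasurableSet.univ, Measure.restrict_univ, hDint]⟩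
  have hQP : P.withDensity D ≪ P := withDensity_absolutelyContinuous P D
  have hPQ : P ≪ P.withDensity D := withDensity_absolutelyContinuous' hDm
    (Eventually.of_forall fun ω => (ENNReal.ofReal_pos.2 (div_pos (hYpos ω) hEY)).ne')
  refine ⟨hQprob, hQP, hPQ, fun t => (hS t).stronglyMeasurable, fun i j hij => ?_⟩
  have hSm : ∀ t, Measurable (S t) := fun t => (hS t).mono (ℱ.le t) le_rfl
  have hSi : ∀ t, Integrable (S t) (P.withDensity D) := fun t =>
    Integrable.of_bound (hSm t).aestronglyMeasurable M (hQP (hM t))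
  refine (ae_eq_condExp_of_forall_setIntegral_eq (ℱ.le i) (hSi j)
    (fun A _ _ => (hSi i).integrableOn) (fun A hA _ => ?_)
    (hS i).stronglyMeasurable.aestronglyMeasurable).symm
  have hA' : MeasurableSet A := ℱ.le i A hA
  rw [eq_comm, ← sub_eq_zero, ← integral_sub (hSi j).integrableOn (hSi i).integrableOn]
  -- The vector identity is tested against each `e`: holding `e` on `A` during the periods between
  -- `i` and `j` has terminal gain `⟨e, S_j - S_i⟩` on `A` and `0` elsewhere.
  refine ext_inner_left ℝ fun e => ?_
  rw [inner_zero_right, ← integral_inner (f := fun ω => S j ω - S i ω) ((hSi j).sub (hSi i)).integrableOn,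
    ← integral_indicator hA']
  let ψ : Fin T → Ω → EuclideanSpace ℝ (Fin d) := fun k =>
    if i ≤ k.castSucc ∧ k.castSucc < j then A.indicator (fun _ => e) else fun _ => 0
  have hψ : IsStrategy ℱ ψ := fun k => by
    by_cases h : i ≤ k.castSucc ∧ k.castSucc < j
    · simp only [ψ, if_pos h]
      exact measurable_const.indicator (ℱ.mono h.1 A hA)
    · simp only [ψ, if_neg h]
      exact measurable_const
  have hW : ∀ ω, terminalWealth S 0 ψ ω =
      A.indicator (fun ω => (inner ℝ e (S j ω - S i ω) : ℝ)) ω := by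
    intro ω
    rw [terminalWealth, zero_add]
    by_cases hω : ω ∈ A
    · rw [indicator_of_mem hω, ← sum_increment i j hij, inner_sum, Finset.sum_filter]
      refine Finset.sum_congr rfl fun k _ => ?_
      by_cases h : i ≤ k.castSucc ∧ k.castSucc < j
      · simp only [ψ, if_pos h, indicator_of_mem hω]
      · simp only [ψ, if_neg h, inner_zero_left]
    · rw [indicator_of_notMem hω]
      refine Finset.sum_eq_zero fun k _ => ?_
      by_cases h : i ≤ k.castSucc ∧ k.castSucc < j
      · simp only [ψ, if_pos h, indicator_of_notMem hω, inner_zero_left]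
      · simp only [ψ, if_neg h, inner_zero_left]
  have hbd : ∃ B : ℝ, ∀ᵐ ω ∂P, |terminalWealth S 0 ψ ω| ≤ B := by
    refine ⟨‖e‖ * (M + M), ?_⟩
    filter_upwards [hM i, hM j] with ω h1 h2
    rw [hW]
    by_cases hω : ω ∈ A
    · rw [indicator_of_mem hω]
      refine (abs_real_inner_le_norm _ _).trans (mul_le_mul_of_nonneg_left ?_ (norm_nonneg e))
      exact (norm_sub_le _ _).trans (add_le_add h2 h1)
    · rw [indicator_of_notMem hω, abs_zero]
      exact mul_nonneg (norm_nonneg e) (by linarith [norm_nonneg (S i ω)])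
  have h0 := hY ψ hψ hbd
  rw [integral_withDensity_eq_integral_toReal_smul₀ hDm
    (Eventually.of_forall fun ω => ENNReal.ofReal_lt_top)]
  have : ∀ ω, (D ω).toReal • A.indicator (fun ω => (inner ℝ e (S j ω - S i ω) : ℝ)) ω =
      a⁻¹ * (Y ω * terminalWealth S 0 ψ ω) := fun ω => by
    rw [hW, smul_eq_mul, ENNReal.toReal_ofReal (div_pos (hYpos ω) hEY).le]
    ring
  simp only [this]
  rw [integral_const_mul, h0, mul_zero]

theorem IsIntegrableOptimal.isEquivMartingaleMeasure {U : ℝ → ℝ} {c : ℝ}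
    {φ : Fin T → Ω → EuclideanSpace ℝ (Fin d)} (hφ : IsIntegrableOptimal P ℱ S U c φ)
    (hfin : FiniteValue P ℱ S U) (hmono : StrictMono U) (hd : Differentiable ℝ U)
    (hconc : ConcaveOn ℝ univ U) (hS : ∀ t, Measurable[ℱ t] (S t)) {M : ℝ}
    (hM : ∀ t, ∀ᵐ ω ∂P, ‖S t ω‖ ≤ M) :
    Integrable (fun ω => deriv U (terminalWealth S c φ ω)) P ∧
      0 < ∫ ω, deriv U (terminalWealth S c φ ω) ∂P ∧
      IsEquivMartingaleMeasure P (marginalUtilityMeasure P S U c φ) ℱ S := by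
  have hY := hφ.integrable_deriv hfin hmono.monotone hd hconc hS
  exact ⟨hY, isEquivMartingaleMeasure_withDensity hS hM hY
    (fun ω => deriv_pos_of_concave_strictMono hconc hmono hd _)
    fun ψ hψ ⟨B, hB⟩ => hφ.integral_deriv_mul_gain hfin hmono.monotone hd hconc hS hψ hB⟩

end MartingaleMeasure

/-! ### Convergence of convex combinations -/

section Komlos

variable {Ω : Type*} {mΩ : MeasurableSpace Ω} {μ : Measure Ω}

/-- Pointwise `|a| ≤ 2^k a² + 2^(-k)`, and the weighted squares are summable in mean because `2^k /
8^k = 4^(-k)`. -/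
theorem ae_summable_of_integral_sq_le {a : ℕ → Ω → ℝ} (ha : ∀ k, Measurable (a k))
    (hi : ∀ k, ∫⁻ ω, ENNReal.ofReal ((a k ω) ^ 2) ∂μ ≤ ENNReal.ofReal ((1 / 8 : ℝ) ^ k)) :
    ∀ᵐ ω ∂μ, Summable fun k => |a k ω| := by
  have h1 : ∫⁻ ω, ∑' k, ENNReal.ofReal (2 ^ k * (a k ω) ^ 2) ∂μ ≠ ⊤ := by
    rw [lintegral_tsum fun k => (((ha k).pow_const 2).const_mul _).ennreal_ofReal.aemeasurable]
    have h2 : ∀ k, ∫⁻ ω, ENNReal.ofReal (2 ^ k * (a k ω) ^ 2) ∂μ ≤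
        ENNReal.ofReal ((1 / 4 : ℝ) ^ k) := fun k => by
      have e : ∀ ω, ENNReal.ofReal (2 ^ k * (a k ω) ^ 2) =
          ENNReal.ofReal (2 ^ k) * ENNReal.ofReal ((a k ω) ^ 2) := fun ω =>
        ENNReal.ofReal_mul (by positivity)
      simp only [e]
      rw [lintegral_const_mul _ ((ha k).pow_const 2).ennreal_ofReal]
      refine (mul_le_mul_right (hi k) _).trans ?_
      rw [← ENNReal.ofReal_mul (by positivity), ← mul_pow]
      norm_num
    refine ((ENNReal.tsum_le_tsum h2).trans_lt ?_).ne
    rw [← ENNReal.ofReal_tsum_of_nonneg (fun k => by positivity)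
      (summable_geometric_of_lt_one (by norm_num) (by norm_num))]
    exact ENNReal.ofReal_lt_top
  have hm : Measurable fun ω => ∑' k, ENNReal.ofReal (2 ^ k * (a k ω) ^ 2) :=
    Measurable.tsum fun k => (((ha k).pow_const 2).const_mul _).ennreal_ofReal
  filter_upwards [ae_lt_top hm h1] with ω hω
  have h3 : Summable fun k => 2 ^ k * (a k ω) ^ 2 := by
    have := ENNReal.summable_toReal hω.ne
    refine this.congr fun k => ?_
    rw [ENNReal.toReal_ofReal (by positivity)]
  have h4 : Summable fun k : ℕ => (1 / 2 : ℝ) ^ k :=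
    summable_geometric_of_lt_one (by norm_num) (by norm_num)
  refine Summable.of_nonneg_of_le (fun k => abs_nonneg _) (fun k => ?_) (h3.add h4)
  have hk : (0 : ℝ) < 2 ^ k := by positivity
  have e : (1 / 2 : ℝ) ^ k = (2 ^ k)⁻¹ := by rw [one_div, inv_pow]
  rw [e]
  rcases le_total (|a k ω|) ((2 ^ k)⁻¹) with h | h
  · have : 0 ≤ 2 ^ k * (a k ω) ^ 2 := by positivity
    linarith
  · have h5 : 1 ≤ 2 ^ k * |a k ω| := by
      have := mul_le_mul_of_nonneg_left h hk.le
      rwa [mul_inv_cancel₀ hk.ne'] at this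
    have h6 : |a k ω| ≤ 2 ^ k * (a k ω) ^ 2 := by
      rw [← sq_abs]
      nlinarith [abs_nonneg (a k ω)]
    have : (0 : ℝ) ≤ (2 ^ k)⁻¹ := by positivity
    linarith

/-- Divergence to infinity puts `ω` in the increasing union over `N` of the events that all `f n`,
`n ≥ N`, exceed `a`; each of these has measure at most `ε`. -/
theorem measure_setOf_tendsto_atTop_eq_zero {f : ℕ → Ω → ℝ}
    (hb : ∀ ε : ENNReal, 0 < ε → ∃ a : ℝ, ∀ n, μ {ω | a < f n ω} ≤ ε) :
    ∀ᵐ ω ∂μ, ¬Tendsto (fun n => f n ω) atTop atTop := by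
  rw [ae_iff]
  simp only [not_not]
  refine le_antisymm (le_of_forall_pos_le_add fun ε hε => ?_) zero_le
  rw [zero_add]
  obtain ⟨a, ha⟩ := hb ε hε
  have hmono : Monotone fun N => {ω : Ω | ∀ n, N ≤ n → a < f n ω} :=
    fun N N' h ω hω n hn => hω n (h.trans hn)
  calc μ {ω | Tendsto (fun n => f n ω) atTop atTop} ≤ μ (⋃ N, {ω | ∀ n, N ≤ n → a < f n ω}) := by
        refine measure_mono fun ω hω => ?_
        obtain ⟨N, hN⟩ := eventually_atTop.1 (hω.eventually (eventually_gt_atTop a))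
        exact mem_iUnion.2 ⟨N, hN⟩
    _ = ⨆ N, μ {ω | ∀ n, N ≤ n → a < f n ω} := hmono.measure_iUnion
    _ ≤ ε := iSup_le fun N => (measure_mono fun ω (hω : ∀ n, N ≤ n → a < f n ω) =>
        hω N le_rfl).trans (ha N)

variable [IsFiniteMeasure μ] {E ι : Type*} [AddCommGroup E] [Module ℝ E] [Fintype ι]

/-- If the convex combinations of a sequence of finite families of nonnegative random variables are
bounded in probability, then suitable convex combinations of the tails converge almost surely. -/
theorem exists_convexHull_tendsto (L : E →ₗ[ℝ] (ι → Ω → ℝ)) (x : ℕ → E)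
    (hmeas : ∀ y ∈ convexHull ℝ (range x), ∀ i, Measurable (L y i))
    (hpos : ∀ y ∈ convexHull ℝ (range x), ∀ i ω, 0 ≤ L y i ω)
    (hb : ∀ ε : ENNReal, 0 < ε → ∃ a : ℝ, ∀ y ∈ convexHull ℝ (range x), ∀ i,
      μ {ω | a < L y i ω} ≤ ε) :
    ∃ y : ℕ → E, (∀ n, y n ∈ convexHull ℝ (x '' Ici n)) ∧
      ∀ᵐ ω ∂μ, ∀ i, ∃ l : ℝ, Tendsto (fun n => L (y n) i ω) atTop (nhds l) := by
  have hsub : ∀ n, convexHull ℝ (x '' Ici n) ⊆ convexHull ℝ (range x) := fun n =>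
    convexHull_mono (image_subset_range _ _)
  have hanti : ∀ n k, n ≤ k → convexHull ℝ (x '' Ici k) ⊆ convexHull ℝ (x '' Ici n) := fun n k h =>
    convexHull_mono (image_mono (Ici_subset_Ici.2 h))
  -- With this transform the squared value at a midpoint is the product of the values at the
  -- endpoints. So the squared distance of `h y` and `h z` is `J y + J z - 2 J(midpoint)`, and
  -- almost-minimisers of `J` over the tail hulls are Cauchy in mean square.
  let h : E → ι → Ω → ℝ := fun y i ω => Real.exp (-(L y i ω) / 2)
  have hm : ∀ y ∈ convexHull ℝ (range x), ∀ i, Measurable (h y i) := fun y hy i =>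
    (((hmeas y hy i).neg).div_const 2).exp
  have h01 : ∀ y ∈ convexHull ℝ (range x), ∀ i ω, ‖h y i ω‖ ≤ 1 := fun y hy i ω => by
    rw [Real.norm_eq_abs, Real.abs_exp, Real.exp_le_one_iff]
    linarith [hpos y hy i ω]
  have hprod : ∀ y ∈ convexHull ℝ (range x), ∀ z ∈ convexHull ℝ (range x), ∀ i,
      Integrable (fun ω => h y i ω * h z i ω) μ := fun y hy z hz i =>
    Integrable.of_bound ((hm y hy i).mul (hm z hz i)).aestronglyMeasurable 1
      (Eventually.of_forall fun ω => by
        rw [norm_mul]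
        exact mul_le_one₀ (h01 y hy i ω) (norm_nonneg _) (h01 z hz i ω))
  let J : E → ℝ := fun y => ∑ i, ∫ ω, h y i ω * h y i ω ∂μ
  have hJ0 : ∀ y, 0 ≤ J y := fun y => Finset.sum_nonneg fun i _ =>
    integral_nonneg fun ω => mul_self_nonneg _
  have hbdd : ∀ n, BddBelow (J '' convexHull ℝ (x '' Ici n)) := fun n =>
    ⟨0, by rintro _ ⟨y, -, rfl⟩; exact hJ0 y⟩
  have hne : ∀ n, (convexHull ℝ (x '' Ici n)).Nonempty := fun n =>
    ⟨x n, subset_convexHull ℝ _ ⟨n, self_mem_Ici, rfl⟩⟩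
  let I : ℕ → ℝ := fun n => sInf (J '' convexHull ℝ (x '' Ici n))
  have hImono : Monotone I := fun n k hnk =>
    csInf_le_csInf (hbdd n) ((hne k).image _) (image_mono (hanti n k hnk))
  have hIle : ∀ n, I n ≤ ∑ _i : ι, μ.real univ := fun n => by
    obtain ⟨y, hy⟩ := hne n
    refine (csInf_le (hbdd n) ⟨y, hy, rfl⟩).trans (Finset.sum_le_sum fun i _ => ?_)
    have := norm_integral_le_of_norm_le_const (μ := μ) (f := fun ω => h y i ω * h y i ω) (C := 1)
      (Eventually.of_forall fun ω => by
        rw [norm_mul]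
        exact mul_le_one₀ (h01 y (hsub n hy) i ω) (norm_nonneg _) (h01 y (hsub n hy) i ω))
    rw [one_mul] at this
    exact (le_abs_self _).trans this
  have hIbdd : BddAbove (range I) := ⟨_, by rintro _ ⟨n, rfl⟩; exact hIle n⟩
  have hIlim := tendsto_atTop_ciSup hImono hIbdd
  set Is := ⨆ n, I n
  have hex : ∀ n : ℕ, ∃ y ∈ convexHull ℝ (x '' Ici n), J y < I n + 1 / ((n : ℝ) + 1) := fun n => by
    obtain ⟨_, ⟨y, hy, rfl⟩, hlt⟩ := exists_lt_of_csInf_lt ((hne n).image J)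
      (lt_add_of_pos_right (I n) (by positivity : (0 : ℝ) < 1 / ((n : ℝ) + 1)))
    exact ⟨y, hy, hlt⟩
  choose y hy hyJ using hex
  have hyr : ∀ n, y n ∈ convexHull ℝ (range x) := fun n => hsub n (hy n)
  let ε : ℕ → ℝ := fun n => Is - I n + 2 * (1 / ((n : ℝ) + 1))
  have hε : Tendsto ε atTop (nhds 0) := by
    have h1 := (tendsto_const_nhds (x := Is)).sub hIlim
    have h2 := (tendsto_one_div_add_atTop_nhds_zero_nat (𝕜 := ℝ)).const_mul 2
    simpa [ε] using h1.add h2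
  have hcauchy : ∀ n k, n ≤ k → ∀ i, ∫ ω, (h (y n) i ω - h (y k) i ω) ^ 2 ∂μ ≤ ε n := by
    intro n k hnk i
    set z := (1 / 2 : ℝ) • y n + (1 / 2 : ℝ) • y k
    have hz : z ∈ convexHull ℝ (x '' Ici n) :=
      (convex_convexHull ℝ _) (hy n) (hanti n k hnk (hy k)) (by norm_num) (by norm_num)
        (by norm_num)
    have hJz : I n ≤ J z := csInf_le (hbdd n) ⟨z, hz, rfl⟩
    have hzz : ∀ j ω, h z j ω * h z j ω = h (y n) j ω * h (y k) j ω := fun j ω => by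
      simp only [h, z, map_add, map_smul, Pi.add_apply, Pi.smul_apply, smul_eq_mul, ← Real.exp_add]
      congr 1
      ring
    have hsq : ∀ j, ∫ ω, (h (y n) j ω - h (y k) j ω) ^ 2 ∂μ =
        ∫ ω, h (y n) j ω * h (y n) j ω ∂μ + ∫ ω, h (y k) j ω * h (y k) j ω ∂μ -
          2 * ∫ ω, h z j ω * h z j ω ∂μ := fun j => by
      simp only [hzz]
      have h2 := integral_sub ((hprod _ (hyr n) _ (hyr n) j).add
        (hprod _ (hyr k) _ (hyr k) j)) ((hprod _ (hyr n) _ (hyr k) j).const_mul 2)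
      rw [integral_add' (hprod _ (hyr n) _ (hyr n) j) (hprod _ (hyr k) _ (hyr k) j),
        integral_const_mul] at h2
      rw [← h2]
      refine integral_congr_ae (Eventually.of_forall fun ω => ?_)
      simp only [Pi.add_apply]
      ring
    have hsum : ∑ j, ∫ ω, (h (y n) j ω - h (y k) j ω) ^ 2 ∂μ = J (y n) + J (y k) - 2 * J z := by
      simp only [hsq, J, Finset.sum_sub_distrib, Finset.sum_add_distrib, Finset.mul_sum]
    have hle : ∫ ω, (h (y n) i ω - h (y k) i ω) ^ 2 ∂μ ≤
        ∑ j, ∫ ω, (h (y n) j ω - h (y k) j ω) ^ 2 ∂μ :=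
      Finset.single_le_sum (f := fun j => ∫ ω, (h (y n) j ω - h (y k) j ω) ^ 2 ∂μ)
        (fun j _ => integral_nonneg fun ω => sq_nonneg _) (Finset.mem_univ i)
    have hkI : I k ≤ Is := le_ciSup hIbdd k
    have hdiv : 1 / ((k : ℝ) + 1) ≤ 1 / ((n : ℝ) + 1) :=
      one_div_le_one_div_of_le (by positivity) (by exact_mod_cast Nat.succ_le_succ hnk)
    have h1 := hyJ n
    have h2 := hyJ k
    simp only [ε]
    linarith
  obtain ⟨σ, hσ, hσε⟩ := extraction_forall_of_eventually
    (fun k : ℕ => hε.eventually (gt_mem_nhds (by positivity : (0 : ℝ) < (1 / 8 : ℝ) ^ k)))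
  refine ⟨y ∘ σ, fun n => hanti n _ (hσ.id_le n) (hy _), ?_⟩
  rw [ae_all_iff]
  intro i
  have hsum := ae_summable_of_integral_sq_le (μ := μ)
    (a := fun k ω => h (y (σ k)) i ω - h (y (σ (k + 1))) i ω)
    (fun k => (hm _ (hyr _) i).sub (hm _ (hyr _) i)) fun k => by
      have hint : Integrable (fun ω => (h (y (σ k)) i ω - h (y (σ (k + 1))) i ω) ^ 2) μ := by
        refine (((hprod _ (hyr (σ k)) _ (hyr (σ k)) i).add
          (hprod _ (hyr (σ (k + 1))) _ (hyr (σ (k + 1))) i)).sub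
          ((hprod _ (hyr (σ k)) _ (hyr (σ (k + 1))) i).const_mul 2)).congr
          (Eventually.of_forall fun ω => ?_)
        simp only [Pi.add_apply, Pi.sub_apply]
        ring
      rw [← ofReal_integral_eq_lintegral_ofReal hint (Eventually.of_forall fun ω => sq_nonneg _)]
      exact ENNReal.ofReal_le_ofReal
        ((hcauchy _ _ (hσ (Nat.lt_succ_self k)).le i).trans (hσε k).le)
  have hinf := measure_setOf_tendsto_atTop_eq_zero (μ := μ) (f := fun n => L (y (σ n)) i)
    fun ε hε => (hb ε hε).imp fun a ha n => ha _ (hyr _) i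
  filter_upwards [hsum, hinf] with ω hω1 hω2
  obtain ⟨l, hl⟩ := cauchySeq_tendsto_of_complete
    (cauchySeq_of_summable_dist (f := fun k => h (y (σ k)) i ω) (by simpa [Real.dist_eq] using hω1))
  have hl0 : 0 ≤ l := ge_of_tendsto' hl fun n => (Real.exp_pos _).le
  have hlog : ∀ n, L (y (σ n)) i ω = -2 * Real.log (h (y (σ n)) i ω) := fun n => by
    simp only [h, Real.log_exp]
    ring
  -- A limit `0` of `exp (-L/2)` would mean `L → ∞`, which boundedness in probability excludes
  -- almost surely.
  rcases hl0.eq_or_lt with rfl | hlpos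
  · exfalso
    apply hω2
    have h1 : Tendsto (fun k => h (y (σ k)) i ω) atTop (nhdsWithin 0 (Ioi 0)) :=
      tendsto_nhdsWithin_iff.2 ⟨hl, Eventually.of_forall fun n => Real.exp_pos _⟩
    have h2 := (Real.tendsto_log_nhdsGT_zero.comp h1).const_mul_atBot_of_neg
      (by norm_num : (-2 : ℝ) < 0)
    exact h2.congr fun n => (hlog n).symm
  · exact ⟨-2 * Real.log l, ((hl.log hlpos.ne').const_mul (-2)).congr fun n => (hlog n).symm⟩

end Komlos

/-! ### Canonical representatives of portfolios -/

section Coimage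

variable {E : Type*} [NormedAddCommGroup E] [InnerProductSpace ℝ E] [FiniteDimensional ℝ E]

/-- The orthogonal projection onto the orthogonal complement of the kernel of `A`. -/
def coimageProj (A : E →L[ℝ] E) : E →L[ℝ] E := 1 - (A.ker).starProjection

/-- A contraction whose fixed points are the kernel of `A`. -/
def kerContraction (A : E →L[ℝ] E) : E →L[ℝ] E :=
  1 - (1 + ‖A‖ ^ 2)⁻¹ • (ContinuousLinearMap.adjoint A * A)

theorem continuous_kerContraction : Continuous (kerContraction (E := E)) := by
  unfold kerContraction
  refine continuous_const.sub (Continuous.smul (Continuous.inv₀ (f := fun A : E →L[ℝ] E => 1 + ‖A‖ ^ 2)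
    (by fun_prop) fun A => by positivity)
    (Continuous.mul ?_ continuous_id))
  exact (ContinuousLinearMap.adjoint (𝕜 := ℝ) (E := E) (F := E)).continuous

/-- With `t = (1 + ‖A‖²)⁻¹`, expanding `‖x - t A*Ax‖²` leaves `-2t‖Ax‖² + t²‖A*Ax‖²`, and `t‖A‖² ≤
1` makes this nonpositive. -/
theorem norm_kerContraction_le (A : E →L[ℝ] E) : ‖kerContraction A‖ ≤ 1 := by
  refine ContinuousLinearMap.opNorm_le_bound _ zero_le_one fun x => ?_
  rw [one_mul]
  set t := (1 + ‖A‖ ^ 2)⁻¹ with ht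
  have ht0 : 0 < t := by positivity
  have h1 : ‖ContinuousLinearMap.adjoint A (A x)‖ ≤ ‖A‖ * ‖A x‖ := by
    refine (ContinuousLinearMap.le_opNorm _ _).trans_eq ?_
    rw [LinearIsometryEquiv.norm_map]
  have h2 : inner ℝ x (ContinuousLinearMap.adjoint A (A x)) = ‖A x‖ ^ 2 := by
    rw [ContinuousLinearMap.adjoint_inner_right, real_inner_self_eq_norm_sq]
  have h3 : ‖kerContraction A x‖ ^ 2 ≤ ‖x‖ ^ 2 := by
    have e : kerContraction A x = x - t • ContinuousLinearMap.adjoint A (A x) := rfl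
    rw [e, norm_sub_sq_real, real_inner_smul_right, h2, norm_smul, mul_pow, Real.norm_eq_abs,
      sq_abs]
    have h4 : ‖ContinuousLinearMap.adjoint A (A x)‖ ^ 2 ≤ ‖A‖ ^ 2 * ‖A x‖ ^ 2 := by
      rw [← mul_pow]
      exact pow_le_pow_left₀ (norm_nonneg _) h1 2
    have h5 : t * ‖A‖ ^ 2 ≤ 1 := by
      rw [ht, inv_mul_le_iff₀ (by positivity)]
      linarith
    have h6 : t ^ 2 * ‖ContinuousLinearMap.adjoint A (A x)‖ ^ 2 ≤ t * ‖A x‖ ^ 2 := by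
      calc t ^ 2 * ‖ContinuousLinearMap.adjoint A (A x)‖ ^ 2 ≤ t ^ 2 * (‖A‖ ^ 2 * ‖A x‖ ^ 2) :=
            mul_le_mul_of_nonneg_left h4 (by positivity)
        _ = (t * ‖A‖ ^ 2) * (t * ‖A x‖ ^ 2) := by ring
        _ ≤ 1 * (t * ‖A x‖ ^ 2) := mul_le_mul_of_nonneg_right h5 (by positivity)
        _ = t * ‖A x‖ ^ 2 := one_mul _
    nlinarith [mul_nonneg ht0.le (sq_nonneg ‖A x‖)]
  exact (pow_le_pow_iff_left₀ (norm_nonneg _) (norm_nonneg _) two_ne_zero).1 h3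

theorem eqLocus_kerContraction (A : E →L[ℝ] E) :
    (kerContraction A).eqLocus (1 : E →L[ℝ] E) = A.ker := by
  ext x
  have ht0 : (1 + ‖A‖ ^ 2)⁻¹ ≠ 0 := by positivity
  have e : kerContraction A x = x - (1 + ‖A‖ ^ 2)⁻¹ • ContinuousLinearMap.adjoint A (A x) := rfl
  have h1 : x ∈ (kerContraction A).eqLocus (1 : E →L[ℝ] E) ↔ kerContraction A x = x := Iff.rfl
  rw [h1, e, sub_eq_self, smul_eq_zero, or_iff_right ht0, LinearMap.mem_ker]
  constructor
  · intro h
    have h2 : inner ℝ x (ContinuousLinearMap.adjoint A (A x)) = ‖A x‖ ^ 2 := by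
      rw [ContinuousLinearMap.adjoint_inner_right, real_inner_self_eq_norm_sq]
    rw [h, inner_zero_right] at h2
    exact norm_eq_zero.1 (pow_eq_zero_iff two_ne_zero |>.1 h2.symm)
  · intro h
    change ContinuousLinearMap.adjoint A (A x) = 0
    rw [show A x = 0 from h, map_zero]

/-- The mean ergodic theorem. The kernel does not vary continuously with `A`, but the averages do;
this is how measurability of the projection is obtained. -/
theorem tendsto_birkhoffAverage_kerContraction (A : E →L[ℝ] E) (x : E) :
    Tendsto (fun n => x - birkhoffAverage ℝ (kerContraction A) _root_.id n x) atTop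
      (nhds (coimageProj A x)) := by
  have h := ContinuousLinearMap.tendsto_birkhoffAverage_orthogonalProjection _
    (norm_kerContraction_le A) x
  have e : ∀ K : Submodule ℝ E, K = A.ker → ∀ [K.HasOrthogonalProjection],
      ((K.orthogonalProjectionOnto x : K) : E) = (A.ker).starProjection x := by
    rintro K rfl _
    rfl
  rw [e _ (eqLocus_kerContraction A)] at h
  exact tendsto_const_nhds.sub h

theorem coimageProj_mem (A : E →L[ℝ] E) (x : E) : coimageProj A x ∈ (A.ker)ᗮ :=
  Submodule.sub_starProjection_mem_orthogonal x

theorem sub_coimageProj_mem (A : E →L[ℝ] E) (x : E) : A (x - coimageProj A x) = 0 := by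
  have : x - coimageProj A x = (A.ker).starProjection x := sub_sub_cancel _ _
  rw [this]
  exact Submodule.starProjection_apply_mem A.ker x

theorem norm_sub_coimageProj_le (A : E →L[ℝ] E) (x : E) : ‖x - coimageProj A x‖ ≤ ‖x‖ := by
  have : x - coimageProj A x = (A.ker).starProjection x := sub_sub_cancel _ _
  rw [this]
  exact Submodule.norm_starProjection_apply_le _ x

theorem coimageProj_coimageProj (A : E →L[ℝ] E) (x : E) :
    coimageProj A (coimageProj A x) = coimageProj A x := by
  have : (A.ker).starProjection (coimageProj A x) = 0 :=
    (Submodule.starProjection_apply_eq_zero_iff (K := A.ker)).2 (coimageProj_mem A x)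
  change coimageProj A x - (A.ker).starProjection (coimageProj A x) = _
  rw [this, sub_zero]

/-- In finite dimension `A` is injective, hence bounded below, on the orthogonal complement of its
kernel. -/
theorem tendsto_zero_of_mem_ker_orthogonal {A : E →L[ℝ] E} {x : ℕ → E}
    (hx : ∀ n, x n ∈ (A.ker)ᗮ) (h : Tendsto (fun n => A (x n)) atTop (nhds 0)) :
    Tendsto x atTop (nhds 0) := by
  let f : (A.ker)ᗮ →ₗ[ℝ] E := (A : E →ₗ[ℝ] E).comp (A.ker)ᗮ.subtype
  have hf : LinearMap.ker f = ⊥ := by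
    rw [LinearMap.ker_eq_bot']
    intro y hy
    have h1 : (y : E) ∈ A.ker := hy
    have h2 : inner ℝ (y : E) (y : E) = 0 := y.2 _ h1
    exact Subtype.ext (inner_self_eq_zero.1 h2)
  obtain ⟨K, -, hK⟩ := f.exists_antilipschitzWith hf
  rw [tendsto_zero_iff_norm_tendsto_zero] at h ⊢
  refine squeeze_zero (fun n => norm_nonneg _) (fun n => ?_) (by simpa using h.const_mul (K : ℝ))
  have := hK.le_mul_dist ⟨x n, hx n⟩ 0
  simpa [f] using this

variable [MeasurableSpace E] [BorelSpace E]

theorem measurable_coimageProj {Ω : Type*} {m : MeasurableSpace Ω} {G : Ω → E →L[ℝ] E}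
    (hG : StronglyMeasurable G) {ξ : Ω → E} (hξ : Measurable ξ) :
    Measurable fun ω => coimageProj (G ω) (ξ ω) := by
  have hC : StronglyMeasurable fun ω => kerContraction (G ω) :=
    continuous_kerContraction.comp_stronglyMeasurable hG
  have hit : ∀ k : ℕ, StronglyMeasurable fun ω => (kerContraction (G ω))^[k] (ξ ω) := fun k => by
    induction k with
    | zero => exact hξ.stronglyMeasurable
    | succ k ih =>
      simp only [Function.iterate_succ_apply']
      exact (isBoundedBilinearMap_apply (𝕜 := ℝ) (E := E) (F := E)).continuous.comp_stronglyMeasurable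
        (hC.prodMk ih)
  refine measurable_of_tendsto_metrizable (f := fun n ω => ξ ω -
    birkhoffAverage ℝ (kerContraction (G ω)) _root_.id n (ξ ω)) (fun n => ?_) ?_
  · refine hξ.sub ?_
    simp only [birkhoffAverage, birkhoffSum, _root_.id]
    exact (Finset.measurable_fun_sum _ fun k _ => (hit k).measurable).const_smul _
  · exact tendsto_pi_nhds.2 fun ω => tendsto_birkhoffAverage_kerContraction _ _

end Coimage

/-! ### The conditional second moment operator and the relevant part of a portfolio. -/

section Canonical

variable {E : Type*} [NormedAddCommGroup E] [InnerProductSpace ℝ E]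

/-- The operator `x ↦ ⟪s, x⟫ s`. -/
def gramOp (s : E) : E →L[ℝ] E := (innerSL ℝ s).smulRight s

theorem gramOp_apply (s x : E) : gramOp s x = (inner ℝ s x : ℝ) • s := rfl

theorem continuous_gramOp : Continuous (gramOp (E := E)) := by
  unfold gramOp
  have : Continuous fun s : E => ContinuousLinearMap.smulRightL ℝ E E (innerSL ℝ s) s := by
    fun_prop
  exact this

theorem norm_gramOp_apply_le (s x : E) : ‖gramOp s x‖ ≤ ‖s‖ * |inner ℝ x s| := by
  rw [gramOp_apply, norm_smul, Real.norm_eq_abs, mul_comm, real_inner_comm]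

variable [FiniteDimensional ℝ E]

/-- The conditional second moment operator. -/
def condGram {Ω : Type*} (m : MeasurableSpace Ω) {mΩ : MeasurableSpace Ω} (μ : Measure Ω)
    (s : Ω → E) : Ω → E →L[ℝ] E :=
  μ[fun ω => gramOp (s ω) | m]

/-- The canonical representative of a portfolio: the part that is relevant for `s`. -/
def canonicalRep {Ω : Type*} (m : MeasurableSpace Ω) {mΩ : MeasurableSpace Ω} (μ : Measure Ω)
    (s : Ω → E) (ω : Ω) : E →L[ℝ] E :=
  coimageProj (condGram m μ s ω)

variable [MeasurableSpace E] [BorelSpace E] {Ω : Type*} {m mΩ : MeasurableSpace Ω} {μ : Measure Ω}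

theorem measurable_canonicalRep (s : Ω → E) {ξ : Ω → E} (hξ : Measurable[m] ξ) :
    Measurable[m] fun ω => canonicalRep m μ s ω (ξ ω) :=
  measurable_coimageProj stronglyMeasurable_condExp hξ

variable [IsFiniteMeasure μ] {s : Ω → E} {M : ℝ}

theorem integrable_gramOp (hs : Measurable s) (hM : ∀ᵐ ω ∂μ, ‖s ω‖ ≤ M) :
    Integrable (fun ω => gramOp (s ω)) μ := by
  refine Integrable.of_bound
    (continuous_gramOp.comp_stronglyMeasurable hs.stronglyMeasurable).aestronglyMeasurable
    (M * M) ?_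
  filter_upwards [hM] with ω hω
  refine ContinuousLinearMap.opNorm_le_bound _
    (mul_nonneg ((norm_nonneg _).trans hω) ((norm_nonneg _).trans hω)) fun x => ?_
  refine (norm_gramOp_apply_le _ _).trans ?_
  calc ‖s ω‖ * |inner ℝ x (s ω)| ≤ ‖s ω‖ * (‖x‖ * ‖s ω‖) :=
        mul_le_mul_of_nonneg_left (abs_real_inner_le_norm _ _) (norm_nonneg _)
    _ = (‖s ω‖ * ‖s ω‖) * ‖x‖ := by ring
    _ ≤ M * M * ‖x‖ := mul_le_mul_of_nonneg_right
        (mul_le_mul hω hω (norm_nonneg _) ((norm_nonneg _).trans hω)) (norm_nonneg _)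

theorem integrable_gramOp_apply (hm : m ≤ mΩ) (hs : Measurable s) (hM : ∀ᵐ ω ∂μ, ‖s ω‖ ≤ M)
    {ξ : Ω → E} (hξ : Measurable[m] ξ) {B : ℝ} (hB : ∀ ω, ‖ξ ω‖ ≤ B) :
    Integrable (fun ω => gramOp (s ω) (ξ ω)) μ := by
  have hξ' : Measurable ξ := hξ.mono hm le_rfl
  refine Integrable.of_bound (C := M * (B * M)) ?_ ?_
  · exact ((isBoundedBilinearMap_apply (𝕜 := ℝ) (E := E) (F := E)).continuous.comp_stronglyMeasurable
      ((continuous_gramOp.comp_stronglyMeasurable hs.stronglyMeasurable).prodMk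
        hξ'.stronglyMeasurable)).aestronglyMeasurable
  · filter_upwards [hM] with ω hω
    have hM0 : 0 ≤ M := (norm_nonneg _).trans hω
    refine (norm_gramOp_apply_le _ _).trans ?_
    refine mul_le_mul hω ((abs_real_inner_le_norm _ _).trans ?_) (abs_nonneg _) hM0
    exact mul_le_mul (hB ω) hω (norm_nonneg _) ((norm_nonneg _).trans (hB ω))

theorem condGram_apply (hm : m ≤ mΩ) (hs : Measurable s) (hM : ∀ᵐ ω ∂μ, ‖s ω‖ ≤ M)
    {ξ : Ω → E} (hξ : Measurable[m] ξ) {B : ℝ} (hB : ∀ ω, ‖ξ ω‖ ≤ B) :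
    (fun ω => condGram m μ s ω (ξ ω)) =ᵐ[μ] μ[fun ω => gramOp (s ω) (ξ ω) | m] := by
  have := condExp_bilin_of_stronglyMeasurable_left
    (ContinuousLinearMap.apply ℝ E : E →L[ℝ] (E →L[ℝ] E) →L[ℝ] E) (m := m) (μ := μ) (f := ξ)
    (g := fun ω => gramOp (s ω)) hξ.stronglyMeasurable
    (by simpa using integrable_gramOp_apply hm hs hM hξ hB) (integrable_gramOp hs hM)
  simp only [ContinuousLinearMap.apply_apply] at this
  exact this.symm

/-- Pulling the bounded `m`-measurable `ξ` out of the conditional expectation turns `∫ ⟨ξ, s⟩²` into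
the integral of `⟨ξ, condGram ξ⟩`, which vanishes. -/
theorem inner_eq_zero_of_condGram_apply_eq_zero (hm : m ≤ mΩ) (hs : Measurable s)
    (hM : ∀ᵐ ω ∂μ, ‖s ω‖ ≤ M) {ξ : Ω → E} (hξ : Measurable[m] ξ) {B : ℝ} (hB : ∀ ω, ‖ξ ω‖ ≤ B)
    (h0 : ∀ ω, condGram m μ s ω (ξ ω) = 0) : ∀ᵐ ω ∂μ, (inner ℝ (ξ ω) (s ω) : ℝ) = 0 := by
  have hξ' : Measurable ξ := hξ.mono hm le_rfl
  have h1 := condGram_apply hm hs hM hξ hB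
  have hint := integrable_gramOp_apply hm hs hM hξ hB
  have hi : Integrable (fun ω => (inner ℝ (ξ ω) (gramOp (s ω) (ξ ω)) : ℝ)) μ := by
    refine (hint.norm.const_mul B).mono' (hξ'.aestronglyMeasurable.inner hint.1)
      (Eventually.of_forall fun ω => ?_)
    rw [Real.norm_eq_abs]
    exact (abs_real_inner_le_norm _ _).trans (mul_le_mul_of_nonneg_right (hB ω) (norm_nonneg _))
  have h2 : μ[fun ω => (inner ℝ (ξ ω) (gramOp (s ω) (ξ ω)) : ℝ) | m] =ᵐ[μ]
      fun ω => (inner ℝ (ξ ω) ((μ[fun ω => gramOp (s ω) (ξ ω) | m]) ω) : ℝ) :=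
    condExp_bilin_of_stronglyMeasurable_left (innerSL ℝ (E := E)) (m := m) (μ := μ)
      (f := ξ) (g := fun ω => gramOp (s ω) (ξ ω)) hξ.stronglyMeasurable hi hint
  have h3 : ∫ ω, (inner ℝ (ξ ω) (gramOp (s ω) (ξ ω)) : ℝ) ∂μ = 0 := by
    rw [← integral_condExp hm]
    refine integral_eq_zero_of_ae ?_
    filter_upwards [h1, h2] with ω hω1 hω2
    rw [hω2, ← hω1, h0, inner_zero_right]
    rfl
  have e : ∀ ω, (inner ℝ (ξ ω) (gramOp (s ω) (ξ ω)) : ℝ) = (inner ℝ (ξ ω) (s ω) : ℝ) ^ 2 :=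
    fun ω => by
      rw [gramOp_apply, real_inner_smul_right, real_inner_comm]
      ring
  simp only [e] at h3 hi
  rw [integral_eq_zero_iff_of_nonneg (fun ω => sq_nonneg _) hi] at h3
  filter_upwards [h3] with ω hω
  exact pow_eq_zero_iff two_ne_zero |>.1 hω

/-- The discarded part lies in the kernel of the conditional Gram operator, so it earns nothing. A
dense sequence makes the null set independent of `v`, so that random portfolios may be inserted. -/
theorem inner_canonicalRep (hm : m ≤ mΩ) (hs : Measurable s) (hM : ∀ᵐ ω ∂μ, ‖s ω‖ ≤ M) :
    ∀ᵐ ω ∂μ, ∀ v : E, (inner ℝ (canonicalRep m μ s ω v) (s ω) : ℝ) = inner ℝ v (s ω) := by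
  have h1 : ∀ᵐ ω ∂μ, ∀ k : ℕ, (inner ℝ (TopologicalSpace.denseSeq E k -
      canonicalRep m μ s ω (TopologicalSpace.denseSeq E k)) (s ω) : ℝ) = 0 :=
    ae_all_iff.2 fun k => inner_eq_zero_of_condGram_apply_eq_zero hm hs hM
      (measurable_const.sub (measurable_canonicalRep s measurable_const))
      (fun ω => norm_sub_coimageProj_le _ _) fun ω => sub_coimageProj_mem _ _
  filter_upwards [h1] with ω hω v
  have hcl : IsClosed {v : E | (inner ℝ (canonicalRep m μ s ω v) (s ω) : ℝ) = inner ℝ v (s ω)} :=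
    isClosed_eq (by fun_prop) (by fun_prop)
  refine (TopologicalSpace.denseRange_denseSeq E).induction_on v hcl fun k => ?_
  have := hω k
  rw [inner_sub_left, sub_eq_zero] at this
  exact this.symm

/-- If the gains of a sequence of portfolios tend to zero, then so do the canonical representatives
along a subsequence. -/
theorem exists_subseq_canonicalRep_tendsto_zero (hm : m ≤ mΩ) (hs : Measurable s)
    (hM : ∀ᵐ ω ∂μ, ‖s ω‖ ≤ M) {ξ : ℕ → Ω → E} (hξ : ∀ n, Measurable[m] (ξ n))
    (h : ∀ᵐ ω ∂μ, Tendsto (fun n => (inner ℝ (ξ n ω) (s ω) : ℝ)) atTop (nhds 0)) :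
    ∃ σ : ℕ → ℕ, StrictMono σ ∧
      ∀ᵐ ω ∂μ, Tendsto (fun n => canonicalRep m μ s ω (ξ (σ n) ω)) atTop (nhds 0) := by
  -- Truncation to the unit ball supplies the bound needed for dominated convergence. Once `η` tends
  -- to `0` its norm is eventually below `1`, where no truncation takes place.
  let η : ℕ → Ω → E := fun n ω =>
    (max 1 ‖canonicalRep m μ s ω (ξ n ω)‖)⁻¹ • canonicalRep m μ s ω (ξ n ω)
  have hpos : ∀ n ω, 0 < max 1 ‖canonicalRep m μ s ω (ξ n ω)‖ := fun n ω =>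
    lt_max_of_lt_left one_pos
  have hηm : ∀ n, Measurable[m] (η n) := fun n => by
    have := measurable_canonicalRep (μ := μ) s (hξ n)
    have h2 : Measurable fun v : E => (max 1 ‖v‖)⁻¹ • v :=
      (measurable_const.max measurable_norm).inv.smul measurable_id
    exact h2.comp this
  have hη1 : ∀ n ω, ‖η n ω‖ ≤ 1 := fun n ω => by
    rw [norm_smul, norm_inv, Real.norm_of_nonneg (hpos n ω).le, inv_mul_le_iff₀ (hpos n ω), mul_one]
    exact le_max_right _ _
  have hηin : ∀ᵐ ω ∂μ, ∀ n, |(inner ℝ (η n ω) (s ω) : ℝ)| ≤ |(inner ℝ (ξ n ω) (s ω) : ℝ)| := by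
    filter_upwards [inner_canonicalRep hm hs hM] with ω hω n
    rw [real_inner_smul_left, hω, abs_mul, abs_inv, abs_of_pos (hpos n ω)]
    exact mul_le_of_le_one_left (abs_nonneg _) (inv_le_one_of_one_le₀ (le_max_left _ _))
  have hlim : ∀ᵐ ω ∂μ, Tendsto (fun n => ‖gramOp (s ω) (η n ω)‖) atTop (nhds 0) := by
    filter_upwards [h, hηin] with ω hω1 hω2
    refine squeeze_zero (fun n => norm_nonneg _) (fun n => (norm_gramOp_apply_le _ _).trans
      (mul_le_mul_of_nonneg_left (hω2 n) (norm_nonneg _))) ?_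
    simpa using hω1.abs.const_mul ‖s ω‖
  have hint := fun n => integrable_gramOp_apply hm hs hM (hηm n) (hη1 n)
  have hI : Tendsto (fun n => ∫ ω, ‖gramOp (s ω) (η n ω)‖ ∂μ) atTop (nhds 0) := by
    have := tendsto_integral_of_dominated_convergence (μ := μ) (fun _ => M * (1 * M))
      (F := fun n ω => ‖gramOp (s ω) (η n ω)‖) (f := fun _ => 0) (fun n => (hint n).1.norm)
      (integrable_const _) (fun n => ?_) hlim
    · simpa using this
    · filter_upwards [hM] with ω hω
      rw [norm_norm]
      refine (norm_gramOp_apply_le _ _).trans ?_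
      refine mul_le_mul hω ((abs_real_inner_le_norm _ _).trans ?_) (abs_nonneg _)
        ((norm_nonneg _).trans hω)
      exact mul_le_mul (hη1 n ω) hω (norm_nonneg _) zero_le_one
  -- Conditional expectation contracts the mean norm, so the Gram operator applied to `η` also tends
  -- to `0` in mean.
  have hI2 : Tendsto (fun n => ∫ ω, ‖condGram m μ s ω (η n ω)‖ ∂μ) atTop (nhds 0) := by
    refine squeeze_zero (fun n => integral_nonneg fun ω => norm_nonneg _) (fun n => ?_) hI
    rw [← integral_condExp hm (f := fun ω => ‖gramOp (s ω) (η n ω)‖)]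
    have e := condGram_apply hm hs hM (hηm n) (hη1 n)
    refine integral_mono_ae ((integrable_condExp.congr e.symm).norm) integrable_condExp ?_
    filter_upwards [e, norm_condExp_le (m := m) (μ := μ) (fun ω => gramOp (s ω) (η n ω))]
      with ω h1 h2
    rw [h1]
    exact h2
  have hGi : ∀ n, Integrable (fun ω => condGram m μ s ω (η n ω)) μ := fun n =>
    integrable_condExp.congr (condGram_apply hm hs hM (hηm n) (hη1 n)).symm
  have hTM : TendstoInMeasure μ (fun n ω => condGram m μ s ω (η n ω)) atTop fun _ => 0 := by
    refine tendstoInMeasure_of_tendsto_eLpNorm (p := 1) one_ne_zero (fun n => (hGi n).1)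
      aestronglyMeasurable_const ?_
    have e : ∀ n, eLpNorm ((fun ω => condGram m μ s ω (η n ω)) - fun _ => 0) 1 μ =
        ENNReal.ofReal (∫ ω, ‖condGram m μ s ω (η n ω)‖ ∂μ) := fun n => by
      rw [ofReal_integral_norm_eq_lintegral_enorm (hGi n), eLpNorm_one_eq_lintegral_enorm]
      simp
    simp only [e]
    rw [← ENNReal.ofReal_zero]
    exact (ENNReal.continuous_ofReal.tendsto 0).comp hI2
  obtain ⟨σ, hσ, hσl⟩ := hTM.exists_seq_tendsto_ae
  refine ⟨σ, hσ, ?_⟩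
  filter_upwards [hσl] with ω hω
  have h0 : Tendsto (fun n => η (σ n) ω) atTop (nhds 0) :=
    tendsto_zero_of_mem_ker_orthogonal (A := condGram m μ s ω)
      (fun n => Submodule.smul_mem _ _ (coimageProj_mem _ _)) hω
  refine h0.congr' ?_
  have h1 : ∀ᶠ n in atTop, ‖η (σ n) ω‖ < 1 :=
    (tendsto_zero_iff_norm_tendsto_zero.1 h0).eventually (gt_mem_nhds one_pos)
  filter_upwards [h1] with n hn
  have h2 : ‖canonicalRep m μ s ω (ξ (σ n) ω)‖ < max 1 ‖canonicalRep m μ s ω (ξ (σ n) ω)‖ := by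
    rw [norm_smul, norm_inv, Real.norm_of_nonneg (hpos _ ω).le, inv_mul_lt_iff₀ (hpos _ ω),
      mul_one] at hn
    exact hn
  have h3 : max 1 ‖canonicalRep m μ s ω (ξ (σ n) ω)‖ = 1 := by
    refine max_eq_left (le_of_not_gt fun h4 => ?_)
    rw [max_eq_right h4.le] at h2
    exact lt_irrefl _ h2
  simp only [η, h3, inv_one, one_smul]

end Canonical

/-! ### The one-period market -/

section OnePeriod

theorem measurable_limUnder_nat {E Ω : Type*} [TopologicalSpace E] [Nonempty E]
    [TopologicalSpace.IsCompletelyMetrizableSpace E] [SecondCountableTopology E]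
    [MeasurableSpace E] [BorelSpace E] {m : MeasurableSpace Ω} {p : ℕ → Ω → E}
    (hp : ∀ n, Measurable (p n)) : Measurable fun ω => limUnder atTop (fun n => p n ω) :=
  (StronglyMeasurable.limUnder fun n => (hp n).stronglyMeasurable).measurable

variable {E : Type*} [NormedAddCommGroup E] [InnerProductSpace ℝ E] [FiniteDimensional ℝ E]
  [MeasurableSpace E] [BorelSpace E] {Ω : Type*} {m mΩ : MeasurableSpace Ω} {μ : Measure Ω}
  [IsFiniteMeasure μ] {s : Ω → E} {M : ℝ}

omit [IsFiniteMeasure μ] in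
theorem exists_measurable_limit {p : ℕ → Ω → E} (hp : ∀ n, Measurable[m] (p n))
    (h : ∀ᵐ ω ∂μ, ∃ l, Tendsto (fun n => p n ω) atTop (nhds l)) :
    ∃ ζ : Ω → E, Measurable[m] ζ ∧ ∀ᵐ ω ∂μ, Tendsto (fun n => p n ω) atTop (nhds (ζ ω)) := by
  refine ⟨fun ω => limUnder atTop (fun n => p n ω), measurable_limUnder_nat hp, ?_⟩
  filter_upwards [h] with ω hω
  exact tendsto_nhds_limUnder hω

-- Borel–Cantelli: along a fast subsequence the increments are eventually below `2^(-j)`, hence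
-- summable.
omit [MeasurableSpace E] [BorelSpace E] [IsFiniteMeasure μ] in
theorem exists_subseq_tendsto_of_cauchy_in_measure {p : ℕ → Ω → E}
    (h : ∀ ε : ℝ, 0 < ε → ∀ᶠ N in atTop, ∀ n k, N ≤ n → N ≤ k →
      μ {ω | ε ≤ ‖p n ω - p k ω‖} ≤ ENNReal.ofReal ε) :
    ∃ σ : ℕ → ℕ, StrictMono σ ∧
      ∀ᵐ ω ∂μ, ∃ l, Tendsto (fun n => p (σ n) ω) atTop (nhds l) := by
  obtain ⟨σ, hσ, hσ'⟩ := extraction_forall_of_eventually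
    (fun j : ℕ => h ((1 / 2 : ℝ) ^ j) (by positivity))
  refine ⟨σ, hσ, ?_⟩
  have hgeo : Summable fun k : ℕ => (1 / 2 : ℝ) ^ k :=
    summable_geometric_of_lt_one (by norm_num) (by norm_num)
  have hsum : ∑' j, μ {ω | (1 / 2 : ℝ) ^ j ≤ ‖p (σ j) ω - p (σ (j + 1)) ω‖} ≠ ⊤ := by
    refine ((ENNReal.tsum_le_tsum fun j =>
      hσ' j (σ j) (σ (j + 1)) le_rfl (hσ (Nat.lt_succ_self j)).le).trans_lt ?_).ne
    rw [← ENNReal.ofReal_tsum_of_nonneg (fun k => by positivity) hgeo]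
    exact ENNReal.ofReal_lt_top
  filter_upwards [ae_eventually_notMem hsum] with ω hω
  refine cauchySeq_tendsto_of_complete (cauchySeq_of_summable_dist
    (Summable.of_norm_bounded_eventually_nat hgeo ?_))
  filter_upwards [hω] with j hj
  rw [Real.norm_of_nonneg dist_nonneg, dist_eq_norm]
  simp only [not_le] at hj
  exact hj.le

/-- If the gains of a sequence of portfolios converge almost surely, then the canonical
representatives converge along a subsequence. -/
theorem exists_subseq_canonicalRep_tendsto (hm : m ≤ mΩ) (hs : Measurable s)
    (hM : ∀ᵐ ω ∂μ, ‖s ω‖ ≤ M) {ξ : ℕ → Ω → E} (hξ : ∀ n, Measurable[m] (ξ n))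
    (h : ∀ᵐ ω ∂μ, ∃ l : ℝ, Tendsto (fun n => (inner ℝ (ξ n ω) (s ω) : ℝ)) atTop (nhds l)) :
    ∃ σ : ℕ → ℕ, StrictMono σ ∧ ∃ ζ : Ω → E, Measurable[m] ζ ∧
      ∀ᵐ ω ∂μ, Tendsto (fun n => canonicalRep m μ s ω (ξ (σ n) ω)) atTop (nhds (ζ ω)) := by
  have hpm : ∀ n, Measurable[m] fun ω => canonicalRep m μ s ω (ξ n ω) := fun n =>
    measurable_canonicalRep s (hξ n)
  -- If the representatives were not Cauchy in measure, differences `ξ (a N) - ξ (b N)` would have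
  -- gains tending to `0` while their representatives stay away from `0`, against
  -- `exists_subseq_canonicalRep_tendsto_zero`.
  suffices hC : ∀ ε : ℝ, 0 < ε → ∀ᶠ N in atTop, ∀ n k, N ≤ n → N ≤ k →
      μ {ω | ε ≤ ‖canonicalRep m μ s ω (ξ n ω) - canonicalRep m μ s ω (ξ k ω)‖} ≤
        ENNReal.ofReal ε by
    obtain ⟨σ, hσ, hl⟩ := exists_subseq_tendsto_of_cauchy_in_measure hC
    exact ⟨σ, hσ, exists_measurable_limit (fun n => hpm (σ n)) hl⟩
  intro ε hε
  by_contra hcon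
  have hcon' : ∀ N : ℕ, ∃ n k, N ≤ n ∧ N ≤ k ∧ ENNReal.ofReal ε <
      μ {ω | ε ≤ ‖canonicalRep m μ s ω (ξ n ω) - canonicalRep m μ s ω (ξ k ω)‖} := by
    intro N
    by_contra hN
    push Not at hN
    exact hcon (eventually_atTop.2 ⟨N, fun N' hN' n k hn hk =>
      hN n k (hN'.trans hn) (hN'.trans hk)⟩)
  choose a b ha hb hab using hcon'
  have h0 : ∀ᵐ ω ∂μ, Tendsto (fun N => (inner ℝ (ξ (a N) ω - ξ (b N) ω) (s ω) : ℝ)) atTop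
      (nhds 0) := by
    filter_upwards [h] with ω ⟨l, hl⟩
    have h1 := hl.comp (tendsto_atTop_mono ha tendsto_id)
    have h2 := hl.comp (tendsto_atTop_mono hb tendsto_id)
    simpa [Function.comp_def, inner_sub_left] using h1.sub h2
  obtain ⟨τ, hτ, hτ0⟩ := exists_subseq_canonicalRep_tendsto_zero hm hs hM
    (ξ := fun N ω => ξ (a N) ω - ξ (b N) ω) (fun N => (hξ _).sub (hξ _)) h0
  have hTM := tendstoInMeasure_of_tendsto_ae (fun n => ((measurable_canonicalRep (μ := μ) s
    ((hξ (a (τ n))).sub (hξ (b (τ n))))).mono hm le_rfl).aestronglyMeasurable) hτ0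
  rw [tendstoInMeasure_iff_norm] at hTM
  have h3 := (hTM ε hε).eventually (gt_mem_nhds (ENNReal.ofReal_pos.2 hε))
  obtain ⟨n, hn⟩ := h3.exists
  refine lt_asymm hn ?_
  simpa only [Pi.sub_apply, sub_zero, map_sub] using hab (τ n)

theorem integrable_inner_of_bounded (hs : Measurable s)
    (hM : ∀ᵐ ω ∂μ, ‖s ω‖ ≤ M) {η : Ω → E} (hη : Measurable η) {B : ℝ} (hB : ∀ ω, ‖η ω‖ ≤ B) :
    Integrable (fun ω => (inner ℝ (η ω) (s ω) : ℝ)) μ := by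
  refine Integrable.of_bound (hη.inner hs).aestronglyMeasurable (B * M) ?_
  filter_upwards [hM] with ω hω
  rw [Real.norm_eq_abs]
  exact (abs_real_inner_le_norm _ _).trans
    (mul_le_mul (hB ω) hω (norm_nonneg _) ((norm_nonneg _).trans (hB ω)))

/-- For portfolios of norm at most one whose canonical representatives do not vanish in
probability, the expected absolute gains are bounded away from zero. -/
theorem exists_pos_le_integral_abs_inner (hm : m ≤ mΩ) (hs : Measurable s)
    (hM : ∀ᵐ ω ∂μ, ‖s ω‖ ≤ M) {η : ℕ → Ω → E} (hη : ∀ n, Measurable[m] (η n))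
    (hη1 : ∀ n ω, ‖η n ω‖ ≤ 1) {ε : ENNReal} (hε : 0 < ε)
    (hbig : ∀ n, ε ≤ μ {ω | 1 ≤ ‖canonicalRep m μ s ω (η n ω)‖}) :
    ∃ δ : ℝ, 0 < δ ∧ ∀ n, δ ≤ ∫ ω, |(inner ℝ (η n ω) (s ω) : ℝ)| ∂μ := by
  by_contra hcon
  push Not at hcon
  choose k hk using fun n : ℕ => hcon (1 / ((n : ℝ) + 1)) (by positivity)
  have hint := fun n => integrable_inner_of_bounded (B := 1) hs hM ((hη (k n)).mono hm le_rfl)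
    (hη1 (k n))
  have hI : Tendsto (fun n => ∫ ω, ‖(inner ℝ (η (k n) ω) (s ω) : ℝ)‖ ∂μ) atTop (nhds 0) :=
    squeeze_zero (fun n => integral_nonneg fun ω => norm_nonneg _) (fun n => (hk n).le)
      tendsto_one_div_add_atTop_nhds_zero_nat
  have hTM : TendstoInMeasure μ (fun n ω => (inner ℝ (η (k n) ω) (s ω) : ℝ)) atTop fun _ => 0 := by
    refine tendstoInMeasure_of_tendsto_eLpNorm (p := 1) one_ne_zero (fun n => (hint n).1)
      aestronglyMeasurable_const ?_
    have e : ∀ n, eLpNorm ((fun ω => (inner ℝ (η (k n) ω) (s ω) : ℝ)) - fun _ => 0) 1 μ =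
        ENNReal.ofReal (∫ ω, ‖(inner ℝ (η (k n) ω) (s ω) : ℝ)‖ ∂μ) := fun n => by
      rw [ofReal_integral_norm_eq_lintegral_enorm (hint n), eLpNorm_one_eq_lintegral_enorm]
      simp
    simp only [e]
    rw [← ENNReal.ofReal_zero]
    exact (ENNReal.continuous_ofReal.tendsto 0).comp hI
  obtain ⟨σ, -, hσl⟩ := hTM.exists_seq_tendsto_ae
  obtain ⟨τ, -, hτ0⟩ := exists_subseq_canonicalRep_tendsto_zero hm hs hM
    (ξ := fun n => η (k (σ n))) (fun n => hη _) hσl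
  have hTM2 := tendstoInMeasure_of_tendsto_ae (fun n => ((measurable_canonicalRep (μ := μ) s
    (hη (k (σ (τ n))))).mono hm le_rfl).aestronglyMeasurable) hτ0
  rw [tendstoInMeasure_iff_norm] at hTM2
  obtain ⟨n, hn⟩ := ((hTM2 1 one_pos).eventually (gt_mem_nhds hε)).exists
  refine not_le.2 hn ?_
  simpa only [sub_zero] using hbig (k (σ (τ n)))

omit [IsFiniteMeasure μ] in
theorem lintegral_neg_combo_le {X Y : Ω → ℝ} (hX : Measurable X) {a b : ℝ} (ha : 0 ≤ a)
    (hb : 0 ≤ b) :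
    ∫⁻ ω, ENNReal.ofReal (-(a * X ω + b * Y ω)) ∂μ ≤
      ENNReal.ofReal a * ∫⁻ ω, ENNReal.ofReal (-X ω) ∂μ +
        ENNReal.ofReal b * ∫⁻ ω, ENNReal.ofReal (-Y ω) ∂μ := by
  have h : Measurable fun ω => ENNReal.ofReal a * ENNReal.ofReal (-X ω) :=
    hX.neg.ennreal_ofReal.const_mul _
  rw [← lintegral_const_mul' _ _ ENNReal.ofReal_ne_top,
    ← lintegral_const_mul' _ _ ENNReal.ofReal_ne_top,
    ← lintegral_add_left h]
  refine lintegral_mono fun ω => ?_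
  rw [← ENNReal.ofReal_mul ha, ← ENNReal.ofReal_mul hb]
  refine (ENNReal.ofReal_le_ofReal (le_of_eq ?_)).trans ENNReal.ofReal_add_le
  ring

theorem combo_le_of_le {a b : ℝ} (ha : 0 ≤ a) (hb : 0 ≤ b) (hab : a + b = 1) {x y K : ENNReal}
    (hx : x ≤ K) (hy : y ≤ K) : ENNReal.ofReal a * x + ENNReal.ofReal b * y ≤ K :=
  calc ENNReal.ofReal a * x + ENNReal.ofReal b * y
      ≤ ENNReal.ofReal a * K + ENNReal.ofReal b * K :=
        add_le_add (mul_le_mul_right hx _) (mul_le_mul_right hy _)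
    _ = K := by rw [← add_mul, ← ENNReal.ofReal_add ha hb, hab, ENNReal.ofReal_one, one_mul]

/-- Convex combinations of uniformly bounded portfolios converge. -/
theorem exists_convexHull_portfolio_tendsto (hm : m ≤ mΩ) {η : ℕ → Ω → E}
    (hη : ∀ n, Measurable[m] (η n)) (hη1 : ∀ n ω, ‖η n ω‖ ≤ 1) :
    ∃ y : ℕ → Ω → E, (∀ n, y n ∈ convexHull ℝ (η '' Ici n)) ∧
      ∃ ζ : Ω → E, Measurable[m] ζ ∧ ∀ᵐ ω ∂μ, Tendsto (fun n => y n ω) atTop (nhds (ζ ω)) := by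
  let b := stdOrthonormalBasis ℝ E
  let ι := Fin (Module.finrank ℝ E)
  -- Adding `1` makes the coordinates nonnegative but destroys linearity. They are therefore carried
  -- as a second component, and the convex set `𝒞` keeps them tied to the portfolio.
  let x : ℕ → (Ω → E) × (ι → Ω → ℝ) := fun n => (η n, fun i ω => inner ℝ (b i) (η n ω) + 1)
  let 𝒞 : Set ((Ω → E) × (ι → Ω → ℝ)) := {v | Measurable[m] v.1 ∧ (∀ ω, ‖v.1 ω‖ ≤ 1) ∧
    ∀ i ω, v.2 i ω = inner ℝ (b i) (v.1 ω) + 1}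
  have h𝒞 : Convex ℝ 𝒞 := by
    rintro v ⟨hv1, hv2, hv3⟩ w ⟨hw1, hw2, hw3⟩ α β hα hβ hαβ
    refine ⟨(hv1.const_smul α).add (hw1.const_smul β), fun ω => ?_, fun i ω => ?_⟩
    · calc ‖α • v.1 ω + β • w.1 ω‖ ≤ ‖α • v.1 ω‖ + ‖β • w.1 ω‖ := norm_add_le _ _
        _ ≤ α * 1 + β * 1 := by
          rw [norm_smul, norm_smul, Real.norm_of_nonneg hα, Real.norm_of_nonneg hβ]
          exact add_le_add (mul_le_mul_of_nonneg_left (hv2 ω) hα)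
            (mul_le_mul_of_nonneg_left (hw2 ω) hβ)
        _ = 1 := by linarith
    · change α * v.2 i ω + β * w.2 i ω = inner ℝ (b i) (α • v.1 ω + β • w.1 ω) + 1
      rw [hv3, hw3, inner_add_right, real_inner_smul_right, real_inner_smul_right]
      linear_combination hαβ
  have hx𝒞 : ∀ n, x n ∈ 𝒞 := fun n => ⟨hη n, hη1 n, fun i ω => rfl⟩
  have hhull : convexHull ℝ (range x) ⊆ 𝒞 := convexHull_min (by rintro _ ⟨n, rfl⟩; exact hx𝒞 n) h𝒞
  have habs : ∀ v ∈ 𝒞, ∀ i ω, |(inner ℝ (b i) (v.1 ω) : ℝ)| ≤ 1 := fun v hv i ω => by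
    refine (abs_real_inner_le_norm _ _).trans ?_
    rw [b.norm_eq_one, one_mul]
    exact hv.2.1 ω
  let L := LinearMap.snd ℝ (Ω → E) (ι → Ω → ℝ)
  have hmeas : ∀ v ∈ convexHull ℝ (range x), ∀ i, Measurable (L v i) := fun v hv i => by
    have hv' := hhull hv
    have e : L v i = fun ω => (inner ℝ (b i) (v.1 ω) : ℝ) + 1 := funext fun ω => hv'.2.2 i ω
    rw [e]
    exact (measurable_const.inner (hv'.1.mono hm le_rfl)).add_const 1
  have hpos : ∀ v ∈ convexHull ℝ (range x), ∀ i ω, 0 ≤ L v i ω := fun v hv i ω => by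
    have hv' := hhull hv
    change 0 ≤ v.2 i ω
    rw [hv'.2.2]
    linarith [neg_abs_le (inner ℝ (b i) (v.1 ω) : ℝ), habs v hv' i ω]
  have hb : ∀ v ∈ convexHull ℝ (range x), ∀ i, {ω | 2 < L v i ω} = ∅ := fun v hv i => by
    have hv' := hhull hv
    refine eq_empty_of_forall_notMem fun ω (hω : 2 < v.2 i ω) => ?_
    rw [hv'.2.2] at hω
    linarith [le_abs_self (inner ℝ (b i) (v.1 ω) : ℝ), habs v hv' i ω]
  obtain ⟨y, hy, hyl⟩ := exists_convexHull_tendsto (μ := μ) L x hmeas hpos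
    (fun ε hε => ⟨2, fun v hv i => by rw [hb v hv i, measure_empty]; exact zero_le⟩)
  refine ⟨fun n => (y n).1, fun n => ?_, ?_⟩
  · have h1 := mem_image_of_mem (LinearMap.fst ℝ (Ω → E) (ι → Ω → ℝ)) (hy n)
    rw [LinearMap.image_convexHull, ← image_comp] at h1
    exact h1
  · have hyC : ∀ n, y n ∈ 𝒞 := fun n =>
      hhull (convexHull_mono (image_subset_range _ _) (hy n))
    refine exists_measurable_limit (fun n => (hyC n).1) ?_
    filter_upwards [hyl] with ω hω
    choose l hl using hω
    refine ⟨∑ i, (l i - 1) • b i, ?_⟩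
    have e : ∀ n, (y n).1 ω = ∑ i, ((y n).2 i ω - 1) • b i := fun n => by
      conv_lhs => rw [← b.sum_repr ((y n).1 ω)]
      refine Finset.sum_congr rfl fun i _ => ?_
      rw [(hyC n).2.2 i ω, add_sub_cancel_right, b.repr_apply_apply]
    simp only [e]
    exact tendsto_finsetSum _ fun i _ => ((hl i).sub_const 1).smul_const _

/-- Absence of arbitrage over one period bounds, in probability, the canonical representatives of
portfolios whose losses are bounded in mean. -/
theorem exists_measure_canonicalRep_le (hm : m ≤ mΩ) (hs : Measurable s)
    (hM : ∀ᵐ ω ∂μ, ‖s ω‖ ≤ M)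
    (hNA : ∀ ξ : Ω → E, Measurable[m] ξ → (∀ᵐ ω ∂μ, 0 ≤ (inner ℝ (ξ ω) (s ω) : ℝ)) →
      ∀ᵐ ω ∂μ, (inner ℝ (ξ ω) (s ω) : ℝ) = 0)
    (C : ℝ) {ε : ENNReal} (hε : 0 < ε) :
    ∃ a : ℝ, ∀ ξ : Ω → E, Measurable[m] ξ →
      ∫⁻ ω, ENNReal.ofReal (-(inner ℝ (ξ ω) (s ω) : ℝ)) ∂μ ≤ ENNReal.ofReal C →
      μ {ω | a < ‖canonicalRep m μ s ω (ξ ω)‖} ≤ ε := by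
  by_contra hcon
  push Not at hcon
  have hcon' := fun n : ℕ => hcon ((n : ℝ) + 1)
  choose ξ hξ hξC hξε using hcon'
  -- Dividing by `ρ` leaves norm at most `1`, mean loss at most `C/(n + 1)`, and norm exactly `1` on
  -- an event of measure above `ε`. The mean absolute gains thus stay above some `δ`.
  let ρ : ℕ → Ω → ℝ := fun n ω => max ((n : ℝ) + 1) ‖canonicalRep m μ s ω (ξ n ω)‖
  let η : ℕ → Ω → E := fun n ω => (ρ n ω)⁻¹ • canonicalRep m μ s ω (ξ n ω)
  have hn1 : ∀ n : ℕ, (0 : ℝ) < (n : ℝ) + 1 := fun n => by positivity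
  have hρ : ∀ (n : ℕ) ω, (n : ℝ) + 1 ≤ ρ n ω := fun n ω => le_max_left _ _
  have hρ0 : ∀ n ω, 0 < ρ n ω := fun n ω => (hn1 n).trans_le (hρ n ω)
  have hη : ∀ n, Measurable[m] (η n) := fun n => by
    have h2 : Measurable fun v : E => (max ((n : ℝ) + 1) ‖v‖)⁻¹ • v :=
      (measurable_const.max measurable_norm).inv.smul measurable_id
    exact h2.comp (measurable_canonicalRep (μ := μ) s (hξ n))
  have hη1 : ∀ n ω, ‖η n ω‖ ≤ 1 := fun n ω => by
    rw [norm_smul, norm_inv, Real.norm_of_nonneg (hρ0 n ω).le, inv_mul_le_iff₀ (hρ0 n ω), mul_one]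
    exact le_max_right _ _
  have hηin : ∀ᵐ ω ∂μ, ∀ n, (inner ℝ (η n ω) (s ω) : ℝ) =
      (ρ n ω)⁻¹ * inner ℝ (ξ n ω) (s ω) := by
    filter_upwards [inner_canonicalRep hm hs hM] with ω hω n
    rw [real_inner_smul_left, hω]
  have hlint : ∀ n, ∫⁻ ω, ENNReal.ofReal (-(inner ℝ (η n ω) (s ω) : ℝ)) ∂μ ≤
      ENNReal.ofReal (C / ((n : ℝ) + 1)) := fun n => by
    have h1 : ∫⁻ ω, ENNReal.ofReal (-(inner ℝ (η n ω) (s ω) : ℝ)) ∂μ ≤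
        ∫⁻ ω, ENNReal.ofReal (((n : ℝ) + 1)⁻¹) *
          ENNReal.ofReal (-(inner ℝ (ξ n ω) (s ω) : ℝ)) ∂μ := by
      refine lintegral_mono_ae ?_
      filter_upwards [hηin] with ω hω
      rw [hω, ← mul_neg, ENNReal.ofReal_mul (inv_pos.2 (hρ0 n ω)).le]
      exact mul_le_mul_left (ENNReal.ofReal_le_ofReal
        (inv_anti₀ (hn1 n) (hρ n ω))) _
    refine h1.trans ?_
    rw [lintegral_const_mul' _ _ ENNReal.ofReal_ne_top, div_eq_inv_mul,
      ENNReal.ofReal_mul (inv_pos.2 (hn1 n)).le]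
    exact mul_le_mul_right (hξC n) _
  obtain ⟨δ, hδ, hδI⟩ := exists_pos_le_integral_abs_inner hm hs hM hη hη1 hε fun n => by
    refine (hξε n).le.trans (measure_mono fun ω (hω : (n : ℝ) + 1 < _) => ?_)
    have h1 : canonicalRep m μ s ω (η n ω) = η n ω := by
      simp only [η, map_smul]
      rw [canonicalRep, coimageProj_coimageProj]
    have h2 : ρ n ω = ‖canonicalRep m μ s ω (ξ n ω)‖ := max_eq_right hω.le
    change 1 ≤ ‖canonicalRep m μ s ω (η n ω)‖
    rw [h1, norm_smul, norm_inv, Real.norm_of_nonneg (hρ0 n ω).le, h2, inv_mul_cancel₀]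
    exact ((hn1 n).trans hω).ne'
  have hint : ∀ w : Ω → E, Measurable[m] w → (∀ ω, ‖w ω‖ ≤ 1) →
      Integrable (fun ω => (inner ℝ (w ω) (s ω) : ℝ)) μ := fun w hw hw1 =>
    integrable_inner_of_bounded hs hM (hw.mono hm le_rfl) hw1
  obtain ⟨y, hy, ζ, hζ, hyζ⟩ := exists_convexHull_portfolio_tendsto (μ := μ) hm hη hη1
  -- The bound `δ ≤ E|X|` is not stable under convex combinations. With `|X| = X + 2X⁻` and mean
  -- loss at most `K` it becomes the affine condition `δ - 2K ≤ E X`, which is.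
  let 𝒞 : ℝ → Set (Ω → E) := fun K => {w | Measurable[m] w ∧ (∀ ω, ‖w ω‖ ≤ 1) ∧
    ∫⁻ ω, ENNReal.ofReal (-(inner ℝ (w ω) (s ω) : ℝ)) ∂μ ≤ ENNReal.ofReal K ∧
    δ - 2 * K ≤ ∫ ω, (inner ℝ (w ω) (s ω) : ℝ) ∂μ}
  have h𝒞 : ∀ K, Convex ℝ (𝒞 K) := by
    rintro K v ⟨hv1, hv2, hv3, hv4⟩ w ⟨hw1, hw2, hw3, hw4⟩ α β hα hβ hαβ
    have e : ∀ ω, (inner ℝ ((α • v + β • w) ω) (s ω) : ℝ) =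
        α * inner ℝ (v ω) (s ω) + β * inner ℝ (w ω) (s ω) := fun ω => by
      rw [Pi.add_apply, Pi.smul_apply, Pi.smul_apply, inner_add_left, real_inner_smul_left,
        real_inner_smul_left]
    refine ⟨(hv1.const_smul α).add (hw1.const_smul β), fun ω => ?_, ?_, ?_⟩
    · calc ‖α • v ω + β • w ω‖ ≤ ‖α • v ω‖ + ‖β • w ω‖ := norm_add_le _ _
        _ ≤ α * 1 + β * 1 := by
          rw [norm_smul, norm_smul, Real.norm_of_nonneg hα, Real.norm_of_nonneg hβ]
          exact add_le_add (mul_le_mul_of_nonneg_left (hv2 ω) hα)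
            (mul_le_mul_of_nonneg_left (hw2 ω) hβ)
        _ = 1 := by linarith
    · simp only [e]
      exact (lintegral_neg_combo_le ((hv1.mono hm le_rfl).inner hs) hα hβ).trans
        (combo_le_of_le hα hβ hαβ hv3 hw3)
    · simp only [e]
      rw [integral_add ((hint v hv1 hv2).const_mul α) ((hint w hw1 hw2).const_mul β),
        integral_const_mul, integral_const_mul]
      calc δ - 2 * K = α * (δ - 2 * K) + β * (δ - 2 * K) := by rw [← add_mul, hαβ, one_mul]
        _ ≤ _ := add_le_add (mul_le_mul_of_nonneg_left hv4 hα) (mul_le_mul_of_nonneg_left hw4 hβ)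
  have hC0 : 0 ≤ max C 0 := le_max_right _ _
  have hη𝒞 : ∀ N n : ℕ, N ≤ n → η n ∈ 𝒞 (max C 0 / ((N : ℝ) + 1)) := by
    intro N n hNn
    have hle : C / ((n : ℝ) + 1) ≤ max C 0 / ((N : ℝ) + 1) :=
      (div_le_div_of_nonneg_right (le_max_left C 0) (hn1 n).le).trans
        (div_le_div_of_nonneg_left hC0 (hn1 N) (by exact_mod_cast Nat.succ_le_succ hNn))
    have h3 := (hlint n).trans (ENNReal.ofReal_le_ofReal hle)
    refine ⟨hη n, hη1 n, h3, ?_⟩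
    have hi := hint _ (hη n) (hη1 n)
    have hneg : ∫ ω, max (-(inner ℝ (η n ω) (s ω) : ℝ)) 0 ∂μ ≤ max C 0 / ((N : ℝ) + 1) := by
      have hmax : ∀ ω, 0 ≤ max (-(inner ℝ (η n ω) (s ω) : ℝ)) 0 := fun ω => le_max_right _ _
      rw [integral_eq_lintegral_of_nonneg_ae (Eventually.of_forall hmax) (hi.neg.pos_part).1]
      refine ENNReal.toReal_le_of_le_ofReal (by positivity) (le_trans (le_of_eq ?_) h3)
      refine lintegral_congr fun ω => ?_
      rw [ENNReal.ofReal_max, ENNReal.ofReal_zero, max_eq_left zero_le]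
    have habs : ∫ ω, |(inner ℝ (η n ω) (s ω) : ℝ)| ∂μ =
        ∫ ω, (inner ℝ (η n ω) (s ω) : ℝ) ∂μ +
          2 * ∫ ω, max (-(inner ℝ (η n ω) (s ω) : ℝ)) 0 ∂μ := by
      have hp : Integrable (fun ω => 2 * max (-(inner ℝ (η n ω) (s ω) : ℝ)) 0) μ :=
        hi.neg.pos_part.const_mul 2
      rw [← integral_const_mul, ← integral_add hi hp]
      refine integral_congr_ae (Eventually.of_forall fun ω => ?_)
      simp only
      rcases le_total 0 (inner ℝ (η n ω) (s ω) : ℝ) with h | h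
      · rw [abs_of_nonneg h, max_eq_right (neg_nonpos.2 h)]; ring
      · rw [abs_of_nonpos h, max_eq_left (neg_nonneg.2 h)]; ring
    have := hδI n
    linarith
  have hy𝒞 : ∀ n : ℕ, y n ∈ 𝒞 (max C 0 / ((n : ℝ) + 1)) := fun n =>
    convexHull_min (by rintro _ ⟨k, hk, rfl⟩; exact hη𝒞 n k hk) (h𝒞 _) (hy n)
  have hK0 : Tendsto (fun n : ℕ => max C 0 / ((n : ℝ) + 1)) atTop (nhds 0) := by
    simpa [div_eq_mul_inv] using
      (tendsto_one_div_add_atTop_nhds_zero_nat (𝕜 := ℝ)).const_mul (max C 0)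
  have hylim : ∀ᵐ ω ∂μ, Tendsto (fun n => (inner ℝ (y n ω) (s ω) : ℝ)) atTop
      (nhds (inner ℝ (ζ ω) (s ω))) := by
    filter_upwards [hyζ] with ω hω
    exact hω.inner tendsto_const_nhds
  have hζpos : ∀ᵐ ω ∂μ, 0 ≤ (inner ℝ (ζ ω) (s ω) : ℝ) := by
    have h1 : ∫⁻ ω, ENNReal.ofReal (-(inner ℝ (ζ ω) (s ω) : ℝ)) ∂μ = 0 := by
      refine le_antisymm ?_ zero_le
      calc ∫⁻ ω, ENNReal.ofReal (-(inner ℝ (ζ ω) (s ω) : ℝ)) ∂μ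
          = ∫⁻ ω, liminf (fun n => ENNReal.ofReal (-(inner ℝ (y n ω) (s ω) : ℝ))) atTop ∂μ := by
            refine lintegral_congr_ae ?_
            filter_upwards [hylim] with ω hω
            exact (((ENNReal.continuous_ofReal.tendsto _).comp hω.neg).liminf_eq).symm
        _ ≤ liminf (fun n => ∫⁻ ω, ENNReal.ofReal (-(inner ℝ (y n ω) (s ω) : ℝ)) ∂μ) atTop :=
            lintegral_liminf_le fun n =>
              ((((hy𝒞 n).1.mono hm le_rfl).inner hs).neg).ennreal_ofReal
        _ ≤ liminf (fun n : ℕ => ENNReal.ofReal (max C 0 / ((n : ℝ) + 1))) atTop :=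
            liminf_le_liminf (Eventually.of_forall fun n => (hy𝒞 n).2.2.1)
        _ = 0 := by
            have := ((ENNReal.continuous_ofReal.tendsto _).comp hK0).liminf_eq
            rwa [ENNReal.ofReal_zero] at this
    have hmeas : Measurable fun ω => ENNReal.ofReal (-(inner ℝ (ζ ω) (s ω) : ℝ)) :=
      ((hζ.mono hm le_rfl).inner hs).neg.ennreal_ofReal
    rw [lintegral_eq_zero_iff hmeas] at h1
    filter_upwards [h1] with ω hω
    simpa using hω
  -- The limit has no losses, so its gain vanishes. The means then tend to `0`, although they lie
  -- above a sequence tending to `δ > 0`.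
  have hζ0 := hNA ζ hζ hζpos
  have hIlim : Tendsto (fun n => ∫ ω, (inner ℝ (y n ω) (s ω) : ℝ) ∂μ) atTop (nhds 0) := by
    have := tendsto_integral_of_dominated_convergence (μ := μ) (fun _ => 1 * M)
      (F := fun n ω => (inner ℝ (y n ω) (s ω) : ℝ)) (f := fun ω => inner ℝ (ζ ω) (s ω))
      (fun n => (hint _ (hy𝒞 n).1 (hy𝒞 n).2.1).1) (integrable_const _) (fun n => ?_) hylim
    · rwa [integral_eq_zero_of_ae hζ0] at this
    · filter_upwards [hM] with ω hω
      rw [Real.norm_eq_abs]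
      exact (abs_real_inner_le_norm _ _).trans
        (mul_le_mul ((hy𝒞 n).2.1 ω) hω (norm_nonneg _) zero_le_one)
  have hlow : Tendsto (fun n : ℕ => δ - 2 * (max C 0 / ((n : ℝ) + 1))) atTop (nhds δ) := by
    simpa using (hK0.const_mul 2).const_sub δ
  exact absurd (le_of_tendsto_of_tendsto' hlow hIlim fun n => (hy𝒞 n).2.2.2) (not_le.2 hδ)

end OnePeriod

/-! ### A separating density over one period -/

section Signed

variable {Ω : Type*} {mΩ : MeasurableSpace Ω} {μ : Measure Ω} [IsFiniteMeasure μ]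
  {E ι : Type*} [AddCommGroup E] [Module ℝ E] [Fintype ι]

-- Markov's inequality, with a threshold that serves all `Y` at once.
omit [IsFiniteMeasure μ] in
theorem measure_lt_le_of_lintegral_le {K : ENNReal} (hK : K ≠ ⊤) {ε : ENNReal} (hε : 0 < ε) :
    ∃ a : ℝ, ∀ Y : Ω → ℝ, Measurable Y → ∫⁻ ω, ENNReal.ofReal (Y ω) ∂μ ≤ K →
      μ {ω | a < Y ω} ≤ ε := by
  obtain ⟨a, ha0, ha⟩ : ∃ a : ℝ, 0 < a ∧ K ≤ ENNReal.ofReal a * ε := by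
    rcases eq_or_ne ε ⊤ with rfl | hε'
    · exact ⟨1, one_pos, by simp⟩
    · refine ⟨(K / ε).toReal + 1, by positivity, ?_⟩
      have h1 : K / ε ≠ ⊤ := ENNReal.div_ne_top hK hε.ne'
      calc K = K / ε * ε := (ENNReal.div_mul_cancel hε.ne' hε').symm
        _ ≤ _ := by
          refine mul_le_mul_left ((ENNReal.ofReal_toReal h1).symm.trans_le ?_) _
          exact ENNReal.ofReal_le_ofReal (le_add_of_nonneg_right zero_le_one)
  refine ⟨a, fun Y hY hYK => ?_⟩
  have h1 : μ {ω | a < Y ω} ≤ μ {ω | ENNReal.ofReal a ≤ ENNReal.ofReal (Y ω)} :=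
    measure_mono fun ω (hω : a < Y ω) => ENNReal.ofReal_le_ofReal hω.le
  have h2 := (mul_meas_ge_le_lintegral hY.ennreal_ofReal (ENNReal.ofReal a) (μ := μ)).trans
    (hYK.trans ha)
  have h3 := ENNReal.ofReal_pos.2 ha0
  exact h1.trans ((ENNReal.mul_le_mul_iff_right h3.ne' ENNReal.ofReal_ne_top).1 h2)

/-- A variant of `exists_convexHull_tendsto` for random variables whose negative parts are bounded
in mean. -/
theorem exists_convexHull_tendsto_of_neg_bounded (L : E →ₗ[ℝ] (ι → Ω → ℝ)) (x : ℕ → E)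
    {K : ENNReal} (hK : K ≠ ⊤)
    (hmeas : ∀ y ∈ convexHull ℝ (range x), ∀ i, Measurable (L y i))
    (hneg : ∀ n i, ∫⁻ ω, ENNReal.ofReal (-L (x n) i ω) ∂μ ≤ K)
    (hb : ∀ ε : ENNReal, 0 < ε → ∃ a : ℝ, ∀ y ∈ convexHull ℝ (range x), ∀ i,
      μ {ω | a < L y i ω} ≤ ε) :
    ∃ y : ℕ → E, (∀ n, y n ∈ convexHull ℝ (x '' Ici n)) ∧
      ∀ᵐ ω ∂μ, ∀ i, ∃ l : ℝ, Tendsto (fun n => L (y n) i ω) atTop (nhds l) := by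
  let F := E × (ι → Ω → ℝ)
  let A : F →ₗ[ℝ] (ι → Ω → ℝ) := L.comp (LinearMap.fst ℝ E (ι → Ω → ℝ))
  let N : F →ₗ[ℝ] (ι → Ω → ℝ) := LinearMap.snd ℝ E (ι → Ω → ℝ)
  -- The negative parts are not linear in `x`, so they enter as a separate component. Their convex
  -- combinations stay nonnegative, stay bounded in mean by `K`, and still compensate the negative
  -- values of `L`, so both `L + N` and `N` are nonnegative.
  let L' : F →ₗ[ℝ] (ι ⊕ ι → Ω → ℝ) := LinearMap.pi fun j =>
    Sum.elim (fun i => (LinearMap.proj i).comp (A + N)) (fun i => (LinearMap.proj i).comp N) j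
  let x' : ℕ → F := fun n => (x n, fun i ω => max (-L (x n) i ω) 0)
  let 𝒞 : Set F := {v | v.1 ∈ convexHull ℝ (range x) ∧ ∀ i, Measurable (v.2 i) ∧
    (∀ ω, 0 ≤ v.2 i ω) ∧ (∀ ω, 0 ≤ L v.1 i ω + v.2 i ω) ∧
    ∫⁻ ω, ENNReal.ofReal (v.2 i ω) ∂μ ≤ K}
  have hC : Convex ℝ 𝒞 := by
    rintro v ⟨hv, hv'⟩ w ⟨hw, hw'⟩ α β hα hβ hαβ
    refine ⟨convex_convexHull ℝ _ hv hw hα hβ hαβ, fun i => ?_⟩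
    obtain ⟨hv1, hv2, hv3, hv4⟩ := hv' i
    obtain ⟨hw1, hw2, hw3, hw4⟩ := hw' i
    refine ⟨(hv1.const_mul α).add (hw1.const_mul β), fun ω =>
      add_nonneg (mul_nonneg hα (hv2 ω)) (mul_nonneg hβ (hw2 ω)), fun ω => ?_, ?_⟩
    · have e : L (α • v + β • w).1 i ω = α * L v.1 i ω + β * L w.1 i ω := by
        rw [Prod.fst_add, Prod.smul_fst, Prod.smul_fst, map_add, map_smul, map_smul]
        rfl
      have e' : (α • v + β • w).2 i ω = α * v.2 i ω + β * w.2 i ω := rfl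
      rw [e, e']
      have := add_nonneg (mul_nonneg hα (hv3 ω)) (mul_nonneg hβ (hw3 ω))
      linarith
    · have := lintegral_neg_combo_le (μ := μ) (Y := -(w.2 i)) hv1.neg hα hβ
      simp only [Pi.neg_apply, neg_neg] at this
      refine le_trans (le_trans (le_of_eq ?_) this) (combo_le_of_le hα hβ hαβ hv4 hw4)
      refine lintegral_congr fun ω => congrArg _ ?_
      change α * v.2 i ω + β * w.2 i ω = _
      ring
  have hx' : ∀ n, x' n ∈ 𝒞 := fun n => by
    have hx := subset_convexHull ℝ _ (mem_range_self (f := x) n)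
    refine ⟨hx, fun i => ⟨(hmeas _ hx i).neg.max measurable_const,
      fun ω => le_max_right _ _, fun ω => ?_, ?_⟩⟩
    · have := le_max_left (-L (x n) i ω) 0
      change 0 ≤ L (x n) i ω + max (-L (x n) i ω) 0
      linarith
    · refine (lintegral_congr fun ω => ?_).trans_le (hneg n i)
      change ENNReal.ofReal (max (-L (x n) i ω) 0) = _
      rw [ENNReal.ofReal_max, ENNReal.ofReal_zero, max_eq_left zero_le]
  have hhull : convexHull ℝ (range x') ⊆ 𝒞 :=
    convexHull_min (by rintro _ ⟨n, rfl⟩; exact hx' n) hC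
  obtain ⟨y, hy, hyl⟩ := exists_convexHull_tendsto (μ := μ) L' x' (by
      rintro v hv (i | i)
      · exact (hmeas _ (hhull hv).1 i).add ((hhull hv).2 i).1
      · exact ((hhull hv).2 i).1) (by
      rintro v hv (i | i) ω
      · exact ((hhull hv).2 i).2.2.1 ω
      · exact ((hhull hv).2 i).2.1 ω) (by
      intro ε hε
      have hε2 : 0 < ε / 2 := ENNReal.half_pos hε.ne'
      obtain ⟨a, ha⟩ := measure_lt_le_of_lintegral_le (μ := μ) hK hε2
      obtain ⟨b, hb⟩ := hb _ hε2
      refine ⟨max a (a + b), ?_⟩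
      rintro v hv (i | i)
      · have h1 := ha _ ((hhull hv).2 i).1 ((hhull hv).2 i).2.2.2
        have h2 := hb _ (hhull hv).1 i
        refine le_trans (measure_mono fun ω (hω : max a (a + b) < L v.1 i ω + v.2 i ω) => ?_)
          ((measure_union_le {ω | a < v.2 i ω} {ω | b < L v.1 i ω}).trans
            ((add_le_add h1 h2).trans_eq (ENNReal.add_halves ε)))
        by_contra hcon
        simp only [mem_union, not_or] at hcon
        obtain ⟨h3, h4⟩ := hcon
        have h3' : v.2 i ω ≤ a := not_lt.1 h3
        have h4' : L v.1 i ω ≤ b := not_lt.1 h4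
        have := (le_max_right a (a + b)).trans_lt hω
        linarith
      · have h1 := ha _ ((hhull hv).2 i).1 ((hhull hv).2 i).2.2.2
        exact le_trans (measure_mono fun ω (hω : max a (a + b) < v.2 i ω) =>
          (le_max_left a (a + b)).trans_lt hω) (h1.trans ENNReal.half_le_self))
  refine ⟨fun n => (y n).1, fun n => ?_, ?_⟩
  · have h1 := mem_image_of_mem (LinearMap.fst ℝ E (ι → Ω → ℝ)) (hy n)
    rw [LinearMap.image_convexHull, ← image_comp] at h1
    exact h1
  · filter_upwards [hyl] with ω hω i
    obtain ⟨l₁, h₁⟩ := hω (Sum.inl i)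
    obtain ⟨l₂, h₂⟩ := hω (Sum.inr i)
    refine ⟨l₁ - l₂, (h₁.sub h₂).congr fun n => ?_⟩
    change L (y n).1 i ω + (y n).2 i ω - (y n).2 i ω = _
    ring

end Signed

section Loss

/-- A smooth decreasing convex function that dominates twice the negative part. -/
def smoothLoss (x : ℝ) : ℝ := √(1 + x ^ 2) - x

theorem abs_le_sqrt_one_add_sq (x : ℝ) : |x| < √(1 + x ^ 2) := by
  rw [← Real.sqrt_sq_eq_abs]
  exact Real.sqrt_lt_sqrt (sq_nonneg _) (by linarith)

theorem smoothLoss_pos (x : ℝ) : 0 < smoothLoss x :=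
  sub_pos.2 ((le_abs_self x).trans_lt (abs_le_sqrt_one_add_sq x))

theorem neg_le_smoothLoss (x : ℝ) : -x ≤ smoothLoss x := by
  have := Real.sqrt_nonneg (1 + x ^ 2)
  unfold smoothLoss
  linarith

theorem smoothLoss_add_le (x h : ℝ) : smoothLoss (x + h) ≤ smoothLoss x + 2 * |h| := by
  have h1 : √(1 + (x + h) ^ 2) ≤ √(1 + x ^ 2) + |h| := by
    rw [Real.sqrt_le_iff]
    refine ⟨by positivity, ?_⟩
    have h2 : x * h ≤ √(1 + x ^ 2) * |h| := by
      refine (le_abs_self _).trans ?_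
      rw [abs_mul]
      exact mul_le_mul_of_nonneg_right (abs_le_sqrt_one_add_sq x).le (abs_nonneg _)
    have h3 : √(1 + x ^ 2) ^ 2 = 1 + x ^ 2 := Real.sq_sqrt (by positivity)
    have h4 := sq_abs h
    nlinarith
  have h5 := neg_abs_le h
  unfold smoothLoss
  linarith

/-- After squaring, convexity reduces to Cauchy–Schwarz for `(1, x)` and `(1, y)`. -/
theorem smoothLoss_combo_le {a b : ℝ} (ha : 0 ≤ a) (hb : 0 ≤ b) (hab : a + b = 1) (x y : ℝ) :
    smoothLoss (a * x + b * y) ≤ a * smoothLoss x + b * smoothLoss y := by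
  have hp : √(1 + x ^ 2) ^ 2 = 1 + x ^ 2 := Real.sq_sqrt (by positivity)
  have hq : √(1 + y ^ 2) ^ 2 = 1 + y ^ 2 := Real.sq_sqrt (by positivity)
  have hpq : 1 + x * y ≤ √(1 + x ^ 2) * √(1 + y ^ 2) := by
    rw [← Real.sqrt_mul (by positivity)]
    refine Real.le_sqrt_of_sq_le ?_
    nlinarith [sq_nonneg (x - y)]
  have h1 : √(1 + (a * x + b * y) ^ 2) ≤ a * √(1 + x ^ 2) + b * √(1 + y ^ 2) := by
    rw [Real.sqrt_le_iff]
    refine ⟨by positivity, ?_⟩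
    have e : b = 1 - a := by linarith
    have h2 := mul_le_mul_of_nonneg_left hpq (mul_nonneg ha hb)
    calc 1 + (a * x + b * y) ^ 2
        = a ^ 2 * (1 + x ^ 2) + b ^ 2 * (1 + y ^ 2) + 2 * (a * b * (1 + x * y)) := by
          subst e; ring
      _ ≤ a ^ 2 * √(1 + x ^ 2) ^ 2 + b ^ 2 * √(1 + y ^ 2) ^ 2 +
          2 * (a * b * (√(1 + x ^ 2) * √(1 + y ^ 2))) := by rw [hp, hq]; linarith
      _ = _ := by ring
  unfold smoothLoss
  linarith

theorem hasDerivAt_smoothLoss (x : ℝ) : HasDerivAt smoothLoss (x / √(1 + x ^ 2) - 1) x := by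
  have h1 : HasDerivAt (fun x : ℝ => 1 + x ^ 2) (2 * x) x := by
    simpa using (hasDerivAt_pow 2 x).const_add 1
  have h2 := (h1.sqrt (by positivity)).sub (hasDerivAt_id x)
  rwa [mul_div_mul_left _ _ two_ne_zero] at h2

theorem abs_div_sqrt_lt_one (x : ℝ) : |x / √(1 + x ^ 2)| < 1 := by
  have : 0 < √(1 + x ^ 2) := by positivity
  rw [abs_div, abs_of_pos this, div_lt_one this]
  exact abs_le_sqrt_one_add_sq x

theorem continuous_smoothLoss : Continuous smoothLoss := by
  unfold smoothLoss
  fun_prop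

end Loss

section Density

variable {E : Type*} [NormedAddCommGroup E] [InnerProductSpace ℝ E] [FiniteDimensional ℝ E]
  [MeasurableSpace E] [BorelSpace E] {Ω : Type*} {m m' mΩ : MeasurableSpace Ω} {μ : Measure Ω}
  [IsFiniteMeasure μ] {s : Ω → E} {M : ℝ}

/-- Under absence of arbitrage the expected loss is minimised by some portfolio. -/
theorem exists_minimizer_smoothLoss (hm : m ≤ mΩ) (hs : Measurable s)
    (hM : ∀ᵐ ω ∂μ, ‖s ω‖ ≤ M)
    (hNA : ∀ ξ : Ω → E, Measurable[m] ξ → (∀ᵐ ω ∂μ, 0 ≤ (inner ℝ (ξ ω) (s ω) : ℝ)) →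
      ∀ᵐ ω ∂μ, (inner ℝ (ξ ω) (s ω) : ℝ) = 0) :
    ∃ ζ : Ω → E, Measurable[m] ζ ∧
      (∫⁻ ω, ENNReal.ofReal (smoothLoss (inner ℝ (ζ ω) (s ω))) ∂μ) ≠ ⊤ ∧
      ∀ ξ : Ω → E, Measurable[m] ξ →
        ∫⁻ ω, ENNReal.ofReal (smoothLoss (inner ℝ (ζ ω) (s ω))) ∂μ ≤
          ∫⁻ ω, ENNReal.ofReal (smoothLoss (inner ℝ (ξ ω) (s ω))) ∂μ := by
  let J : (Ω → E) → ENNReal := fun ξ =>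
    ∫⁻ ω, ENNReal.ofReal (smoothLoss (inner ℝ (ξ ω) (s ω))) ∂μ
  let I : ENNReal := ⨅ ξ : {ξ : Ω → E // Measurable[m] ξ}, J ξ
  have hIle : ∀ ξ : Ω → E, Measurable[m] ξ → I ≤ J ξ := fun ξ hξ =>
    iInf_le (fun ξ : {ξ : Ω → E // Measurable[m] ξ} => J ξ) ⟨ξ, hξ⟩
  have hI : I ≠ ⊤ := by
    refine ((hIle (fun _ => 0) measurable_const).trans_lt ?_).ne
    simp only [J, inner_zero_left]
    rw [lintegral_const]
    exact ENNReal.mul_lt_top ENNReal.ofReal_lt_top (measure_lt_top _ _)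
  have hex : ∀ n : ℕ, ∃ ξ : Ω → E, Measurable[m] ξ ∧ J ξ ≤ I + ((n : ENNReal) + 1)⁻¹ := by
    intro n
    have h1 : I < I + ((n : ENNReal) + 1)⁻¹ := ENNReal.lt_add_right hI (by simp)
    obtain ⟨ξ, hξ⟩ := iInf_lt_iff.1 h1
    exact ⟨ξ, ξ.2, hξ.le⟩
  choose x hx hxJ using hex
  have hin : ∀ ξ : Ω → E, Measurable[m] ξ → Measurable fun ω => (inner ℝ (ξ ω) (s ω) : ℝ) :=
    fun ξ hξ => (hξ.mono hm le_rfl).inner hs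
  have hconv : ∀ K : ENNReal, Convex ℝ {ξ : Ω → E | Measurable[m] ξ ∧ J ξ ≤ K} := by
    rintro K v ⟨hv1, hv2⟩ w ⟨hw1, hw2⟩ α β hα hβ hαβ
    refine ⟨(hv1.const_smul α).add (hw1.const_smul β), ?_⟩
    have h1 := lintegral_neg_combo_le (μ := μ)
      (X := fun ω => -smoothLoss (inner ℝ (v ω) (s ω)))
      (Y := fun ω => -smoothLoss (inner ℝ (w ω) (s ω)))
      (continuous_smoothLoss.measurable.comp (hin v hv1)).neg hα hβ
    simp only [neg_neg] at h1
    refine le_trans (le_trans (lintegral_mono fun ω => ENNReal.ofReal_le_ofReal ?_) h1)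
      (combo_le_of_le hα hβ hαβ hv2 hw2)
    have e : (inner ℝ ((α • v + β • w) ω) (s ω) : ℝ) =
        α * inner ℝ (v ω) (s ω) + β * inner ℝ (w ω) (s ω) := by
      rw [Pi.add_apply, Pi.smul_apply, Pi.smul_apply, inner_add_left, real_inner_smul_left,
        real_inner_smul_left]
    rw [e]
    refine (smoothLoss_combo_le hα hβ hαβ _ _).trans_eq ?_
    ring
  have hnegJ : ∀ ξ : Ω → E, ∫⁻ ω, ENNReal.ofReal (-(inner ℝ (ξ ω) (s ω) : ℝ)) ∂μ ≤ J ξ := fun ξ =>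
    lintegral_mono fun ω => ENNReal.ofReal_le_ofReal (neg_le_smoothLoss _)
  have hinv1 : ∀ n : ℕ, ((n : ENNReal) + 1)⁻¹ ≤ 1 := fun n => by
    rw [ENNReal.inv_le_one]
    exact le_add_self
  have hK : I + 1 ≠ ⊤ := ENNReal.add_ne_top.2 ⟨hI, ENNReal.one_ne_top⟩
  have hhull : convexHull ℝ (range x) ⊆ {ξ : Ω → E | Measurable[m] ξ ∧ J ξ ≤ I + 1} :=
    convexHull_min (by
      rintro _ ⟨n, rfl⟩
      exact ⟨hx n, (hxJ n).trans (add_le_add le_rfl (hinv1 n))⟩) (hconv _)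
  let L : (Ω → E) →ₗ[ℝ] (Unit → Ω → ℝ) :=
    { toFun := fun ξ _ ω => inner ℝ (ξ ω) (s ω)
      map_add' := fun ξ η => by ext; exact inner_add_left _ _ _
      map_smul' := fun r ξ => by ext; exact real_inner_smul_left _ _ _ }
  obtain ⟨y, hy, hyl⟩ := exists_convexHull_tendsto_of_neg_bounded (μ := μ) L x hK
    (fun v hv _ => hin v (hhull hv).1)
    -- The expected loss bounds the negative parts in mean. Absence of arbitrage then bounds the
    -- canonical representatives, and through them the gains, in probability.
    (fun n _ => (hnegJ _).trans ((hxJ n).trans (add_le_add le_rfl (hinv1 n)))) (by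
      intro ε hε
      obtain ⟨a, ha⟩ := exists_measure_canonicalRep_le hm hs hM hNA (I + 1).toReal hε
      refine ⟨max a 0 * M, fun v hv _ => le_trans (measure_mono_ae ?_) (ha v (hhull hv).1 ?_)⟩
      · filter_upwards [hM, inner_canonicalRep hm hs hM] with ω hω hω2
        intro (h : max a 0 * M < inner ℝ (v ω) (s ω))
        change a < ‖canonicalRep m μ s ω (v ω)‖
        by_contra hcon
        refine not_le.2 h ?_
        rw [← hω2]
        refine (real_inner_le_norm _ _).trans (mul_le_mul ((not_lt.1 hcon).trans
          (le_max_left _ _)) hω (norm_nonneg _) (le_max_right _ _))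
      · rw [ENNReal.ofReal_toReal hK]
        exact (hnegJ v).trans (hhull hv).2)
  have hym : ∀ n, Measurable[m] (y n) ∧ J (y n) ≤ I + ((n : ENNReal) + 1)⁻¹ := fun n =>
    convexHull_min (by
      rintro _ ⟨k, hk, rfl⟩
      refine ⟨hx k, (hxJ k).trans (add_le_add le_rfl (ENNReal.inv_le_inv.2 ?_))⟩
      exact add_le_add (Nat.cast_le.2 hk) le_rfl) (hconv _) (hy n)
  obtain ⟨σ, hσ, ζ, hζ, hζl⟩ := exists_subseq_canonicalRep_tendsto hm hs hM
    (fun n => (hym n).1) (hyl.mono fun ω hω => hω ())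
  have hlim : ∀ᵐ ω ∂μ, Tendsto (fun n => (inner ℝ (y (σ n) ω) (s ω) : ℝ)) atTop
      (nhds (inner ℝ (ζ ω) (s ω))) := by
    filter_upwards [hζl, inner_canonicalRep hm hs hM] with ω h1 h2
    exact (h1.inner tendsto_const_nhds).congr fun n => h2 _
  have hJζ : J ζ ≤ I := by
    have hε : Tendsto (fun n : ℕ => I + ((σ n : ℕ) + 1 : ENNReal)⁻¹) atTop (nhds I) := by
      have h1 : Tendsto (fun n : ℕ => ((n : ENNReal) + 1)⁻¹) atTop (nhds 0) := by
        have := (tendsto_add_atTop_iff_nat 1).2 ENNReal.tendsto_inv_nat_nhds_zero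
        simpa using this
      simpa using (h1.comp hσ.tendsto_atTop).const_add I
    calc J ζ = ∫⁻ ω, liminf (fun n => ENNReal.ofReal (smoothLoss (inner ℝ (y (σ n) ω) (s ω))))
          atTop ∂μ := by
          refine lintegral_congr_ae ?_
          filter_upwards [hlim] with ω hω
          exact (((ENNReal.continuous_ofReal.comp continuous_smoothLoss).tendsto _).comp
            hω).liminf_eq.symm
      _ ≤ liminf (fun n => J (y (σ n))) atTop := lintegral_liminf_le fun n =>
          (continuous_smoothLoss.measurable.comp (hin _ (hym _).1)).ennreal_ofReal
      _ ≤ liminf (fun n : ℕ => I + ((σ n : ℕ) + 1 : ENNReal)⁻¹) atTop :=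
          liminf_le_liminf (Eventually.of_forall fun n => (hym _).2)
      _ = I := hε.liminf_eq
  exact ⟨ζ, hζ, (hJζ.trans_lt hI.lt_top).ne, fun ξ hξ => hJζ.trans (hIle ξ hξ)⟩

/-- Over one period without arbitrage there is a bounded positive density that makes all bounded
portfolios centered. -/
theorem exists_density_of_noArbitrage (hm : m ≤ m') (hm' : m' ≤ mΩ) (hs : Measurable[m'] s)
    (hM : ∀ᵐ ω ∂μ, ‖s ω‖ ≤ M)
    (hNA : ∀ ξ : Ω → E, Measurable[m] ξ → (∀ᵐ ω ∂μ, 0 ≤ (inner ℝ (ξ ω) (s ω) : ℝ)) →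
      ∀ᵐ ω ∂μ, (inner ℝ (ξ ω) (s ω) : ℝ) = 0) :
    ∃ z : Ω → ℝ, Measurable[m'] z ∧ (∀ ω, 0 < z ω) ∧ (∀ ω, z ω ≤ 2) ∧
      ∀ ξ : Ω → E, Measurable[m] ξ → ∀ B : ℝ, (∀ ω, ‖ξ ω‖ ≤ B) →
        ∫ ω, z ω * (inner ℝ (ξ ω) (s ω) : ℝ) ∂μ = 0 := by
  have hs' : Measurable s := hs.mono hm' le_rfl
  have hmΩ : m ≤ mΩ := hm.trans hm'
  obtain ⟨ζ, hζ, hfin, hmin⟩ := exists_minimizer_smoothLoss hmΩ hs' hM hNA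
  let X : Ω → ℝ := fun ω => inner ℝ (ζ ω) (s ω)
  let g : ℝ → ℝ := fun x => x / √(1 + x ^ 2)
  have hg : Measurable g := by fun_prop
  have hX : Measurable[m'] X := by
    have h1 : Measurable[m'] ζ := hζ.mono hm le_rfl
    exact Measurable.inner h1 hs
  have hX' : Measurable X := hX.mono hm' le_rfl
  have habs : ∀ x, |g x| < 1 := abs_div_sqrt_lt_one
  -- The density is minus the derivative of the loss at the minimiser; `|g| < 1` puts it strictly
  -- between `0` and `2`. Centering is the first-order condition in the direction of a bounded
  -- portfolio.
  refine ⟨fun ω => 1 - g (X ω), measurable_const.sub (hg.comp hX),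
    fun ω => sub_pos.2 ((le_abs_self _).trans_lt (habs _)), fun ω => ?_, ?_⟩
  · have := neg_abs_le (g (X ω))
    have := habs (X ω)
    linarith
  intro ξ hξ B hB
  have hW : Measurable fun ω => (inner ℝ (ξ ω) (s ω) : ℝ) := (hξ.mono hmΩ le_rfl).inner hs'
  have hWB : ∀ᵐ ω ∂μ, |(inner ℝ (ξ ω) (s ω) : ℝ)| ≤ B * M := by
    filter_upwards [hM] with ω hω
    exact (abs_real_inner_le_norm _ _).trans
      (mul_le_mul (hB ω) hω (norm_nonneg _) ((norm_nonneg _).trans (hB ω)))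
  have hXi : Integrable (fun ω => smoothLoss (X ω)) μ :=
    ⟨(continuous_smoothLoss.measurable.comp hX').aestronglyMeasurable, by
      rw [hasFiniteIntegral_iff_ofReal (Eventually.of_forall fun ω => (smoothLoss_pos _).le)]
      exact hfin.lt_top⟩
  let F : ℝ → Ω → ℝ := fun t ω => smoothLoss (X ω + t * inner ℝ (ξ ω) (s ω))
  have hFm : ∀ t, AEStronglyMeasurable (F t) μ := fun t =>
    (continuous_smoothLoss.measurable.comp (hX'.add (hW.const_mul t))).aestronglyMeasurable
  have hFi : ∀ t, Integrable (F t) μ := fun t => by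
    refine (hXi.add (integrable_const (2 * (|t| * (B * M))))).mono' (hFm t) ?_
    filter_upwards [hWB] with ω hω
    rw [Real.norm_of_nonneg (smoothLoss_pos _).le]
    refine (smoothLoss_add_le _ _).trans (add_le_add le_rfl ?_)
    rw [abs_mul]
    exact mul_le_mul_of_nonneg_left (mul_le_mul_of_nonneg_left hω (abs_nonneg _)) zero_le_two
  have hder := hasDerivAt_integral_of_dominated_loc_of_deriv_le (μ := μ) (F := F) (x₀ := 0)
    (F' := fun t ω => (g (X ω + t * inner ℝ (ξ ω) (s ω)) - 1) * inner ℝ (ξ ω) (s ω))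
    (bound := fun _ => 2 * (B * M)) (s := univ) univ_mem (Eventually.of_forall hFm) (hFi 0)
    (((hg.comp (hX'.add (hW.const_mul 0))).sub_const 1).mul hW).aestronglyMeasurable (by
      filter_upwards [hWB] with ω hω t _
      rw [Real.norm_eq_abs, abs_mul]
      refine mul_le_mul ?_ hω (abs_nonneg _) zero_le_two
      have := habs (X ω + t * inner ℝ (ξ ω) (s ω))
      rw [abs_lt] at this
      rw [abs_le]
      constructor <;> linarith) (integrable_const _) (Eventually.of_forall fun ω t _ => by
      have h1 : HasDerivAt (fun t : ℝ => X ω + t * inner ℝ (ξ ω) (s ω))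
          (inner ℝ (ξ ω) (s ω)) t := by
        simpa using ((hasDerivAt_id t).mul_const (inner ℝ (ξ ω) (s ω) : ℝ)).const_add (X ω)
      exact (hasDerivAt_smoothLoss _).comp t h1)
  have hmin' : IsLocalMin (fun t => ∫ ω, F t ω ∂μ) 0 := by
    refine Eventually.of_forall fun t => ?_
    have e : ∀ t, ∫ ω, F t ω ∂μ = (∫⁻ ω, ENNReal.ofReal (F t ω) ∂μ).toReal := fun t =>
      integral_eq_lintegral_of_nonneg_ae (Eventually.of_forall fun ω => (smoothLoss_pos _).le)
        (hFm t)
    have hft : (∫⁻ ω, ENNReal.ofReal (F t ω) ∂μ) ≠ ⊤ :=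
      ((hasFiniteIntegral_iff_ofReal (Eventually.of_forall fun ω => (smoothLoss_pos _).le)).1
        (hFi t).2).ne
    simp only [e]
    refine ENNReal.toReal_mono hft ?_
    have h1 := hmin (fun ω => ζ ω + t • ξ ω) (hζ.add (hξ.const_smul t))
    simpa only [F, X, zero_mul, add_zero, inner_add_left, real_inner_smul_left] using h1
  have h0 := hmin'.hasDerivAt_eq_zero hder.2
  have e : ∫ ω, (1 - g (X ω)) * (inner ℝ (ξ ω) (s ω) : ℝ) ∂μ =
      -∫ ω, (g (X ω + 0 * inner ℝ (ξ ω) (s ω)) - 1) * (inner ℝ (ξ ω) (s ω) : ℝ) ∂μ := by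
    rw [← integral_neg]
    refine integral_congr_ae (Eventually.of_forall fun ω => ?_)
    simp only [zero_mul, add_zero]
    ring
  rw [e, h0, neg_zero]

end Density

/-! ### An equivalent measure that makes all bounded portfolios centered -/

section MultiPeriod

variable {Ω : Type*} {mΩ : MeasurableSpace Ω} {P : Measure Ω} {T d : ℕ}
  {ℱ : Filtration (Fin (T + 1)) mΩ} {S : Fin (T + 1) → Ω → EuclideanSpace ℝ (Fin d)}

theorem NoArbitrage.one_period (hNA : NoArbitrage P ℱ S) (i : Fin T)
    {ξ : Ω → EuclideanSpace ℝ (Fin d)} (hξ : Measurable[ℱ i.castSucc] ξ)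
    (h : ∀ᵐ ω ∂P, 0 ≤ (inner ℝ (ξ ω) (increment S i ω) : ℝ)) :
    ∀ᵐ ω ∂P, (inner ℝ (ξ ω) (increment S i ω) : ℝ) = 0 := by
  let φ : Fin T → Ω → EuclideanSpace ℝ (Fin d) := fun j ω => if j = i then ξ ω else 0
  have hφ : IsStrategy ℱ φ := fun j => by
    by_cases hj : j = i
    · subst hj
      simpa [φ] using hξ
    · simp [φ, hj]
  have e : ∀ ω, terminalWealth S 0 φ ω = inner ℝ (ξ ω) (increment S i ω) := fun ω => by
    rw [terminalWealth, zero_add, Finset.sum_eq_single i]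
    · simp [φ]
    · intro j _ hj
      simp [φ, hj]
    · simp
  have := hNA φ hφ
  simp only [e] at this
  exact this h

/-- A finite measure under which all bounded one-period portfolios from the period `k` on are
centered. -/
theorem exists_centering_measure_from [IsFiniteMeasure P] (hS : ∀ t, Measurable[ℱ t] (S t)) {M : ℝ}
    (hM : ∀ i, ∀ᵐ ω ∂P, ‖increment S i ω‖ ≤ M) (hNA : NoArbitrage P ℱ S) (j : ℕ) (hj : j ≤ T) :
    ∃ Q : Measure Ω, IsFiniteMeasure Q ∧ Q ≪ P ∧ P ≪ Q ∧
      (∀ f : Ω → ENNReal, ∫⁻ ω, f ω ∂Q ≤ 2 ^ j * ∫⁻ ω, f ω ∂P) ∧ ∀ i : Fin T, T ≤ i + j →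
      ∀ ξ : Ω → EuclideanSpace ℝ (Fin d), Measurable[ℱ i.castSucc] ξ → ∀ B : ℝ,
        (∀ ω, ‖ξ ω‖ ≤ B) → ∫ ω, (inner ℝ (ξ ω) (increment S i ω) : ℝ) ∂Q = 0 := by
  induction j with
  | zero =>
    exact ⟨P, inferInstance, Measure.AbsolutelyContinuous.rfl, Measure.AbsolutelyContinuous.rfl,
      fun f => by simp, fun i hi => absurd i.2 (not_lt.2 hi)⟩
  | succ j ih =>
    obtain ⟨Q, hQf, hQP, hPQ, hQl, hQ⟩ := ih (by omega)
    -- The next earlier period. Its density `z` is known at the end of the period, so for later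
    -- periods `z ξ` is again an admissible bounded portfolio and the centering already achieved is
    -- kept.
    let k : Fin T := ⟨T - (j + 1), by omega⟩
    obtain ⟨z, hz, hz0, hz2, hzc⟩ := exists_density_of_noArbitrage (μ := Q)
      (ℱ.mono (Fin.castSucc_lt_succ (i := k)).le) (ℱ.le k.succ) (measurable_increment hS k)
      (hQP.ae_le (hM k)) fun ξ hξ h =>
        hQP.ae_le (hNA.one_period k hξ (hPQ.ae_le h))
    have hz' : Measurable z := hz.mono (ℱ.le _) le_rfl
    have hint : ∀ g : Ω → ℝ, ∫ ω, g ω ∂Q.withDensity (fun ω => ENNReal.ofReal (z ω)) =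
        ∫ ω, z ω * g ω ∂Q := fun g => by
      rw [integral_withDensity_eq_integral_toReal_smul hz'.ennreal_ofReal
        (Eventually.of_forall fun ω => ENNReal.ofReal_lt_top)]
      refine integral_congr_ae (Eventually.of_forall fun ω => ?_)
      simp only [smul_eq_mul]
      rw [ENNReal.toReal_ofReal (hz0 ω).le]
    refine ⟨Q.withDensity fun ω => ENNReal.ofReal (z ω), ?_,
      (withDensity_absolutelyContinuous _ _).trans hQP, hPQ.trans
        (withDensity_absolutelyContinuous' hz'.ennreal_ofReal.aemeasurable
          (Eventually.of_forall fun ω => (ENNReal.ofReal_pos.2 (hz0 ω)).ne')), fun f => ?_, ?_⟩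
    · refine isFiniteMeasure_withDensity ((lintegral_mono fun ω =>
        ENNReal.ofReal_le_ofReal (hz2 ω)).trans_lt ?_).ne
      rw [lintegral_const]
      exact ENNReal.mul_lt_top ENNReal.ofReal_lt_top (measure_lt_top _ _)
    · calc ∫⁻ ω, f ω ∂Q.withDensity (fun ω => ENNReal.ofReal (z ω))
          ≤ ∫⁻ ω, ENNReal.ofReal (z ω) * f ω ∂Q :=
            lintegral_withDensity_le_lintegral_mul _ hz'.ennreal_ofReal f
        _ ≤ ∫⁻ ω, 2 * f ω ∂Q := lintegral_mono fun ω => mul_le_mul_left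
            ((ENNReal.ofReal_le_ofReal (hz2 ω)).trans_eq (ENNReal.ofReal_ofNat 2)) _
        _ = 2 * ∫⁻ ω, f ω ∂Q := lintegral_const_mul' _ _ ENNReal.ofNat_ne_top
        _ ≤ 2 * (2 ^ j * ∫⁻ ω, f ω ∂P) := mul_le_mul_right (hQl f) _
        _ = _ := by rw [pow_succ]; ring
    · intro i hi ξ hξ B hB
      rw [hint]
      rcases eq_or_ne i k with rfl | hik
      · exact hzc ξ hξ B hB
      · have hki : k.succ ≤ i.castSucc := by
          have h1 : (i : ℕ) ≠ T - (j + 1) := fun h => hik (Fin.ext h)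
          rw [Fin.le_def, Fin.val_succ, Fin.val_castSucc]
          change T - (j + 1) + 1 ≤ (i : ℕ)
          omega
        have h1 := hQ i (by
          have h1 : (i : ℕ) ≠ T - (j + 1) := fun h => hik (Fin.ext h)
          omega) (fun ω => z ω • ξ ω) ((hz.mono (ℱ.mono hki) le_rfl).smul hξ) (2 * B)
          fun ω => by
            rw [norm_smul, Real.norm_of_nonneg (hz0 ω).le]
            exact mul_le_mul (hz2 ω) (hB ω) (norm_nonneg _) zero_le_two
        simpa only [real_inner_smul_left] using h1

/-- Without arbitrage there is an equivalent finite measure under which all bounded one-period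
portfolios are centered. -/
theorem exists_centering_measure [IsFiniteMeasure P] (hS : ∀ t, Measurable[ℱ t] (S t)) {M : ℝ}
    (hM : ∀ i, ∀ᵐ ω ∂P, ‖increment S i ω‖ ≤ M) (hNA : NoArbitrage P ℱ S) :
    ∃ Q : Measure Ω, IsFiniteMeasure Q ∧ Q ≪ P ∧ P ≪ Q ∧
      (∀ f : Ω → ENNReal, ∫⁻ ω, f ω ∂Q ≤ 2 ^ T * ∫⁻ ω, f ω ∂P) ∧ ∀ i : Fin T,
      ∀ ξ : Ω → EuclideanSpace ℝ (Fin d), Measurable[ℱ i.castSucc] ξ → ∀ B : ℝ,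
        (∀ ω, ‖ξ ω‖ ≤ B) → ∫ ω, (inner ℝ (ξ ω) (increment S i ω) : ℝ) ∂Q = 0 := by
  obtain ⟨Q, h1, h2, h3, h5, h4⟩ := exists_centering_measure_from hS hM hNA T le_rfl
  exact ⟨Q, h1, h2, h3, h5, fun i => h4 i (by omega)⟩

end MultiPeriod

/-! ### Mean profits and losses under a centering measure. -/

section MeanBounds

variable {E : Type*} [NormedAddCommGroup E] [InnerProductSpace ℝ E] [FiniteDimensional ℝ E]
  [MeasurableSpace E] [BorelSpace E] {Ω : Type*} {m mΩ : MeasurableSpace Ω} {μ : Measure Ω}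
  [IsFiniteMeasure μ] {s : Ω → E} {M : ℝ}

-- The decomposition of an integral into its parts, written without subtraction in `ENNReal`.
omit [IsFiniteMeasure μ] in
theorem ofReal_integral_add_ofReal {Y : Ω → ℝ} (hY : Integrable Y μ) :
    ENNReal.ofReal (∫ ω, Y ω ∂μ) + ∫⁻ ω, ENNReal.ofReal (-Y ω) ∂μ =
      ENNReal.ofReal (-∫ ω, Y ω ∂μ) + ∫⁻ ω, ENNReal.ofReal (Y ω) ∂μ := by
  have h1 : (∫⁻ ω, ENNReal.ofReal (Y ω) ∂μ) ≠ ⊤ := hY.lintegral_lt_top.ne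
  have h2 : (∫⁻ ω, ENNReal.ofReal (-Y ω) ∂μ) ≠ ⊤ := hY.neg.lintegral_lt_top.ne
  have e := integral_eq_lintegral_pos_part_sub_lintegral_neg_part hY
  rw [← ENNReal.toReal_eq_toReal_iff' (ENNReal.add_ne_top.2 ⟨ENNReal.ofReal_ne_top, h2⟩)
    (ENNReal.add_ne_top.2 ⟨ENNReal.ofReal_ne_top, h1⟩),
    ENNReal.toReal_add ENNReal.ofReal_ne_top h2, ENNReal.toReal_add ENNReal.ofReal_ne_top h1,
    ENNReal.toReal_ofReal', ENNReal.toReal_ofReal']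
  have h3 : max (∫ ω, Y ω ∂μ) 0 - max (-∫ ω, Y ω ∂μ) 0 = ∫ ω, Y ω ∂μ := max_zero_sub_eq_self _
  linarith

/-- On a set where everything is bounded, a centered gain does not change the mean. -/
theorem setLIntegral_parts_add_inner (hm : m ≤ mΩ) (hs : Measurable s)
    (hM : ∀ᵐ ω ∂μ, ‖s ω‖ ≤ M)
    (h0 : ∀ ξ : Ω → E, Measurable[m] ξ → ∀ B : ℝ, (∀ ω, ‖ξ ω‖ ≤ B) →
      ∫ ω, (inner ℝ (ξ ω) (s ω) : ℝ) ∂μ = 0)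
    {X : Ω → ℝ} (hX : Measurable[m] X) {ξ : Ω → E} (hξ : Measurable[m] ξ) {A : Set Ω}
    (hA : MeasurableSet[m] A) {B : ℝ} (hXB : ∀ ω ∈ A, |X ω| ≤ B) (hξB : ∀ ω ∈ A, ‖ξ ω‖ ≤ B) :
    ∫⁻ ω in A, ENNReal.ofReal (X ω) ∂μ +
        ∫⁻ ω in A, ENNReal.ofReal (-(X ω + inner ℝ (ξ ω) (s ω))) ∂μ =
      ∫⁻ ω in A, ENNReal.ofReal (-X ω) ∂μ +
        ∫⁻ ω in A, ENNReal.ofReal (X ω + inner ℝ (ξ ω) (s ω)) ∂μ := by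
  have hA' : MeasurableSet A := hm _ hA
  have hX' : Measurable X := hX.mono hm le_rfl
  have hXi : Integrable X (μ.restrict A) := by
    refine Integrable.of_bound hX'.aestronglyMeasurable B ?_
    exact (ae_restrict_iff' hA').2 (Eventually.of_forall hXB)
  have hη : Measurable[m] (A.indicator ξ) := hξ.indicator hA
  have hηB : ∀ ω, ‖A.indicator ξ ω‖ ≤ |B| := fun ω => by
    by_cases h : ω ∈ A
    · rw [indicator_of_mem h]
      exact (hξB ω h).trans (le_abs_self B)
    · rw [indicator_of_notMem h, norm_zero]
      exact abs_nonneg _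
  have e : (fun ω => (inner ℝ (A.indicator ξ ω) (s ω) : ℝ)) =
      A.indicator fun ω => (inner ℝ (ξ ω) (s ω) : ℝ) := by
    ext ω
    by_cases h : ω ∈ A
    · rw [indicator_of_mem h, indicator_of_mem h]
    · rw [indicator_of_notMem h, indicator_of_notMem h, inner_zero_left]
  have hgi : Integrable (fun ω => (inner ℝ (ξ ω) (s ω) : ℝ)) (μ.restrict A) := by
    have := integrable_inner_of_bounded hs hM (hη.mono hm le_rfl) hηB
    rw [e] at this
    exact (integrable_indicator_iff hA').1 this
  have hg0 : ∫ ω in A, (inner ℝ (ξ ω) (s ω) : ℝ) ∂μ = 0 := by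
    have := h0 _ hη _ hηB
    rwa [e, integral_indicator hA'] at this
  have hI : ∫ ω in A, (X ω + inner ℝ (ξ ω) (s ω)) ∂μ = ∫ ω in A, X ω ∂μ := by
    rw [integral_add hXi hgi, hg0, add_zero]
  have h1 := ofReal_integral_add_ofReal hXi
  have h2 := ofReal_integral_add_ofReal (hXi.add hgi)
  simp only [Pi.add_apply] at h2
  rw [hI] at h2
  rcases le_total 0 (∫ ω in A, X ω ∂μ) with h | h
  · rw [ENNReal.ofReal_of_nonpos (neg_nonpos.2 h), zero_add] at h1 h2
    rw [← h1, ← h2]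
    ring
  · rw [ENNReal.ofReal_of_nonpos h, zero_add] at h1 h2
    rw [h1, h2]
    ring

omit [IsFiniteMeasure μ] in
theorem lintegral_le_of_forall_setLIntegral_le {A : ℕ → Set Ω} (hA : Monotone A)
    (hU : ⋃ k, A k = univ) {f : Ω → ENNReal} {C : ENNReal}
    (h : ∀ k, ∫⁻ ω in A k, f ω ∂μ ≤ C) : ∫⁻ ω, f ω ∂μ ≤ C := by
  rw [← setLIntegral_univ, ← hU, setLIntegral_iUnion_of_directed _ hA.directed_le]
  exact iSup_le h

/-- Adding a gain that is centered under bounded portfolios increases the mean loss, and the mean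
profit grows at most by the mean loss. -/
theorem lintegral_parts_add_inner_le (hm : m ≤ mΩ) (hs : Measurable s)
    (hM : ∀ᵐ ω ∂μ, ‖s ω‖ ≤ M)
    (h0 : ∀ ξ : Ω → E, Measurable[m] ξ → ∀ B : ℝ, (∀ ω, ‖ξ ω‖ ≤ B) →
      ∫ ω, (inner ℝ (ξ ω) (s ω) : ℝ) ∂μ = 0)
    {X : Ω → ℝ} (hX : Measurable[m] X) {ξ : Ω → E} (hξ : Measurable[m] ξ) :
    ∫⁻ ω, ENNReal.ofReal (-X ω) ∂μ ≤
        ∫⁻ ω, ENNReal.ofReal (-(X ω + inner ℝ (ξ ω) (s ω))) ∂μ ∧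
      ∫⁻ ω, ENNReal.ofReal (X ω + inner ℝ (ξ ω) (s ω)) ∂μ ≤
        ∫⁻ ω, ENNReal.ofReal (X ω) ∂μ +
          ∫⁻ ω, ENNReal.ofReal (-(X ω + inner ℝ (ξ ω) (s ω))) ∂μ := by
  -- Centering is only known for bounded portfolios, so the argument is localised to events known
  -- beforehand that exhaust the space.
  let A : ℕ → Set Ω := fun k => {ω | |X ω| ≤ k} ∩ {ω | ‖ξ ω‖ ≤ k}
  have hAm : ∀ k, MeasurableSet[m] (A k) := fun k =>
    (measurableSet_le (continuous_abs.measurable.comp hX) measurable_const).inter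
      (measurableSet_le (measurable_norm.comp hξ) measurable_const)
  have hAmono : Monotone A := fun k l hkl ω hω =>
    ⟨le_trans (α := ℝ) hω.1 (Nat.cast_le.2 hkl), le_trans (α := ℝ) hω.2 (Nat.cast_le.2 hkl)⟩
  have hAU : ⋃ k, A k = univ := by
    refine eq_univ_of_forall fun ω => mem_iUnion.2 ?_
    obtain ⟨k, hk⟩ := exists_nat_ge (max |X ω| ‖ξ ω‖)
    exact ⟨k, (le_max_left _ _).trans hk, (le_max_right _ _).trans hk⟩
  constructor
  · refine lintegral_le_of_forall_setLIntegral_le hAmono hAU fun k => ?_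
    -- On `{X < 0}` the positive part of `X` vanishes, and the balance of means becomes the
    -- submartingale inequality for the losses.
    have hneg : MeasurableSet[m] {ω | X ω < 0} := measurableSet_lt hX measurable_const
    have h1 := setLIntegral_parts_add_inner hm hs hM h0 hX hξ ((hAm k).inter hneg) (B := k)
      (fun ω hω => hω.1.1) (fun ω hω => hω.1.2)
    have h2 : ∫⁻ ω in A k ∩ {ω | X ω < 0}, ENNReal.ofReal (X ω) ∂μ = 0 := by
      exact setLIntegral_eq_zero ((hm _ (hAm k)).inter (hm _ hneg)) fun ω hω =>
        ENNReal.ofReal_of_nonpos (le_of_lt hω.2)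
    have h3 : ∫⁻ ω in A k, ENNReal.ofReal (-X ω) ∂μ =
        ∫⁻ ω in A k ∩ {ω | X ω < 0}, ENNReal.ofReal (-X ω) ∂μ := by
      rw [← lintegral_inter_add_sdiff _ (A k) (hm _ hneg),
        setLIntegral_eq_zero ((hm _ (hAm k)).diff (hm _ hneg)) fun ω hω =>
          ENNReal.ofReal_of_nonpos (neg_nonpos.2 (not_lt.1 hω.2)), add_zero]
    rw [h3]
    rw [h2, zero_add] at h1
    exact (le_self_add.trans_eq h1.symm).trans (setLIntegral_le_lintegral _ _)
  · refine lintegral_le_of_forall_setLIntegral_le hAmono hAU fun k => ?_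
    have h1 := setLIntegral_parts_add_inner hm hs hM h0 hX hξ (hAm k) (B := k)
      (fun ω hω => hω.1) (fun ω hω => hω.2)
    exact (le_add_self.trans_eq h1.symm).trans
      (add_le_add (setLIntegral_le_lintegral _ _) (setLIntegral_le_lintegral _ _))

end MeanBounds

/-! ### Mean bounds for wealth at intermediate times. -/

section Wealth

variable {Ω : Type*} {mΩ : MeasurableSpace Ω} {Q : Measure Ω} [IsFiniteMeasure Q] {T d : ℕ}
  {ℱ : Filtration (Fin (T + 1)) mΩ} {S : Fin (T + 1) → Ω → EuclideanSpace ℝ (Fin d)}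
  {φ : Fin T → Ω → EuclideanSpace ℝ (Fin d)} {M : ℝ}

theorem lintegral_neg_wealthAt_le (hS : ∀ t, Measurable[ℱ t] (S t))
    (hM : ∀ i, ∀ᵐ ω ∂Q, ‖increment S i ω‖ ≤ M)
    (h0 : ∀ i : Fin T, ∀ ξ : Ω → EuclideanSpace ℝ (Fin d), Measurable[ℱ i.castSucc] ξ → ∀ B : ℝ,
      (∀ ω, ‖ξ ω‖ ≤ B) → ∫ ω, (inner ℝ (ξ ω) (increment S i ω) : ℝ) ∂Q = 0)
    (hφ : IsStrategy ℱ φ) (c : ℝ) (t : Fin (T + 1)) :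
    ∫⁻ ω, ENNReal.ofReal (-wealthAt S c φ t ω) ∂Q ≤
      ∫⁻ ω, ENNReal.ofReal (-terminalWealth S c φ ω) ∂Q := by
  induction t using Fin.reverseInduction with
  | last => rw [wealthAt_last]
  | cast i ih =>
    refine le_trans ?_ ih
    simp only [wealthAt_succ]
    exact (lintegral_parts_add_inner_le (ℱ.le _) ((measurable_increment hS i).mono (ℱ.le _) le_rfl)
      (hM i) (h0 i) (measurable_wealthAt hS hφ _) (hφ i)).1

/-- Each period adds at most the mean loss at its end, which is at most the terminal mean loss;
hence the factor `t`. -/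
theorem lintegral_wealthAt_le (hS : ∀ t, Measurable[ℱ t] (S t))
    (hM : ∀ i, ∀ᵐ ω ∂Q, ‖increment S i ω‖ ≤ M)
    (h0 : ∀ i : Fin T, ∀ ξ : Ω → EuclideanSpace ℝ (Fin d), Measurable[ℱ i.castSucc] ξ → ∀ B : ℝ,
      (∀ ω, ‖ξ ω‖ ≤ B) → ∫ ω, (inner ℝ (ξ ω) (increment S i ω) : ℝ) ∂Q = 0)
    (hφ : IsStrategy ℱ φ) (c : ℝ) (t : Fin (T + 1)) :
    ∫⁻ ω, ENNReal.ofReal (wealthAt S c φ t ω) ∂Q ≤ ENNReal.ofReal c * Q univ +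
      (t : ℕ) * ∫⁻ ω, ENNReal.ofReal (-terminalWealth S c φ ω) ∂Q := by
  induction t using Fin.induction with
  | zero => simp [wealthAt_zero]
  | succ i ih =>
    have h1 := (lintegral_parts_add_inner_le (ℱ.le _)
      ((measurable_increment hS i).mono (ℱ.le _) le_rfl)
      (hM i) (h0 i) (measurable_wealthAt hS hφ i.castSucc (c := c)) (hφ i)).2
    simp only [← wealthAt_succ] at h1
    refine (h1.trans (add_le_add ih (lintegral_neg_wealthAt_le hS hM h0 hφ c i.succ))).trans_eq ?_
    rw [Fin.val_castSucc, Fin.val_succ]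
    push_cast
    ring

end Wealth

/-! ### Semicontinuity of expected utility -/

section Semicontinuity

variable {Ω : Type*} {mΩ : MeasurableSpace Ω} {P : Measure Ω}

/-- Absolute continuity of the integral: the complements decrease to a null set. -/
theorem eventually_setLIntegral_compl_le [IsFiniteMeasure P] {G : ℕ → Set Ω}
    (hG : ∀ k, MeasurableSet (G k)) (hmono : Monotone G) (hae : ∀ᵐ ω ∂P, ∃ k, ω ∈ G k)
    {h : Ω → ENNReal} (hh : ∫⁻ ω, h ω ∂P ≠ ⊤) {ε : ENNReal} (hε : 0 < ε) :
    ∀ᶠ k in atTop, ∫⁻ ω in (G k)ᶜ, h ω ∂P ≤ ε := by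
  have h1 : Tendsto (fun k => P (G k)ᶜ) atTop (nhds (P (⋂ k, (G k)ᶜ))) :=
    tendsto_measure_iInter_atTop (fun k => (hG k).compl.nullMeasurableSet)
      (fun k l hkl => compl_subset_compl.2 (hmono hkl)) ⟨0, measure_ne_top _ _⟩
  have h2 : P (⋂ k, (G k)ᶜ) = 0 := by
    refine measure_mono_null (fun ω hω => ?_) hae
    rintro ⟨k, hk⟩
    exact mem_iInter.1 hω k hk
  rw [h2] at h1
  exact (tendsto_setLIntegral_zero hh h1).eventually (ge_mem_nhds hε)

variable [IsProbabilityMeasure P] {T d : ℕ}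
  {ℱ : Filtration (Fin (T + 1)) mΩ} {S : Fin (T + 1) → Ω → EuclideanSpace ℝ (Fin d)} {U : ℝ → ℝ}
  {c M : ℝ} {φ : ℕ → Fin T → Ω → EuclideanSpace ℝ (Fin d)}

/-- For a bounded sequence of strategies the wealth processes are bounded up to a set on which the
expected utilities are small. -/
theorem FiniteValue.exists_bounded_wealthAt (hfin : FiniteValue P ℱ S U) (hmono : Monotone U)
    (hcont : Continuous U) (hS : ∀ t, Measurable[ℱ t] (S t))
    (hM : ∀ i, ∀ᵐ ω ∂P, ‖increment S i ω‖ ≤ M)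
    (hφ : ∀ n, IsStrategy ℱ (φ n)) (hi : ∀ n, Integrable (fun ω => U (terminalWealth S c (φ n) ω)) P)
    (hb : ∀ᵐ ω ∂P, ∀ i, ∃ k : ℕ, ∀ n, ‖φ n i ω‖ ≤ k) {g : Ω → ℝ} (hg : Integrable g P)
    (t : Fin (T + 1)) : ∀ ε : ℝ, 0 < ε →
      ∃ A : Set Ω, MeasurableSet[ℱ t] A ∧ (∃ q : ℝ, ∀ᵐ ω ∂P, ω ∈ A → ∀ n, |wealthAt S c (φ n) t ω| ≤ q) ∧
        (∀ n, ∫ ω in Aᶜ, U (terminalWealth S c (φ n) ω) ∂P ≤ ε) ∧ ∫ ω in Aᶜ, |g ω| ∂P ≤ ε := by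
  induction t using Fin.induction with
  | zero =>
    intro ε hε
    refine ⟨univ, MeasurableSet.univ, ⟨|c|, Eventually.of_forall fun ω _ n => ?_⟩, fun n => ?_, ?_⟩
    · rw [wealthAt_zero]
    · simpa using hε.le
    · simpa using hε.le
  | succ i ih =>
    intro ε hε
    obtain ⟨A, hA, ⟨q, hq⟩, hAU, hAg⟩ := ih (ε / 2) (half_pos hε)
    obtain ⟨h, hh, hle⟩ := hfin.exists_setIntegral_le hmono hcont hS i.castSucc q
    -- The event is known at the start of the period. On the removed part `A ∩ (G k)ᶜ` the wealth is
    -- still at most `q`, so the utilities are dominated by `h`, whose integral there is small for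
    -- large `k`, uniformly in `n`.
    let G : ℕ → Set Ω := fun k => {ω | ∀ n, ‖φ n i ω‖ ≤ k}
    have hGm : ∀ k, MeasurableSet[ℱ i.castSucc] (G k) := fun k => by
      have e : G k = ⋂ n, {ω | ‖φ n i ω‖ ≤ k} := by ext; simp [G]
      rw [e]
      exact MeasurableSet.iInter fun n =>
        measurableSet_le (measurable_norm.comp (hφ n i)) measurable_const
    have hGm' : ∀ k, MeasurableSet (G k) := fun k => ℱ.le _ _ (hGm k)
    have hGmono : Monotone G := fun k l hkl ω (hω : ∀ n, ‖φ n i ω‖ ≤ k) n =>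
      (hω n).trans (Nat.cast_le.2 hkl)
    have hGae : ∀ᵐ ω ∂P, ∃ k, ω ∈ G k := hb.mono fun ω hω => hω i
    have hε2 : 0 < ENNReal.ofReal (ε / 2) := ENNReal.ofReal_pos.2 (half_pos hε)
    have hgl : ∫⁻ ω, ENNReal.ofReal |g ω| ∂P ≠ ⊤ := hg.abs.lintegral_lt_top.ne
    obtain ⟨k, hk1, hk2⟩ := ((eventually_setLIntegral_compl_le hGm' hGmono hGae hh.ne hε2).and
      (eventually_setLIntegral_compl_le hGm' hGmono hGae hgl hε2)).exists
    have hA' : MeasurableSet A := ℱ.le _ _ hA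
    have hsplit : ∀ f : Ω → ℝ, Integrable f P →
        ∫ ω in (A ∩ G k)ᶜ, f ω ∂P = ∫ ω in Aᶜ, f ω ∂P + ∫ ω in A ∩ (G k)ᶜ, f ω ∂P := fun f hf => by
      rw [← setIntegral_union _ (hA'.inter (hGm' k).compl) hf.integrableOn hf.integrableOn]
      · congr 2
        ext ω
        simp only [mem_compl_iff, mem_inter_iff, mem_union]
        tauto
      · exact disjoint_compl_left.mono_right inter_subset_left
    refine ⟨A ∩ G k, (ℱ.mono (Fin.castSucc_lt_succ (i := i)).le) _ (hA.inter (hGm k)),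
      ⟨q + k * M, ?_⟩, fun n => ?_, ?_⟩
    · filter_upwards [hq, hM i] with ω h1 h2 hω n
      rw [wealthAt_succ]
      refine (abs_add_le _ _).trans (add_le_add (h1 hω.1 n) ((abs_real_inner_le_norm _ _).trans ?_))
      exact mul_le_mul (hω.2 n) h2 (norm_nonneg _) (Nat.cast_nonneg _)
    · rw [hsplit _ (hi n)]
      refine (add_le_add (hAU n) ?_).trans_eq (add_halves ε)
      -- The bound `q` holds only almost everywhere on `A`, whereas the domination asks for it
      -- everywhere.
      let B : Set Ω := (A ∩ (G k)ᶜ) ∩ {ω | wealthAt S c (φ n) i.castSucc ω ≤ q}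
      have hB : MeasurableSet[ℱ i.castSucc] B := (hA.inter (hGm k).compl).inter
        (measurableSet_le (measurable_wealthAt hS (hφ n) _) measurable_const)
      have e : B =ᵐ[P] (A ∩ (G k)ᶜ : Set Ω) := by
        filter_upwards [hq] with ω hω
        refine propext ⟨fun h => h.1, fun h => ⟨h, (le_abs_self _).trans (hω h.1 n)⟩⟩
      rw [← setIntegral_congr_set e]
      refine (hle c (φ n) (hφ n) (hi n) B hB fun ω hω => hω.2).trans ?_
      refine ENNReal.toReal_le_of_le_ofReal (half_pos hε).le (le_trans ?_ hk1)
      exact lintegral_mono_set fun ω hω => hω.1.2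
    · rw [hsplit _ hg.abs]
      refine (add_le_add hAg ?_).trans_eq (add_halves ε)
      rw [integral_eq_lintegral_of_nonneg_ae (Eventually.of_forall fun ω => abs_nonneg _)
        hg.abs.1.restrict]
      refine ENNReal.toReal_le_of_le_ofReal (half_pos hε).le (le_trans ?_ hk2)
      exact lintegral_mono_set fun ω hω => hω.2

/-- Expected utility is upper semicontinuous along almost surely convergent strategies. -/
theorem FiniteValue.le_integral_of_tendsto (hfin : FiniteValue P ℱ S U) (hmono : Monotone U)
    (hcont : Continuous U) (hS : ∀ t, Measurable[ℱ t] (S t))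
    (hM : ∀ i, ∀ᵐ ω ∂P, ‖increment S i ω‖ ≤ M)
    (hφ : ∀ n, IsStrategy ℱ (φ n)) (hi : ∀ n, Integrable (fun ω => U (terminalWealth S c (φ n) ω)) P)
    {ψ : Fin T → Ω → EuclideanSpace ℝ (Fin d)}
    (hψ : Integrable (fun ω => U (terminalWealth S c ψ ω)) P)
    (hlim : ∀ᵐ ω ∂P, ∀ i, Tendsto (fun n => φ n i ω) atTop (nhds (ψ i ω))) {b : ℝ}
    (hb : ∀ᶠ n in atTop, b ≤ ∫ ω, U (terminalWealth S c (φ n) ω) ∂P) :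
    b ≤ ∫ ω, U (terminalWealth S c ψ ω) ∂P := by
  refine le_of_forall_pos_le_add fun ε hε => ?_
  have hbdd : ∀ᵐ ω ∂P, ∀ i, ∃ k : ℕ, ∀ n, ‖φ n i ω‖ ≤ k := by
    filter_upwards [hlim] with ω hω i
    obtain ⟨B, hB⟩ := (hω i).norm.bddAbove_range
    obtain ⟨k, hk⟩ := exists_nat_ge B
    exact ⟨k, fun n => (hB (mem_range_self n)).trans hk⟩
  -- On `A` the terminal wealths are uniformly bounded and dominated convergence applies; off `A`
  -- only a one-sided bound on the utilities is available, and it suffices.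
  obtain ⟨A, hA, ⟨q, hq⟩, hAU, hAg⟩ := hfin.exists_bounded_wealthAt hmono hcont hS hM hφ hi hbdd hψ
    (Fin.last T) (ε / 2) (half_pos hε)
  simp only [wealthAt_last] at hq
  have hA' : MeasurableSet A := ℱ.le _ _ hA
  have hwlim : ∀ᵐ ω ∂P, Tendsto (fun n => U (terminalWealth S c (φ n) ω)) atTop
      (nhds (U (terminalWealth S c ψ ω))) := by
    filter_upwards [hlim] with ω hω
    refine (hcont.tendsto _).comp (tendsto_const_nhds.add (tendsto_finsetSum _ fun i _ => ?_))
    exact (hω i).inner tendsto_const_nhds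
  have hAlim : Tendsto (fun n => ∫ ω in A, U (terminalWealth S c (φ n) ω) ∂P) atTop
      (nhds (∫ ω in A, U (terminalWealth S c ψ ω) ∂P)) := by
    refine tendsto_integral_of_dominated_convergence (fun _ => max |U q| |U (-q)|)
      (fun n => (hi n).1.restrict) (integrable_const _) (fun n => ?_) (ae_restrict_of_ae hwlim)
    rw [ae_restrict_iff' hA']
    filter_upwards [hq] with ω hω h
    obtain ⟨h1, h2⟩ := abs_le.1 (hω h n)
    rw [Real.norm_eq_abs, abs_le']
    exact ⟨((hmono h2).trans (le_abs_self _)).trans (le_max_left _ _),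
      ((neg_le_neg (hmono h1)).trans (neg_le_abs _)).trans (le_max_right _ _)⟩
  have h1 : b ≤ ε / 2 + ∫ ω in A, U (terminalWealth S c ψ ω) ∂P := by
    refine ge_of_tendsto (hAlim.const_add (ε / 2)) ?_
    filter_upwards [hb] with n hn
    rw [← integral_add_compl hA' (hi n)] at hn
    have := hAU n
    linarith
  have h2 : -∫ ω in Aᶜ, U (terminalWealth S c ψ ω) ∂P ≤ ε / 2 :=
    (neg_le_abs _).trans ((abs_integral_le_integral_abs).trans hAg)
  rw [← integral_add_compl hA' hψ]
  linarith

end Semicontinuity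

/-! ### Elasticity bounds -/

section Elasticity

variable {U : ℝ → ℝ}

theorem half_le_of_concaveOn (hconc : ConcaveOn ℝ univ U) (h0 : U 0 = 0) (x : ℝ) :
    U x / 2 ≤ U (x / 2) := by
  have hhalf : (0 : ℝ) ≤ 1 / 2 := by norm_num
  have h := hconc.2 (mem_univ x) (mem_univ 0) hhalf hhalf (by norm_num)
  simp only [smul_eq_mul, mul_zero, add_zero, h0] at h
  rw [div_eq_inv_mul, div_eq_inv_mul]
  simpa using h

/-- Either elasticity condition controls the gains from halving the position. -/
theorem exists_max_le_of_elasticity (hU : ElasticityAtTop U ∨ ElasticityAtBot U) :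
    ∃ p κ C : ℝ, 0 ≤ p ∧ 0 ≤ κ ∧ κ < 1 ∧
      ∀ x, max (U x) 0 ≤ p * U (x / 2) + κ * max (-U x) 0 + C := by
  rcases hU with ⟨hconc, hmono, h0, x₀, γ, hx₀, hγ0, hγ1, h⟩ | ⟨hconc, hmono, h0, x₀, α, hx₀, hα, h⟩
  · have hC : 0 ≤ U (2 * x₀) := h0.symm.trans_le (hmono (by linarith))
    have hp : (0 : ℝ) ≤ 2 ^ γ := by positivity
    -- The elasticity at `l = 2` gives `p = 2^γ` for large `x`. For negative `x`, concavity gives `U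
    -- (x/2) ≥ U x / 2`, which costs `κ = 2^γ / 2 < 1`; the constant covers `0 ≤ x ≤ 2 x₀`.
    refine ⟨2 ^ γ, 2 ^ γ / 2, U (2 * x₀), hp, by positivity, ?_, fun x => ?_⟩
    · rw [div_lt_one two_pos]
      calc (2 : ℝ) ^ γ < 2 ^ (1 : ℝ) := Real.rpow_lt_rpow_of_exponent_lt one_lt_two hγ1
        _ = 2 := Real.rpow_one 2
    · rcases le_total x 0 with hx | hx
      · have h1 : U x ≤ 0 := (hmono hx).trans_eq h0
        have h2 := mul_le_mul_of_nonneg_left (half_le_of_concaveOn hconc h0 x) hp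
        rw [max_eq_right h1, max_eq_left (neg_nonneg.2 h1)]
        linarith
      · have h1 : 0 ≤ U x := h0.symm.trans_le (hmono hx)
        have h2 : 0 ≤ U (x / 2) := h0.symm.trans_le (hmono (by linarith))
        rw [max_eq_left h1, max_eq_right (neg_nonpos.2 h1)]
        have h3 := mul_nonneg hp h2
        rcases le_total x (2 * x₀) with hx2 | hx2
        · have := hmono hx2
          linarith
        · have h4 := h (x / 2) 2 (by linarith) one_le_two
          rw [mul_div_cancel₀ x two_ne_zero] at h4
          linarith
  · have hκ : (0 : ℝ) ≤ 2 ^ (-α) := by positivity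
    have hx₀U : U x₀ ≤ 0 := (hmono hx₀).trans_eq h0
    -- Here concavity gives `p = 2` for positive `x`. For `x ≤ 2 x₀` the elasticity at `l = 2`,
    -- multiplied by `2^(-α)`, gives `κ = 2^(-α) < 1`; the constant covers `2 x₀ ≤ x ≤ 0`.
    refine ⟨2, 2 ^ (-α), -2 * U x₀, zero_le_two, hκ, ?_, fun x => ?_⟩
    · exact Real.rpow_lt_one_of_one_lt_of_neg one_lt_two (neg_neg_of_pos hα)
    · rcases le_total x 0 with hx | hx
      · have h1 : U x ≤ 0 := (hmono hx).trans_eq h0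
        have h2 := mul_nonneg hκ (neg_nonneg.2 h1)
        rw [max_eq_right h1, max_eq_left (neg_nonneg.2 h1)]
        rcases le_total (2 * x₀) x with hx2 | hx2
        · have := hmono (show x₀ ≤ x / 2 by linarith)
          linarith
        · have h4 := h (x / 2) 2 (by linarith) one_le_two
          rw [mul_div_cancel₀ x two_ne_zero] at h4
          have h5 := mul_le_mul_of_nonneg_left h4 hκ
          rw [← mul_assoc, ← Real.rpow_add two_pos,
            show -α + (1 + α) = 1 by ring, Real.rpow_one] at h5
          linarith
      · have h1 : 0 ≤ U x := h0.symm.trans_le (hmono hx)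
        have h2 := half_le_of_concaveOn hconc h0 x
        rw [max_eq_left h1, max_eq_right (neg_nonpos.2 h1)]
        linarith

/-- A concave strictly increasing function with `U 0 = 0` decreases at least linearly. -/
theorem neg_le_one_add_div (hconc : ConcaveOn ℝ univ U) (hmono : StrictMono U) (h0 : U 0 = 0)
    (x : ℝ) : -x ≤ 1 + max (-U x) 0 / -U (-1) := by
  have h1 : U (-1) < 0 := (hmono (by norm_num)).trans_eq h0
  have h2 : 0 ≤ max (-U x) 0 / -U (-1) := div_nonneg (le_max_right _ _) (neg_nonneg.2 h1.le)
  rcases le_total (-1) x with hx | hx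
  · linarith
  · have hx0 : 0 < -x := by linarith
    have ha : 0 ≤ 1 / (-x) := by positivity
    have hb : 0 ≤ 1 - 1 / (-x) := sub_nonneg.2 ((div_le_one hx0).2 (by linarith))
    have h := hconc.2 (mem_univ x) (mem_univ 0) ha hb (by ring)
    simp only [smul_eq_mul, mul_zero, add_zero, h0] at h
    rw [show 1 / -x * x = -1 by rw [one_div, inv_neg, neg_mul, inv_mul_cancel₀ (by linarith)],
      one_div, inv_mul_le_iff₀ hx0] at h
    have h3 : -x ≤ max (-U x) 0 / -U (-1) := by
      rw [le_div_iff₀ (by linarith)]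
      refine le_trans ?_ (le_max_left _ _)
      linarith
    linarith

end Elasticity

/-! ### Uniform bounds for strategies of nearly maximal utility. -/

section UniformBounds

variable {Ω : Type*} {mΩ : MeasurableSpace Ω} {P : Measure Ω} [IsProbabilityMeasure P] {T d : ℕ}
  {ℱ : Filtration (Fin (T + 1)) mΩ} {S : Fin (T + 1) → Ω → EuclideanSpace ℝ (Fin d)} {U : ℝ → ℝ}

/-- Strategies whose expected utility is bounded below have bounded expected disutility. -/
theorem FiniteValue.exists_integral_neg_le (hfin : FiniteValue P ℱ S U)
    (hU : ElasticityAtTop U ∨ ElasticityAtBot U) (hmono : Monotone U) (hcont : Continuous U)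
    (hconc : ConcaveOn ℝ univ U) (hS : ∀ t, Measurable[ℱ t] (S t)) (c b : ℝ) :
    ∃ K : ℝ, ∀ φ : Fin T → Ω → EuclideanSpace ℝ (Fin d), IsStrategy ℱ φ →
      Integrable (fun ω => U (terminalWealth S c φ ω)) P →
      b ≤ ∫ ω, U (terminalWealth S c φ ω) ∂P →
      ∫ ω, max (-U (terminalWealth S c φ ω)) 0 ∂P ≤ K := by
  obtain ⟨p, κ, C, hp, hκ0, hκ1, h⟩ := exists_max_le_of_elasticity hU
  -- Half the wealth is the wealth of half the strategy from capital `c / 2`, so its expected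
  -- utility is at most `C'`. With `E U⁺ ≤ p C' + κ E U⁻ + C` and `b ≤ E U⁺ - E U⁻`, the condition
  -- `κ < 1` lets one solve for `E U⁻`.
  obtain ⟨C', hC'⟩ := hfin.exists_integral_le hmono hcont hS (1 / 2 * c + 1 / 2 * 0)
  refine ⟨(p * C' + C - b) / (1 - κ), fun φ hφ hi hb => ?_⟩
  have hhalf : (0 : ℝ) ≤ 1 / 2 := by norm_num
  have hi0 : Integrable (fun ω => U (terminalWealth S 0 (fun _ _ => 0 : Fin T → Ω → _) ω)) P := by
    simp only [terminalWealth_zero]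
    exact integrable_const _
  have hic := (hfin.integrable_combo hmono hcont hconc hS hhalf hhalf (by norm_num) hφ
    isStrategy_zero hi hi0).1
  have hle := hC' _ (hφ.combo isStrategy_zero (1 / 2) (1 / 2))
    (by simpa only [terminalWealth_combo] using hic)
  simp only [terminalWealth_combo] at hle
  simp only [terminalWealth_zero, mul_zero, add_zero] at hle hic
  have e : ∀ x : ℝ, 1 / 2 * x = x / 2 := fun x => by ring
  simp only [e] at hle hic
  have hpos : Integrable (fun ω => max (U (terminalWealth S c φ ω)) 0) P := hi.pos_part
  have hneg : Integrable (fun ω => max (-U (terminalWealth S c φ ω)) 0) P := hi.neg_part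
  have h1 : ∫ ω, max (U (terminalWealth S c φ ω)) 0 ∂P ≤
      p * C' + κ * ∫ ω, max (-U (terminalWealth S c φ ω)) 0 ∂P + C := by
    have hsum : Integrable (fun ω => p * U (terminalWealth S c φ ω / 2) +
        κ * max (-U (terminalWealth S c φ ω)) 0) P := (hic.const_mul p).add (hneg.const_mul κ)
    have h2 : ∫ ω, max (U (terminalWealth S c φ ω)) 0 ∂P ≤
        ∫ ω, (p * U (terminalWealth S c φ ω / 2) + κ * max (-U (terminalWealth S c φ ω)) 0 + C) ∂P :=
      integral_mono hpos (hsum.add (integrable_const C)) fun ω => h (terminalWealth S c φ ω)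
    rw [integral_add hsum (integrable_const C), integral_add (hic.const_mul p) (hneg.const_mul κ),
      integral_const_mul, integral_const_mul, integral_const, probReal_univ, one_smul] at h2
    have h3 := mul_le_mul_of_nonneg_left hle hp
    linarith
  have h5 : ∫ ω, U (terminalWealth S c φ ω) ∂P = ∫ ω, max (U (terminalWealth S c φ ω)) 0 ∂P -
      ∫ ω, max (-U (terminalWealth S c φ ω)) 0 ∂P := by
    rw [← integral_sub hpos hneg]
    exact integral_congr_ae (Eventually.of_forall fun ω => (max_zero_sub_eq_self _).symm)
  rw [le_div_iff₀ (by linarith)]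
  linarith

/-- Strategies whose expected utility is bounded below have bounded expected losses. -/
theorem FiniteValue.exists_lintegral_neg_terminalWealth_le (hfin : FiniteValue P ℱ S U)
    (hU : ElasticityAtTop U ∨ ElasticityAtBot U) (hmono : StrictMono U) (hcont : Continuous U)
    (hconc : ConcaveOn ℝ univ U) (h0 : U 0 = 0) (hS : ∀ t, Measurable[ℱ t] (S t)) (c b : ℝ) :
    ∃ K : ℝ, ∀ φ : Fin T → Ω → EuclideanSpace ℝ (Fin d), IsStrategy ℱ φ →
      Integrable (fun ω => U (terminalWealth S c φ ω)) P →
      b ≤ ∫ ω, U (terminalWealth S c φ ω) ∂P →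
      ∫⁻ ω, ENNReal.ofReal (-terminalWealth S c φ ω) ∂P ≤ ENNReal.ofReal K := by
  obtain ⟨K, hK⟩ := hfin.exists_integral_neg_le hU hmono.monotone hcont hconc hS c b
  have h1 : 0 < -U (-1) := neg_pos.2 ((hmono (by norm_num)).trans_eq h0)
  refine ⟨1 + K / -U (-1), fun φ hφ hi hb => ?_⟩
  have hdiv : Integrable (fun ω => max (-U (terminalWealth S c φ ω)) 0 / -U (-1)) P :=
    hi.neg_part.div_const _
  have hneg : Integrable (fun ω => 1 + max (-U (terminalWealth S c φ ω)) 0 / -U (-1)) P :=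
    (integrable_const 1).add hdiv
  have hnn : ∀ ω, 0 ≤ 1 + max (-U (terminalWealth S c φ ω)) 0 / -U (-1) := fun ω =>
    add_nonneg zero_le_one (div_nonneg (le_max_right _ _) h1.le)
  calc ∫⁻ ω, ENNReal.ofReal (-terminalWealth S c φ ω) ∂P
      ≤ ∫⁻ ω, ENNReal.ofReal (1 + max (-U (terminalWealth S c φ ω)) 0 / -U (-1)) ∂P :=
        lintegral_mono fun ω => ENNReal.ofReal_le_ofReal (neg_le_one_add_div hconc hmono h0 _)
    _ = ENNReal.ofReal (∫ ω, (1 + max (-U (terminalWealth S c φ ω)) 0 / -U (-1)) ∂P) :=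
        (ofReal_integral_eq_lintegral_ofReal hneg (Eventually.of_forall hnn)).symm
    _ ≤ ENNReal.ofReal (1 + K / -U (-1)) := by
        refine ENNReal.ofReal_le_ofReal ?_
        rw [integral_add (integrable_const 1) hdiv, integral_div]
        have := div_le_div_of_nonneg_right (hK φ hφ hi hb) h1.le
        simpa using this

/-- The gains over each period of the strategies whose expected utility is bounded below are bounded
in mean under a measure that makes bounded portfolios centered. -/
theorem exists_lintegral_gain_le {Q : Measure Ω} [IsFiniteMeasure Q] {M : ℝ}
    (hS : ∀ t, Measurable[ℱ t] (S t)) (hM : ∀ i, ∀ᵐ ω ∂Q, ‖increment S i ω‖ ≤ M)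
    (h0 : ∀ i : Fin T, ∀ ξ : Ω → EuclideanSpace ℝ (Fin d), Measurable[ℱ i.castSucc] ξ → ∀ B : ℝ,
      (∀ ω, ‖ξ ω‖ ≤ B) → ∫ ω, (inner ℝ (ξ ω) (increment S i ω) : ℝ) ∂Q = 0) (c : ℝ)
    {N : ENNReal} (hN : N ≠ ⊤) :
    ∃ K : ENNReal, K ≠ ⊤ ∧ ∀ φ : Fin T → Ω → EuclideanSpace ℝ (Fin d), IsStrategy ℱ φ →
      ∫⁻ ω, ENNReal.ofReal (-terminalWealth S c φ ω) ∂Q ≤ N → ∀ i,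
        ∫⁻ ω, ENNReal.ofReal (inner ℝ (φ i ω) (increment S i ω)) ∂Q ≤ K ∧
        ∫⁻ ω, ENNReal.ofReal (-(inner ℝ (φ i ω) (increment S i ω) : ℝ)) ∂Q ≤ K := by
  have hK : ENNReal.ofReal c * Q univ + T * N ≠ ⊤ := ENNReal.add_ne_top.2
    ⟨ENNReal.mul_ne_top ENNReal.ofReal_ne_top (measure_ne_top _ _),
      ENNReal.mul_ne_top (ENNReal.natCast_ne_top _) hN⟩
  refine ⟨ENNReal.ofReal c * Q univ + T * N + N, ENNReal.add_ne_top.2 ⟨hK, hN⟩,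
    fun φ hφ hφN i => ?_⟩
  have hneg : ∀ t, ∫⁻ ω, ENNReal.ofReal (-wealthAt S c φ t ω) ∂Q ≤ N := fun t =>
    (lintegral_neg_wealthAt_le hS hM h0 hφ c t).trans hφN
  have hpos : ∀ t : Fin (T + 1), ∫⁻ ω, ENNReal.ofReal (wealthAt S c φ t ω) ∂Q ≤
      ENNReal.ofReal c * Q univ + T * N := fun t =>
    (lintegral_wealthAt_le hS hM h0 hφ c t).trans (add_le_add le_rfl (mul_le_mul'
      (Nat.cast_le.2 (Nat.lt_succ_iff.1 t.2)) hφN))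
  have hm : ∀ t, Measurable (wealthAt S c φ t) := fun t =>
    (measurable_wealthAt hS hφ t).mono (ℱ.le _) le_rfl
  -- A gain is a difference of wealths, so its parts are bounded by a positive part of wealth at one
  -- end and a negative part at the other.
  have e : ∀ ω, (inner ℝ (φ i ω) (increment S i ω) : ℝ) =
      wealthAt S c φ i.succ ω - wealthAt S c φ i.castSucc ω := fun ω => by
    rw [wealthAt_succ]; ring
  constructor
  · calc ∫⁻ ω, ENNReal.ofReal (inner ℝ (φ i ω) (increment S i ω)) ∂Q
        ≤ ∫⁻ ω, (ENNReal.ofReal (wealthAt S c φ i.succ ω) +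
            ENNReal.ofReal (-wealthAt S c φ i.castSucc ω)) ∂Q := lintegral_mono fun ω => by
          rw [e, sub_eq_add_neg]
          exact ENNReal.ofReal_add_le
      _ ≤ _ := by
          rw [lintegral_add_left (hm _).ennreal_ofReal]
          exact add_le_add (hpos _) (hneg _)
  · calc ∫⁻ ω, ENNReal.ofReal (-(inner ℝ (φ i ω) (increment S i ω) : ℝ)) ∂Q
        ≤ ∫⁻ ω, (ENNReal.ofReal (wealthAt S c φ i.castSucc ω) +
            ENNReal.ofReal (-wealthAt S c φ i.succ ω)) ∂Q := lintegral_mono fun ω => by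
          rw [e, neg_sub, sub_eq_add_neg]
          exact ENNReal.ofReal_add_le
      _ ≤ _ := by
          rw [lintegral_add_left (hm _).ennreal_ofReal]
          exact add_le_add (hpos _) (hneg _)

end UniformBounds

/-! ### Existence of an optimal strategy -/

section Existence

variable {Ω : Type*} {mΩ : MeasurableSpace Ω} {P : Measure Ω} [IsProbabilityMeasure P] {T d : ℕ}
  {ℱ : Filtration (Fin (T + 1)) mΩ} {S : Fin (T + 1) → Ω → EuclideanSpace ℝ (Fin d)} {U : ℝ → ℝ}
  {M : ℝ}

/-- If the gains over all periods converge almost surely then the canonical representatives of the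
strategies converge along a common subsequence. -/
theorem exists_subseq_strategy_tendsto (hS : ∀ t, Measurable[ℱ t] (S t))
    (hM : ∀ i, ∀ᵐ ω ∂P, ‖increment S i ω‖ ≤ M) {y : ℕ → Fin T → Ω → EuclideanSpace ℝ (Fin d)}
    (hy : ∀ n, IsStrategy ℱ (y n))
    (h : ∀ᵐ ω ∂P, ∀ i, ∃ l : ℝ,
      Tendsto (fun n => (inner ℝ (y n i ω) (increment S i ω) : ℝ)) atTop (nhds l)) :
    ∃ σ : ℕ → ℕ, StrictMono σ ∧ ∃ ψ, IsStrategy ℱ ψ ∧ ∀ᵐ ω ∂P, ∀ i, Tendsto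
      (fun n => canonicalRep (ℱ i.castSucc) P (increment S i) ω (y (σ n) i ω)) atTop
        (nhds (ψ i ω)) := by
  -- Subsequences are extracted period by period; the limits already found survive further
  -- extraction.
  have hfs : ∀ s : Finset (Fin T), ∃ σ : ℕ → ℕ, StrictMono σ ∧
      ∃ ψ : Fin T → Ω → EuclideanSpace ℝ (Fin d), IsStrategy ℱ ψ ∧ ∀ᵐ ω ∂P, ∀ i ∈ s, Tendsto
        (fun n => canonicalRep (ℱ i.castSucc) P (increment S i) ω (y (σ n) i ω)) atTop
          (nhds (ψ i ω)) := by
    intro s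
    induction s using Finset.induction with
    | empty => exact ⟨_root_.id, strictMono_id, fun _ _ => 0, isStrategy_zero, by simp⟩
    | insert i s his ih =>
      obtain ⟨σ, hσ, ψ, hψ, hl⟩ := ih
      obtain ⟨τ, hτ, ζ, hζ, hζl⟩ := exists_subseq_canonicalRep_tendsto (μ := P)
        (ℱ.le i.castSucc) ((measurable_increment hS i).mono (ℱ.le _) le_rfl) (hM i)
        (ξ := fun n => y (σ n) i) (fun n => hy _ i) (by
          filter_upwards [h] with ω hω
          obtain ⟨l, hl⟩ := hω i
          exact ⟨l, hl.comp hσ.tendsto_atTop⟩)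
      refine ⟨σ ∘ τ, hσ.comp hτ, Function.update ψ i ζ, fun j => ?_, ?_⟩
      · rcases eq_or_ne j i with rfl | hj
        · rw [Function.update_self]
          exact hζ
        · rw [Function.update_of_ne hj]
          exact hψ j
      · filter_upwards [hl, hζl] with ω h1 h2 j hj
        rcases eq_or_ne j i with rfl | hji
        · rw [Function.update_self]
          exact h2
        · rw [Function.update_of_ne hji]
          exact (h1 j (Finset.mem_of_mem_insert_of_ne hj hji)).comp hτ.tendsto_atTop
  obtain ⟨σ, hσ, ψ, hψ, hl⟩ := hfs Finset.univ
  exact ⟨σ, hσ, ψ, hψ, hl.mono fun ω hω i => hω i (Finset.mem_univ i)⟩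

/-- Without arbitrage, a strategy that maximises expected utility exists. -/
theorem FiniteValue.exists_isIntegrableOptimal (hfin : FiniteValue P ℱ S U)
    (hU : ElasticityAtTop U ∨ ElasticityAtBot U) (hmono : StrictMono U) (hcont : Continuous U)
    (hconc : ConcaveOn ℝ univ U) (h0 : U 0 = 0) (hS : ∀ t, Measurable[ℱ t] (S t))
    (hM : ∀ i, ∀ᵐ ω ∂P, ‖increment S i ω‖ ≤ M) (hNA : NoArbitrage P ℱ S) (c : ℝ) :
    ∃ φ, IsIntegrableOptimal P ℱ S U c φ := by
  let 𝒮 := Fin T → Ω → EuclideanSpace ℝ (Fin d)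
  let 𝒞 : ℝ → Set 𝒮 := fun b => {φ | IsStrategy ℱ φ ∧
    Integrable (fun ω => U (terminalWealth S c φ ω)) P ∧ b ≤ ∫ ω, U (terminalWealth S c φ ω) ∂P}
  have hconv : ∀ b, Convex ℝ (𝒞 b) := by
    rintro b φ ⟨h1, h2, h3⟩ ψ ⟨h1', h2', h3'⟩ α β hα hβ hαβ
    obtain ⟨h4, h5⟩ := hfin.integrable_combo hmono.monotone hcont hconc hS hα hβ hαβ h1 h1' h2 h2'
    simp only [← terminalWealth_combo] at h4 h5
    rw [← add_mul, hαβ, one_mul] at h4 h5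
    refine ⟨h1.combo h1' α β, h4, le_trans ?_ h5⟩
    calc b = α * b + β * b := by rw [← add_mul, hαβ, one_mul]
      _ ≤ _ := add_le_add (mul_le_mul_of_nonneg_left h3 hα) (mul_le_mul_of_nonneg_left h3' hβ)
  let V : Set ℝ := {r | ∃ φ : 𝒮, IsStrategy ℱ φ ∧
    Integrable (fun ω => U (terminalWealth S c φ ω)) P ∧ r = ∫ ω, U (terminalWealth S c φ ω) ∂P}
  have hVne : V.Nonempty := ⟨_, fun _ _ => 0, isStrategy_zero, by
    simp only [terminalWealth_zero]; exact integrable_const _, rfl⟩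
  have hVbdd : BddAbove V := by
    obtain ⟨C, hC⟩ := hfin.exists_integral_le hmono.monotone hcont hS c
    refine ⟨C, ?_⟩
    rintro _ ⟨φ, hφ, hi, rfl⟩
    exact hC φ hφ hi
  have hex : ∀ n : ℕ, ∃ φ : 𝒮, φ ∈ 𝒞 (sSup V - 1 / ((n : ℝ) + 1)) := fun n => by
    have hn : (0 : ℝ) < 1 / ((n : ℝ) + 1) := by positivity
    obtain ⟨_, ⟨φ, hφ, hi, rfl⟩, hlt⟩ := exists_lt_of_lt_csSup hVne (sub_lt_self (sSup V) hn)
    exact ⟨φ, hφ, hi, hlt.le⟩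
  choose x hx using hex
  have h𝒞mono : ∀ b b', b ≤ b' → 𝒞 b' ⊆ 𝒞 b := fun b b' hbb φ hφ =>
    ⟨hφ.1, hφ.2.1, hbb.trans hφ.2.2⟩
  have hone : ∀ n : ℕ, sSup V - 1 ≤ sSup V - 1 / ((n : ℝ) + 1) := fun n => by
    refine sub_le_sub_left ?_ _
    rw [div_le_one (by positivity)]
    exact le_add_of_nonneg_left (Nat.cast_nonneg _)
  have hx1 : ∀ n, x n ∈ 𝒞 (sSup V - 1) := fun n => h𝒞mono _ _ (hone n) (hx n)
  have hhull : convexHull ℝ (range x) ⊆ 𝒞 (sSup V - 1) :=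
    convexHull_min (by rintro _ ⟨n, rfl⟩; exact hx1 n) (hconv _)
  obtain ⟨K, hK⟩ := hfin.exists_lintegral_neg_terminalWealth_le hU hmono hcont hconc h0 hS c
    (sSup V - 1)
  obtain ⟨Q, hQf, hQP, hPQ, hQl, hQc⟩ := exists_centering_measure hS hM hNA
  obtain ⟨K', hK', hgain⟩ := exists_lintegral_gain_le hS (fun i => hQP.ae_le (hM i)) hQc c
    (N := 2 ^ T * ENNReal.ofReal K)
    (ENNReal.mul_ne_top (ENNReal.pow_ne_top ENNReal.ofNat_ne_top) ENNReal.ofReal_ne_top)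
  have hgain' : ∀ φ ∈ 𝒞 (sSup V - 1), ∀ i,
      ∫⁻ ω, ENNReal.ofReal (inner ℝ (φ i ω) (increment S i ω)) ∂Q ≤ K' ∧
        ∫⁻ ω, ENNReal.ofReal (-(inner ℝ (φ i ω) (increment S i ω) : ℝ)) ∂Q ≤ K' := fun φ hφ =>
    hgain φ hφ.1 ((hQl _).trans (mul_le_mul_right (hK φ hφ.1 hφ.2.1 hφ.2.2) _))
  let L : 𝒮 →ₗ[ℝ] (Fin T → Ω → ℝ) :=
    { toFun := fun φ i ω => inner ℝ (φ i ω) (increment S i ω)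
      map_add' := fun φ ψ => by ext; exact inner_add_left _ _ _
      map_smul' := fun r φ => by ext; exact real_inner_smul_left _ _ _ }
  have hLm : ∀ φ ∈ 𝒞 (sSup V - 1), ∀ i, Measurable (L φ i) := fun φ hφ i =>
    (measurable_gain hS i (hφ.1 i)).mono (ℱ.le _) le_rfl
  obtain ⟨y, hy, hyl⟩ := exists_convexHull_tendsto_of_neg_bounded (μ := Q) L x hK'
    (fun φ hφ => hLm φ (hhull hφ)) (fun n i => (hgain' _ (hx1 n) i).2) (fun ε hε => by
      obtain ⟨a, ha⟩ := measure_lt_le_of_lintegral_le (μ := Q) hK' hε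
      exact ⟨a, fun φ hφ i => ha _ (hLm φ (hhull hφ) i) (hgain' φ (hhull hφ) i).1⟩)
  -- Superlevel sets are convex, so combinations of the tail from `n` on are as good as the `n`-th
  -- bound.
  have hy𝒞 : ∀ n : ℕ, y n ∈ 𝒞 (sSup V - 1 / ((n : ℝ) + 1)) := fun n => by
    refine convexHull_min ?_ (hconv _) (hy n)
    rintro _ ⟨k, hk, rfl⟩
    refine h𝒞mono _ _ (sub_le_sub_left (one_div_le_one_div_of_le (by positivity) ?_) _) (hx k)
    exact add_le_add (Nat.cast_le.2 hk) le_rfl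
  obtain ⟨σ, hσ, ψ, hψ, hl⟩ := exists_subseq_strategy_tendsto hS hM (fun n => (hy𝒞 n).1)
    (hPQ.ae_le hyl)
  let φ : ℕ → 𝒮 := fun n i ω => canonicalRep (ℱ i.castSucc) P (increment S i) ω (y (σ n) i ω)
  have hφ : ∀ n, IsStrategy ℱ (φ n) := fun n i =>
    measurable_canonicalRep _ ((hy𝒞 (σ n)).1 i)
  -- Canonical representatives earn the same gains, so the utilities are unchanged while the
  -- portfolios now converge.
  have hwe : ∀ᵐ ω ∂P, ∀ n, terminalWealth S c (φ n) ω = terminalWealth S c (y (σ n)) ω := by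
    have h1 : ∀ᵐ ω ∂P, ∀ i, ∀ v, (inner ℝ (canonicalRep (ℱ i.castSucc) P (increment S i) ω v)
        (increment S i ω) : ℝ) = inner ℝ v (increment S i ω) := ae_all_iff.2 fun i =>
      inner_canonicalRep (ℱ.le _) ((measurable_increment hS i).mono (ℱ.le _) le_rfl) (hM i)
    filter_upwards [h1] with ω hω n
    simp only [terminalWealth, φ, hω]
  have hue : ∀ n, (fun ω => U (terminalWealth S c (y (σ n)) ω)) =ᵐ[P]
      fun ω => U (terminalWealth S c (φ n) ω) := fun n =>
    hwe.mono fun ω hω => by simp only [hω n]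
  have hφi : ∀ n, Integrable (fun ω => U (terminalWealth S c (φ n) ω)) P := fun n =>
    (hy𝒞 (σ n)).2.1.congr (hue n)
  have hφb : ∀ n, sSup V - 1 / ((σ n : ℝ) + 1) ≤ ∫ ω, U (terminalWealth S c (φ n) ω) ∂P := fun n =>
    (hy𝒞 (σ n)).2.2.trans_eq (integral_congr_ae (hue n))
  -- Fatou carries the uniform bound on the negative parts over to the limit.
  have hψi : Integrable (fun ω => U (terminalWealth S c ψ ω)) P := by
    obtain ⟨K₂, hK₂⟩ := hfin.exists_integral_neg_le hU hmono.monotone hcont hconc hS c (sSup V - 1)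
    refine hfin.integrable_utility hmono.monotone hcont hS hψ ?_
    refine lt_of_le_of_lt ?_ (ENNReal.ofReal_lt_top (r := K₂))
    calc ∫⁻ ω, ENNReal.ofReal (-U (terminalWealth S c ψ ω)) ∂P
        = ∫⁻ ω, liminf (fun n => ENNReal.ofReal (-U (terminalWealth S c (φ n) ω))) atTop ∂P := by
          refine lintegral_congr_ae ?_
          filter_upwards [hl] with ω hω
          have h1 : Tendsto (fun n => terminalWealth S c (φ n) ω) atTop
              (nhds (terminalWealth S c ψ ω)) :=
            tendsto_const_nhds.add (tendsto_finsetSum _ fun i _ =>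
              (hω i).inner tendsto_const_nhds)
          exact ((ENNReal.continuous_ofReal.tendsto _).comp
            ((hcont.tendsto _).comp h1).neg).liminf_eq.symm
      _ ≤ liminf (fun n => ∫⁻ ω, ENNReal.ofReal (-U (terminalWealth S c (φ n) ω)) ∂P) atTop :=
          lintegral_liminf_le fun n => (hcont.measurable.comp
            (measurable_terminalWealth hS c (hφ n))).neg.ennreal_ofReal
      _ ≤ liminf (fun _ : ℕ => ENNReal.ofReal K₂) atTop := by
          refine liminf_le_liminf (Eventually.of_forall fun n => ?_)
          have h2 := hK₂ (φ n) (hφ n) (hφi n) ((hone _).trans (hφb n))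
          refine le_trans (le_of_eq ?_) (ENNReal.ofReal_le_ofReal h2)
          rw [ofReal_integral_eq_lintegral_ofReal (hφi n).neg_part
            (Eventually.of_forall fun ω => le_max_right _ _)]
          refine lintegral_congr fun ω => ?_
          rw [ENNReal.ofReal_max, ENNReal.ofReal_zero, max_eq_left zero_le]
      _ = ENNReal.ofReal K₂ := liminf_const _
  refine ⟨ψ, hψ, hψi, fun χ hχ hχi => (le_csSup hVbdd ⟨χ, hχ, hχi, rfl⟩).trans ?_⟩
  refine le_of_forall_pos_le_add fun ε hε => ?_
  have hev : ∀ᶠ n : ℕ in atTop, 1 / ((σ n : ℝ) + 1) < ε :=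
    ((tendsto_one_div_add_atTop_nhds_zero_nat (𝕜 := ℝ)).comp hσ.tendsto_atTop).eventually
      (gt_mem_nhds hε)
  have := hfin.le_integral_of_tendsto hmono.monotone hcont hS hM hφ hφi hψi hl (b := sSup V - ε)
    (hev.mono fun n hn => le_trans (by linarith) (hφb n))
  linarith

end Existence

end UtilityMax

end

/-! ### Conclusion: the optimal strategy and its martingale density. -/

theorem theorem6p2 {Ω : Type*} {mΩ : MeasurableSpace Ω} (P : Measure Ω) [IsProbabilityMeasure P]
    (T d : ℕ) (ℱ : Filtration (Fin (T + 1)) mΩ)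
    (hnull : ∀ A : Set Ω, MeasurableSet A → P A = 0 → MeasurableSet[ℱ 0] A)
    (S : Fin (T + 1) → Ω → EuclideanSpace ℝ (Fin d))
    (hadapted : ∀ t, Measurable[ℱ t] (S t))
    (hbdd : ∃ M : ℝ, ∀ t, ∀ᵐ ω ∂P, ‖S t ω‖ ≤ M)
    (U : ℝ → ℝ)
    (hU : UtilityMax.ElasticityAtTop U ∨ UtilityMax.ElasticityAtBot U)
    (hmono : StrictMono U) (hC1 : ContDiff ℝ 1 U)
    (hNA : UtilityMax.NoArbitrage P ℱ S)
    (hfin : UtilityMax.FiniteValue P ℱ S U)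
    (c : ℝ) :
    (∃ φ, UtilityMax.IsOptimal P ℱ S U c φ) ∧
    ∀ φ, UtilityMax.IsOptimal P ℱ S U c φ →
      Integrable (fun ω => deriv U (UtilityMax.terminalWealth S c φ ω)) P ∧
      0 < ∫ ω, deriv U (UtilityMax.terminalWealth S c φ ω) ∂P ∧
      UtilityMax.IsEquivMartingaleMeasure P (UtilityMax.marginalUtilityMeasure P S U c φ) ℱ S := by
  obtain ⟨M, hM⟩ := hbdd
  have hconc : ConcaveOn ℝ univ U := hU.elim (fun h => h.1) fun h => h.1
  have h0 : U 0 = 0 := hU.elim (fun h => h.2.2.1) fun h => h.2.2.1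
  have hd : Differentiable ℝ U := hC1.differentiable one_ne_zero
  have hincr : ∀ i, ∀ᵐ ω ∂P, ‖UtilityMax.increment S i ω‖ ≤ M + M := fun i => by
    filter_upwards [hM i.succ, hM i.castSucc] with ω h1 h2
    exact (norm_sub_le _ _).trans (add_le_add h1 h2)
  refine ⟨?_, fun φ hφ => ?_⟩
  · obtain ⟨φ, h1, h2, h3⟩ := hfin.exists_isIntegrableOptimal hU hmono hC1.continuous hconc h0
      hadapted hincr hNA c
    exact ⟨φ, (hfin.isOptimal_iff hmono.monotone hC1.continuous hadapted).2 ⟨h1, h2, h3⟩⟩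
  · obtain ⟨h1, h2, h3⟩ := (hfin.isOptimal_iff hmono.monotone hC1.continuous hadapted).1 hφ
    exact UtilityMax.IsIntegrableOptimal.isEquivMartingaleMeasure ⟨h1, h2, h3⟩ hfin hmono hd hconc
      hadapted hM
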